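/- **Setting.** Let $\mathcal G=(\partial\colon E\to G,\triangleright)$ be a crossed module of finite-dimensional Lie groups (so $\partial(g\triangleright e)=g\,\partial(e)\,g^{-1}$ and $\partial(e)\triangleright f=efe^{-1}$), with Lie algebras $\mathfrak g,\mathfrak e$. *Squares and cubes.* A *square in $\mathcal G$* is a tuple $(X,Y,Z,W;e)$ (bottom, right, left, top edge in $G$, face $e\in E$) with $\partial(e)^{-1}XY=ZW$. Composition is horizontal (second factor to the right), with face $(X\triangleright e')e$, and vertical (second factor above), with face $e\,(Z\triangleright e')$; the edges are multiplied accordingly. $G$ acts by $g\triangleright(X,Y,Z,W;e)=(gXg^{-1},gYg^{-1},gZg^{-1},gWg^{-1};g\triangleright e)$. Put $\rho(X,Y,Z,W;e)=(Z^{-1},X,W,Y^{-1};Z^{-1}\triangleright e)$, $r_x(X,Y,Z,W;e)=(W,Y^{-1},Z^{-1},X;Z^{-1}\triangleright e^{-1})$ and $r_{xy}(X,Y,Z,W;e)=(Z,W,X,Y;e^{-1})$. A colouring $T$ of $[0,1]^3$ assigns elements of $G$ to the edges and elements of $E$ to the faces. It is *flat* if its six faces $T\circ\delta_i^\pm$ are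 squares in $\mathcal G$ and the homotopy addition equation holds: $T\circ\delta_3^+$ is the composite of the $3\times3$ array whose top, middle and bottom rows are $$(\,\cdot\,,\ T\circ\delta_2^+,\ \cdot\,),\qquad (\rho(T\circ\delta_1^-),\ T\circ\delta_3^-,\ r_{xy}(T\circ\delta_1^+)),\qquad (\,\cdot\,,\ r_x(T\circ\delta_2^-),\ \cdot\,),$$ where the corners are the thin squares (face $1_E$) whose outer edges are $1_G$ and whose inner edges match the neighbours. *Bundle and connection.* Let $M$ be a smooth manifold with an open cover $\{U_i\}_{i\in I}$. A cubical $\mathcal G$-2-bundle is given by smooth maps $\phi_{ij}\colon U_i\cap U_j\to G$ and $\psi_{ijkl}\colon U_i\cap U_j\cap U_k\cap U_l\to E$ such that pointwise $(\psi,\phi)_{ijkl}=(\phi_{ij},\phi_{jl},\phi_{ik},\phi_{kl};\psi_{ijkl})$ is a square in $\mathcal G$; for any assignment of indices to the eight vertices of the cube, the induced colouring of the cube is flat; $\phi_{ii}=1$; and $\psi_{iijj}=\psi_{ijij}=1$. A connection in it consists of forms $A_i\in\Omega^1(U_i,\mathfrak g)$, $B_i\in\Omega^2(U_i,\mathfrak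 e)$, $\eta_{ij}\in\Omega^1(U_i\cap U_j,\mathfrak e)$ with $\partial(B_i)=dA_i+\tfrac12A_i\wedge^{\rm ad}A_i$, $\eta_{ii}=0$, $$A_j=\phi_{ij}^{-1}(A_i+\partial(\eta_{ij}))\phi_{ij}+\phi_{ij}^{-1}d\phi_{ij},\qquad B_j=\phi_{ij}^{-1}\triangleright\bigl(B_i+d\eta_{ij}+\tfrac12\eta_{ij}\wedge^{\rm ad}\eta_{ij}+A_i\wedge^{\triangleright}\eta_{ij}\bigr),$$ $$\eta_{ik}+\phi_{ik}\triangleright\eta_{kl}-\phi_{ik}\phi_{kl}\phi_{jl}^{-1}\triangleright\eta_{jl}-\phi_{ik}\phi_{kl}\phi_{jl}^{-1}\phi_{ij}^{-1}\triangleright\eta_{ij}=\psi_{ijkl}^{-1}d\psi_{ijkl}+\psi_{ijkl}^{-1}(A_i\triangleright\psi_{ijkl}).$$ Fix such a bundle with connection. *Local holonomy.* For a smooth $\gamma\colon[0,1]\to M$ let $g^A_\gamma(t)$ solve $g'=g\,A(\gamma')$, $g(0)=1$, and put $g^A_\gamma=g^A_\gamma(1)$. For a smooth $S\colon[0,1]^2\to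 M$, $\gamma_s(t)=\gamma^t(s)=S(t,s)$, let $\mathcal H^{(A,B)}(S)=(g^A_{\gamma_0},g^A_{\gamma^1},g^A_{\gamma^0},g^A_{\gamma_1};e(1))$, where $$e'(s)=e(s)\int_0^1\bigl(g^A_{\gamma^0}(s)\,g^A_{\gamma_s}(t)\bigr)\triangleright B(\partial_tS,\partial_sS)\,dt,\qquad e(0)=1 .$$ For $\gamma$ in $U_i\cap U_j$ let $\tau(\gamma_{ij})=(g^{A_i}_\gamma,\phi_{ij}(\gamma(1)),\phi_{ij}(\gamma(0)),g^{A_j}_\gamma;f(1))$, where $f'(z)=-f(z)\int_0^1g^{A_i+z\partial(\eta_{ij})}_\gamma(t)\triangleright\eta_{ij}(\gamma'(t))\,dt$, $f(0)=1$; put $\hat\tau(\gamma_{ij})=r_{xy}(\tau(\gamma_{ij}))$. *Global holonomy.* Let $\Gamma\colon[0,1]^2\to M$ be smooth. Let $\mathcal Q$ be a subdivision of $[0,1]^2$ into rectangles $Q_R$ by partitions of the two factors, with an index $i_R$ for each $R$ such that $\Gamma(Q_R)\subset U_{i_R}$. Restrictions of $\Gamma$ to rectangles and to edges are rescaled to $[0,1]^2$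 and $[0,1]$ and precomposed with a smooth monotone reparametrization $\theta$ of $[0,1]$ fixing the end points, in each coordinate. Then $\mathcal H(\Gamma,\mathcal Q)$ is the composite of the array of the squares $\mathcal H^{(A_{i_R},B_{i_R})}(\Gamma|_{Q_R})$ for the rectangles; $\hat\tau(\hat\gamma_{i_Ri_S})$ for the vertical edge between $R$ and its right neighbour $S$; $\tau(\gamma_{i_Ri_S})$ for the horizontal edge between $R$ and its upper neighbour $S$; and $(\psi,\phi)_{i_Ri_Si_Ti_V}(x)$ for the interior vertices, where $R,S,T,V$ are the lower left, lower right, upper left and upper right rectangles at the vertex and $x$ is its image. For a curve $\gamma$, a partition of $[0,1]$ with $\gamma_r$ the restriction of $\gamma$ to the $r$-th interval and $x_r$ its end point, and two assignments $q=(i_r)$, $q'=(i'_r)$, put $$\tau(\gamma,q,q')=\tau((\gamma_1)_{i_1i'_1})\,(\psi,\phi)_{i_1i_2i'_1i'_2}(x_1)\,\tau((\gamma_2)_{i_2i'_2})\cdots\tau((\gamma_s)_{i_si'_s})$$ (horizontal composite). **Theorem.** Let $\Gamma$ and $\mathcal Q$ be as above. 1. $\mathcal H(\Gamma,\mathcal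 Q)$ does not depend on $\theta$. 2. If $\mathcal Q_1$ arises from $\mathcal Q$ by adding one point to one of the two partitions, and each new rectangle gets the index of the rectangle of $\mathcal Q$ that contains it, then $\mathcal H(\Gamma,\mathcal Q_1)=\mathcal H(\Gamma,\mathcal Q)$. 3. Let $\mathcal Q'$ have the same subdivision as $\mathcal Q$, with indices $i'_R$ such that $\Gamma(Q_R)\subset U_{i_R}\cap U_{i'_R}$. Then there is a flat colouring $T$ of $[0,1]^3$ with $T\circ\delta_3^-=\mathcal H(\Gamma,\mathcal Q)$, $T\circ\delta_3^+=\mathcal H(\Gamma,\mathcal Q')$ and $T\circ\delta_i^\pm=\tau(\partial_i^\pm\Gamma,\partial_i^\pm\mathcal Q,\partial_i^\pm\mathcal Q')$ for $i=1,2$, where $\partial_i^\pm$ denotes the restriction to the corresponding side of $[0,1]^2$. 4. If moreover $\Gamma(\partial[0,1]^2)=\{x\}$, and on all rectangles along the boundary of $[0,1]^2$ the indices are $i_R=i$ and $i'_R=i'$ with fixed $i,i'$, then $$\mathcal H(\Gamma,\mathcal Q')=\phi_{ii'}(x)^{-1}\triangleright\mathcal H(\Gamma,\mathcal Q).$$ 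-/

import Mathlib

open Set Manifold
open scoped ContDiff Topology

noncomputable section

/-! ### Lie crossed modules -/

/-- A Lie crossed module `(∂ : E → G, ▷)`; `G` and `E` are Lie groups modelled on `VG` and `VE`.
`bd` is `∂`, and `act g e` is `g ▷ e`. The Lie algebras are the tangent spaces at `1`, which are
`VG` and `VE` by definition of `TangentSpace`. -/
structure LieCrossedModule (VG VE G E : Type*)
    [NormedAddCommGroup VG] [NormedSpace ℝ VG] [NormedAddCommGroup VE] [NormedSpace ℝ VE]
    [TopologicalSpace G] [ChartedSpace VG G] [Group G]
    [TopologicalSpace E] [ChartedSpace VE E] [Group E] where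
  bd : E →* G
  act : G →* MulAut E
  bd_act : ∀ g e, bd (act g e) = g * bd e * g⁻¹
  peiffer : ∀ e f, act (bd e) f = e * f * e⁻¹
  smooth_bd : ContMDiff 𝓘(ℝ, VE) 𝓘(ℝ, VG) ∞ bd
  smooth_act : ContMDiff (𝓘(ℝ, VG).prod 𝓘(ℝ, VE)) 𝓘(ℝ, VE) ∞ (fun p : G × E => act p.1 p.2)

section LieGroupCalculus

variable {VG G : Type*} [NormedAddCommGroup VG] [NormedSpace ℝ VG]
  [TopologicalSpace G] [ChartedSpace VG G] [Group G]

/-- The bracket of the Lie algebra of `G`. -/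
def lieBr (G : Type*) [TopologicalSpace G] [ChartedSpace VG G] [Group G] (X Y : VG) : VG :=
  Bracket.bracket (L := GroupLieAlgebra 𝓘(ℝ, VG) G) (M := GroupLieAlgebra 𝓘(ℝ, VG) G) X Y

/-- The adjoint action `g X g⁻¹`. -/
def adj (g : G) (X : VG) : VG :=
  mfderiv 𝓘(ℝ, VG) 𝓘(ℝ, VG) (fun k : G => g * k * g⁻¹) 1 X

/-- `f⁻¹ df` at the point `x`, evaluated on the tangent vector `v`. -/
def logDer {V M : Type*} [NormedAddCommGroup V] [NormedSpace ℝ V]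
    [TopologicalSpace M] [ChartedSpace V M] (f : M → G) (x : M)
    (v : TangentSpace 𝓘(ℝ, V) x) : VG :=
  mfderiv 𝓘(ℝ, V) 𝓘(ℝ, VG) (fun y => (f x)⁻¹ * f y) x v

/-- `g` solves `g' = g a` on `[0,1]` with `g 0 = 1`. -/
def IsPathExp (a : ℝ → VG) (g : ℝ → G) : Prop :=
  g 0 = 1 ∧ ∀ t ∈ Icc (0 : ℝ) 1,
    HasMFDerivWithinAt 𝓘(ℝ, ℝ) 𝓘(ℝ, VG) g (Icc 0 1) t
      ((1 : ℝ →L[ℝ] ℝ).smulRight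
        (mulInvariantVectorField (I := 𝓘(ℝ, VG)) (G := G) (a t) (g t) : VG))

open Classical in
/-- The path-ordered exponential of `a : [0,1] → Lie G`: the solution of `g' = g a`, `g 0 = 1`. -/
def pathExp (G : Type*) [TopologicalSpace G] [ChartedSpace VG G] [Group G]
    (a : ℝ → VG) : ℝ → G :=
  if h : ∃ g : ℝ → G, IsPathExp a g then h.choose else fun _ => 1

end LieGroupCalculus

namespace LieCrossedModule

variable {VG VE G E : Type*}
  [NormedAddCommGroup VG] [NormedSpace ℝ VG] [NormedAddCommGroup VE] [NormedSpace ℝ VE]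
  [TopologicalSpace G] [ChartedSpace VG G] [Group G]
  [TopologicalSpace E] [ChartedSpace VE E] [Group E]
  (C : LieCrossedModule VG VE G E)

/-- The differential `∂ : 𝔢 → 𝔤`. -/
def dbd (v : VE) : VG := mfderiv 𝓘(ℝ, VE) 𝓘(ℝ, VG) C.bd 1 v

/-- The induced action of `G` on `𝔢`. -/
def lact (g : G) (v : VE) : VE := mfderiv 𝓘(ℝ, VE) 𝓘(ℝ, VE) (fun e => C.act g e) 1 v

/-- The derived action of `𝔤` on `𝔢`. -/
def dact (X : VG) (v : VE) : VE :=
  mfderiv 𝓘(ℝ, VG) 𝓘(ℝ, VE) (fun g : G => C.lact g v) 1 X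

/-- `e⁻¹ (X ▷ e) ∈ 𝔢` for `X ∈ 𝔤` and `e ∈ E`. -/
def dactGroup (X : VG) (e : E) : VE :=
  mfderiv 𝓘(ℝ, VG) 𝓘(ℝ, VE) (fun g : G => e⁻¹ * C.act g e) 1 X

end LieCrossedModule

/-! ### Squares and cubes in a crossed module -/

/-- A colouring of the square: `X` bottom, `Y` right, `Z` left, `W` top edge (horizontal edges
directed to the right, vertical edges upwards), and `e` for the face. -/
@[ext] structure Sq (G E : Type*) where
  X : G
  Y : G
  Z : G
  W : G
  e : E

/-- A colouring of the cube `[0,1]³`; `false`, `true` stand for the coordinate values `0`, `1`.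
`p x₂ x₃`, `q x₁ x₃`, `r x₁ x₂` are the edges in the directions `1`, `2`, `3`,
and `f₁`, `f₂`, `f₃` are the faces orthogonal to these directions. -/
structure Cube (G E : Type*) where
  p : Bool → Bool → G
  q : Bool → Bool → G
  r : Bool → Bool → G
  f₁ : Bool → E
  f₂ : Bool → E
  f₃ : Bool → E

namespace Cube

variable {G E : Type*} (T : Cube G E)

/-- The face `∂₁^±`, with the coordinates `(x₂, x₃)`. -/
def face₁ (α : Bool) : Sq G E := ⟨T.q α false, T.r α true, T.r α false, T.q α true, T.f₁ α⟩

/-- The face `∂₂^±`, with the coordinates `(x₁, x₃)`. -/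
def face₂ (α : Bool) : Sq G E := ⟨T.p α false, T.r true α, T.r false α, T.p α true, T.f₂ α⟩

/-- The face `∂₃^±`, with the coordinates `(x₁, x₂)`. -/
def face₃ (α : Bool) : Sq G E := ⟨T.p false α, T.q true α, T.q false α, T.p true α, T.f₃ α⟩

end Cube

namespace LieCrossedModule

variable {VG VE G E : Type*}
  [NormedAddCommGroup VG] [NormedSpace ℝ VG] [NormedAddCommGroup VE] [NormedSpace ℝ VE]
  [TopologicalSpace G] [ChartedSpace VG G] [Group G]
  [TopologicalSpace E] [ChartedSpace VE E] [Group E]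
  (C : LieCrossedModule VG VE G E)

/-- A flat colouring of the square, i.e. a square in the crossed module. -/
def SqFlat (s : Sq G E) : Prop := (C.bd s.e)⁻¹ * s.X * s.Y = s.Z * s.W

/-- Horizontal composition, `s` on the left of `t` (used when `s.Y = t.Z`). -/
def hcomp (s t : Sq G E) : Sq G E := ⟨s.X * t.X, t.Y, s.Z, s.W * t.W, C.act s.X t.e * s.e⟩

/-- Vertical composition, `s` below `t` (used when `s.W = t.X`). -/
def vcomp (s t : Sq G E) : Sq G E := ⟨s.X, s.Y * t.Y, s.Z * t.Z, t.W, s.e * C.act s.Z t.e⟩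

/-- Anticlockwise rotation by a right angle. -/
def rot (s : Sq G E) : Sq G E := ⟨s.Z⁻¹, s.X, s.W, s.Y⁻¹, C.act s.Z⁻¹ s.e⟩

/-- Reflection that exchanges bottom and top. -/
def reflV (s : Sq G E) : Sq G E := ⟨s.W, s.Y⁻¹, s.Z⁻¹, s.X, C.act s.Z⁻¹ s.e⁻¹⟩

/-- The action of `G` on squares. -/
def gact (g : G) (s : Sq G E) : Sq G E :=
  ⟨g * s.X * g⁻¹, g * s.Y * g⁻¹, g * s.Z * g⁻¹, g * s.W * g⁻¹, C.act g s.e⟩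

end LieCrossedModule

namespace Sq

variable {G E : Type*} [Group G] [Group E]

/-- Reflection in the diagonal, `r_{xy}`. -/
def diag (s : Sq G E) : Sq G E := ⟨s.Z, s.W, s.X, s.Y, s.e⁻¹⟩

/-- The four thin corner squares. -/
def ulCorner (E : Type*) [Group E] (g : G) : Sq G E := ⟨g, g⁻¹, 1, 1, 1⟩

def llCorner (E : Type*) [Group E] (g : G) : Sq G E := ⟨1, g, 1, g, 1⟩

def urCorner (E : Type*) [Group E] (g : G) : Sq G E := ⟨g, 1, g, 1, 1⟩

def lrCorner (E : Type*) [Group E] (g : G) : Sq G E := ⟨1, 1, g⁻¹, g, 1⟩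

end Sq

namespace LieCrossedModule

variable {VG VE G E : Type*}
  [NormedAddCommGroup VG] [NormedSpace ℝ VG] [NormedAddCommGroup VE] [NormedSpace ℝ VE]
  [TopologicalSpace G] [ChartedSpace VG G] [Group G]
  [TopologicalSpace E] [ChartedSpace VE E] [Group E]
  (C : LieCrossedModule VG VE G E)

/-- The homotopy addition equation: the upper face `∂₃⁺` is the composite of the array with
`∂₃⁻` in the centre, the four side faces around it and thin squares in the corners. -/
def HomotopyAddition (T : Cube G E) : Prop :=
  T.face₃ true =
    C.vcomp
      (C.vcomp
        (C.hcomp (C.hcomp (Sq.llCorner E (T.r false false)⁻¹) (C.reflV (T.face₂ false)))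
          (Sq.lrCorner E (T.r true false)))
        (C.hcomp (C.hcomp (C.rot (T.face₁ false)) (T.face₃ false)) (T.face₁ true).diag))
      (C.hcomp (C.hcomp (Sq.ulCorner E (T.r false true)⁻¹) (T.face₂ true))
        (Sq.urCorner E (T.r true true)))

/-- A flat colouring of the cube. -/
def CubeFlat (T : Cube G E) : Prop :=
  (∀ α, C.SqFlat (T.face₁ α) ∧ C.SqFlat (T.face₂ α) ∧ C.SqFlat (T.face₃ α)) ∧
    C.HomotopyAddition T

/-- Composite `f 0, g 0, f 1, g 1, …, g (m-1), f m` from left to right. -/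
def hchain (f g : ℕ → Sq G E) : ℕ → Sq G E
  | 0 => f 0
  | k + 1 => C.hcomp (C.hcomp (hchain f g k) (g k)) (f (k + 1))

/-- Composite `f 0, g 0, f 1, g 1, …, g (m-1), f m` from the bottom to the top. -/
def vchain (f g : ℕ → Sq G E) : ℕ → Sq G E
  | 0 => f 0
  | k + 1 => C.vcomp (C.vcomp (vchain f g k) (g k)) (f (k + 1))

end LieCrossedModule

/-! ### Differential forms on a manifold -/

section Forms

variable {V M : Type*} [NormedAddCommGroup V] [NormedSpace ℝ V]
  [TopologicalSpace M] [ChartedSpace V M]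
  {F : Type*} [NormedAddCommGroup F] [NormedSpace ℝ F] {k : ℕ}

/-- Not necessarily smooth `F`-valued differential `k`-forms on `M` (modelled on `V`). -/
abbrev DForm (V M : Type*) [NormedAddCommGroup V] [NormedSpace ℝ V]
    [TopologicalSpace M] [ChartedSpace V M] (k : ℕ)
    (F : Type*) [NormedAddCommGroup F] [NormedSpace ℝ F] :=
  (x : M) → TangentSpace 𝓘(ℝ, V) x [⋀^Fin k]→L[ℝ] F

/-- The form in the chart at `x₀`: the pull-back along the inverse of the chart. -/
def chartForm (w : DForm V M k F) (x₀ : M) : V → V [⋀^Fin k]→L[ℝ] F := fun y =>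
  (w ((extChartAt 𝓘(ℝ, V) x₀).symm y)).compContinuousLinearMap
    (mfderiv 𝓘(ℝ, V) 𝓘(ℝ, V) (extChartAt 𝓘(ℝ, V) x₀).symm y)

/-- `w` is smooth on the open set `S`. -/
def SmoothFormOn (w : DForm V M k F) (S : Set M) : Prop :=
  ∀ x₀ : M, ContDiffOn ℝ ∞ (chartForm w x₀)
    ((extChartAt 𝓘(ℝ, V) x₀).target ∩ (extChartAt 𝓘(ℝ, V) x₀).symm ⁻¹' S)

/-- The exterior derivative, computed at `x` in the chart at `x`. -/
def dForm (w : DForm V M k F) : DForm V M (k + 1) F := fun x =>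
  (extDeriv (chartForm w x) (extChartAt 𝓘(ℝ, V) x x)).compContinuousLinearMap
    (mfderiv 𝓘(ℝ, V) 𝓘(ℝ, V) (extChartAt 𝓘(ℝ, V) x) x)

/-- The velocity of a curve `[0,1] → M`. -/
def vel (V : Type*) [NormedAddCommGroup V] [NormedSpace ℝ V] [ChartedSpace V M]
    (γ : ℝ → M) (t : ℝ) : TangentSpace 𝓘(ℝ, V) (γ t) :=
  mfderivWithin 𝓘(ℝ, ℝ) 𝓘(ℝ, V) γ (Icc 0 1) t (1 : ℝ)

/-- The pull-back of a 1-form to a curve. -/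
def pull₁ (A : DForm V M 1 F) (γ : ℝ → M) (t : ℝ) : F := A (γ t) ![vel V γ t]

/-- The pull-back of a 2-form to a square, evaluated on `(∂/∂t, ∂/∂s)`. -/
def pull₂ (B : DForm V M 2 F) (S : ℝ → ℝ → M) (t s : ℝ) : F :=
  B (S t s) ![vel V (fun t' => S t' s) t, vel V (fun s' => S t s') s]

end Forms

/-! ### Cubical 2-bundles with connection -/

/-- A cubical 2-bundle over `(M, U)`, given by its transition functions `φ i j` on
`U i ∩ U j` and `ψ i j k l` on `U i ∩ U j ∩ U k ∩ U l`. -/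
structure CubicalBundle (V : Type*) {VG VE G E M ι : Type*}
    [NormedAddCommGroup V] [NormedSpace ℝ V]
    [NormedAddCommGroup VG] [NormedSpace ℝ VG] [NormedAddCommGroup VE] [NormedSpace ℝ VE]
    [TopologicalSpace G] [ChartedSpace VG G] [Group G]
    [TopologicalSpace E] [ChartedSpace VE E] [Group E]
    [TopologicalSpace M] [ChartedSpace V M]
    (C : LieCrossedModule VG VE G E) (U : ι → Set M) where
  φ : ι → ι → M → G
  ψ : ι → ι → ι → ι → M → E
  smooth_φ : ∀ i j, ContMDiffOn 𝓘(ℝ, V) 𝓘(ℝ, VG) ∞ (φ i j) (U i ∩ U j)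
  smooth_ψ : ∀ i j k l,
    ContMDiffOn 𝓘(ℝ, V) 𝓘(ℝ, VE) ∞ (ψ i j k l) (U i ∩ U j ∩ U k ∩ U l)
  flat_sq : ∀ i j k l, ∀ x ∈ U i ∩ U j ∩ U k ∩ U l,
    C.SqFlat ⟨φ i j x, φ j l x, φ i k x, φ k l x, ψ i j k l x⟩
  /-- `v x₁ x₂ x₃` is the chart that sits at the vertex `(x₁, x₂, x₃)` of the cube. -/
  flat_cube : ∀ v : Bool → Bool → Bool → ι, ∀ x : M, (∀ a b c, x ∈ U (v a b c)) →
    C.CubeFlat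
      { p := fun b c => φ (v false b c) (v true b c) x
        q := fun a c => φ (v a false c) (v a true c) x
        r := fun a b => φ (v a b false) (v a b true) x
        f₁ := fun a => ψ (v a false false) (v a true false) (v a false true) (v a true true) x
        f₂ := fun b => ψ (v false b false) (v true b false) (v false b true) (v true b true) x
        f₃ := fun c => ψ (v false false c) (v true false c) (v false true c) (v true true c) x }
  φ_self : ∀ i, ∀ x ∈ U i, φ i i x = 1
  ψ_degen : ∀ i j, ∀ x ∈ U i ∩ U j, ψ i i j j x = 1 ∧ ψ i j i j x = 1

/-- A connection in a cubical 2-bundle: `A i`, `B i` are forms on `U i`, and `η i j` is a form on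
`U i ∩ U j`. For 1-forms `a`, `b` one has `½ (a ∧^ad a)(u,v) = [a u, a v]` and
`(a ∧^▷ b)(u,v) = a u ▷ b v - a v ▷ b u`. -/
structure CubicalBundle.Connection {V VG VE G E M ι : Type*}
    [NormedAddCommGroup V] [NormedSpace ℝ V]
    [NormedAddCommGroup VG] [NormedSpace ℝ VG] [NormedAddCommGroup VE] [NormedSpace ℝ VE]
    [TopologicalSpace G] [ChartedSpace VG G] [Group G]
    [TopologicalSpace E] [ChartedSpace VE E] [Group E]
    [TopologicalSpace M] [ChartedSpace V M]
    {C : LieCrossedModule VG VE G E} {U : ι → Set M} (𝓑 : CubicalBundle V C U) where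
  A : ι → DForm V M 1 VG
  B : ι → DForm V M 2 VE
  η : ι → ι → DForm V M 1 VE
  smooth_A : ∀ i, SmoothFormOn (A i) (U i)
  smooth_B : ∀ i, SmoothFormOn (B i) (U i)
  smooth_η : ∀ i j, SmoothFormOn (η i j) (U i ∩ U j)
  fake_curvature : ∀ i, ∀ x ∈ U i, ∀ u v : TangentSpace 𝓘(ℝ, V) x,
    C.dbd (B i x ![u, v]) = dForm (A i) x ![u, v] + lieBr G (A i x ![u]) (A i x ![v])
  η_self : ∀ i, ∀ x ∈ U i, η i i x = 0
  A_transition : ∀ i j, ∀ x ∈ U i ∩ U j, ∀ u : TangentSpace 𝓘(ℝ, V) x,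
    A j x ![u] =
      adj (𝓑.φ i j x)⁻¹ (A i x ![u] + C.dbd (η i j x ![u])) + logDer (𝓑.φ i j) x u
  B_transition : ∀ i j, ∀ x ∈ U i ∩ U j, ∀ u v : TangentSpace 𝓘(ℝ, V) x,
    B j x ![u, v] =
      C.lact (𝓑.φ i j x)⁻¹
        (B i x ![u, v] + dForm (η i j) x ![u, v]
          + lieBr E (η i j x ![u]) (η i j x ![v])
          + (C.dact (A i x ![u]) (η i j x ![v]) - C.dact (A i x ![v]) (η i j x ![u])))
  η_compat : ∀ i j k l, ∀ x ∈ U i ∩ U j ∩ U k ∩ U l, ∀ u : TangentSpace 𝓘(ℝ, V) x,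
    η i k x ![u] + C.lact (𝓑.φ i k x) (η k l x ![u])
      - C.lact (𝓑.φ i k x * 𝓑.φ k l x * (𝓑.φ j l x)⁻¹) (η j l x ![u])
      - C.lact (𝓑.φ i k x * 𝓑.φ k l x * (𝓑.φ j l x)⁻¹ * (𝓑.φ i j x)⁻¹) (η i j x ![u])
    = logDer (𝓑.ψ i j k l) x u + C.dactGroup (A i x ![u]) (𝓑.ψ i j k l x)

/-! ### Local holonomy -/

section LocalHolonomy

variable {V VG VE G E M : Type*} [NormedAddCommGroup V] [NormedSpace ℝ V]
  [NormedAddCommGroup VG] [NormedSpace ℝ VG] [NormedAddCommGroup VE] [NormedSpace ℝ VE]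
  [TopologicalSpace G] [ChartedSpace VG G] [Group G]
  [TopologicalSpace E] [ChartedSpace VE E] [Group E]
  [TopologicalSpace M] [ChartedSpace V M]
  (C : LieCrossedModule VG VE G E)

/-- The holonomy `g_γ` of a 1-form along a curve `[0,1] → M`. -/
def curveHol (G : Type*) [TopologicalSpace G] [ChartedSpace VG G] [Group G]
    (A : DForm V M 1 VG) (γ : ℝ → M) : G := pathExp G (pull₁ A γ) 1

/-- The surface-ordered exponential `e(1,1)` over `[0,1]²` of the pair of forms
`a₁ dt + a₂ ds`, `b dt ∧ ds`, i.e. the value at `s = 1` of the solution of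
`∂e/∂s = e ∫₀¹ (g_{γ^0}(s) g_{γ_s}(t)) ▷ b(t,s) dt`, `e = 1` at `s = 0`. -/
def surfExp (a₁ a₂ : ℝ → ℝ → VG) (b : ℝ → ℝ → VE) : E :=
  pathExp E (fun s => ∫ t in (0 : ℝ)..1,
    C.lact (pathExp G (fun s' => a₂ 0 s') s * pathExp G (fun t' => a₁ t' s) t) (b t s)) 1

/-- The holonomy of a local connection pair along a square `S : [0,1]² → M`. -/
def localHol (A : DForm V M 1 VG) (B : DForm V M 2 VE) (S : ℝ → ℝ → M) : Sq G E where
  X := curveHol G A (fun t => S t 0)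
  Y := curveHol G A (fun s => S 1 s)
  Z := curveHol G A (fun s => S 0 s)
  W := curveHol G A (fun t => S t 1)
  e := surfExp C (fun t s => pull₁ A (fun t' => S t' s) t)
    (fun t s => pull₁ A (fun s' => S t s') s) (pull₂ B S)

/-- The element `f_γ`: the surface-ordered exponential over `γ × id`, `(t,z) ↦ (γ t, z)`, of the
pair `A + z ∂η`, `B + z dη + ½ z² η ∧ η + z A ∧ η + dz ∧ η` on `M × [0,1]`. The pull-backs of these
forms along `γ × id` are `(A(γ') + z ∂η(γ')) dt` and `dz ∧ η(γ') dt = - η(γ') dt ∧ dz`. -/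
def transElt (A : DForm V M 1 VG) (η : DForm V M 1 VE) (γ : ℝ → M) : E :=
  surfExp C (fun t z => pull₁ A γ t + z • C.dbd (pull₁ η γ t)) (fun _ _ => 0)
    (fun t _ => - pull₁ η γ t)

end LocalHolonomy

/-! ### Partitions and global holonomy -/

/-- A partition `0 = pts 0 < pts 1 < … < pts (m+1) = 1` of the unit interval into the cells
`[pts a, pts (a+1)]`, `a = 0, …, m`. -/
structure UnitPartition where
  m : ℕ
  pts : ℕ → ℝ
  pts_zero : pts 0 = 0
  pts_last : pts (m + 1) = 1
  lt : ∀ a ≤ m, pts a < pts (a + 1)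

namespace UnitPartition

/-- The partition with an additional point `c` in the interior of the cell number `k`. -/
def insert (P : UnitPartition) (k : ℕ) (c : ℝ) (hk : k ≤ P.m)
    (h₁ : P.pts k < c) (h₂ : c < P.pts (k + 1)) : UnitPartition where
  m := P.m + 1
  pts j := if j ≤ k then P.pts j else if j = k + 1 then c else P.pts (j - 1)
  pts_zero := by simpa using P.pts_zero
  pts_last := by
    rw [if_neg (by omega), if_neg (by omega)]
    simpa using P.pts_last
  lt := by
    intro a ha
    rcases lt_trichotomy a k with h | rfl | h
    · rw [if_pos (by omega), if_pos (by omega)]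
      exact P.lt a (by omega)
    · simpa using h₁
    · rw [if_neg (by omega), if_neg (by omega : ¬ a + 1 ≤ k), if_neg (by omega : ¬ a + 1 = k + 1)]
      rcases Nat.lt_or_ge (k + 1) a with h' | h'
      · rw [if_neg (by omega)]
        obtain ⟨b, rfl⟩ : ∃ b, a = b + 1 := ⟨a - 1, by omega⟩
        simpa using P.lt b (by omega)
      · obtain rfl : a = k + 1 := by omega
        simpa using h₂

/-- The number of the cell of `P` in which the cell number `j` of `P.insert k …` lies. -/
def parent (k j : ℕ) : ℕ := if j ≤ k then j else j - 1

/-- The parametrization of the cell number `a` by `[0,1]` with the help of `θ`. -/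
def cell (P : UnitPartition) (θ : ℝ → ℝ) (a : ℕ) (t : ℝ) : ℝ :=
  P.pts a + (P.pts (a + 1) - P.pts a) * θ t

end UnitPartition

/-- A reparametrization of `[0,1]`. Those that are constant near `0` and near `1` turn
restrictions to rectangles into 2-paths, with a product structure close to the boundary. -/
def IsReparam (θ : ℝ → ℝ) : Prop :=
  ContDiffOn ℝ ∞ θ (Icc 0 1) ∧ MonotoneOn θ (Icc 0 1) ∧ θ 0 = 0 ∧ θ 1 = 1

/-- `idx a b` is the chart assigned to the rectangle in column `a` and row `b`, and `Γ` maps each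
rectangle into the open set of its chart. -/
def IsAssignment {M ι : Type*} (U : ι → Set M) (Γ : ℝ × ℝ → M) (P Q : UnitPartition)
    (idx : ℕ → ℕ → ι) : Prop :=
  ∀ a ≤ P.m, ∀ b ≤ Q.m, ∀ t ∈ Icc (P.pts a) (P.pts (a + 1)),
    ∀ s ∈ Icc (Q.pts b) (Q.pts (b + 1)), Γ (t, s) ∈ U (idx a b)

namespace CubicalBundle.Connection

variable {V VG VE G E M ι : Type*} [NormedAddCommGroup V] [NormedSpace ℝ V]
  [NormedAddCommGroup VG] [NormedSpace ℝ VG] [NormedAddCommGroup VE] [NormedSpace ℝ VE]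
  [TopologicalSpace G] [ChartedSpace VG G] [Group G]
  [TopologicalSpace E] [ChartedSpace VE E] [Group E]
  [TopologicalSpace M] [ChartedSpace V M]
  {C : LieCrossedModule VG VE G E} {U : ι → Set M} {𝓑 : CubicalBundle V C U}
  (𝓐 : 𝓑.Connection)

/-- The transition 2-cube `τ(γ_{ij})` of a curve in `U i ∩ U j`. Its mirror image `τ̂` in the
diagonal is `(𝓐.tau i j γ).diag`. -/
def tau (i j : ι) (γ : ℝ → M) : Sq G E where
  X := curveHol G (𝓐.A i) γ
  Y := 𝓑.φ i j (γ 1)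
  Z := 𝓑.φ i j (γ 0)
  W := curveHol G (𝓐.A j) γ
  e := transElt C (𝓐.A i) (𝓐.η i j) γ

/-- The square `(ψ, φ)_{ijkl}` at the point `x`. -/
def psiSq (_𝓐 : 𝓑.Connection) (i j k l : ι) (x : M) : Sq G E :=
  ⟨𝓑.φ i j x, 𝓑.φ j l x, 𝓑.φ i k x, 𝓑.φ k l x, 𝓑.ψ i j k l x⟩

/-- The transition row `τ(γ, Q, Q')` of a curve `γ : [0,1] → M` for the partition `P` and two
assignments `i`, `i'` of charts to its cells. -/
def tauRow (θ : ℝ → ℝ) (γ : ℝ → M) (P : UnitPartition) (i i' : ℕ → ι) : Sq G E :=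
  C.hchain (fun a => 𝓐.tau (i a) (i' a) (fun t => γ (P.cell θ a t)))
    (fun a => 𝓐.psiSq (i a) (i (a + 1)) (i' a) (i' (a + 1)) (γ (P.pts (a + 1)))) P.m

/-- The row number `b` of rectangles: local holonomies, with the squares `τ̂` of the vertical
edges between them. -/
def holRow (θ : ℝ → ℝ) (Γ : ℝ × ℝ → M) (P Q : UnitPartition) (idx : ℕ → ℕ → ι) (b : ℕ) :
    Sq G E :=
  C.hchain
    (fun a => localHol C (𝓐.A (idx a b)) (𝓐.B (idx a b))
      (fun t s => Γ (P.cell θ a t, Q.cell θ b s)))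
    (fun a => (𝓐.tau (idx a b) (idx (a + 1) b)
      (fun s => Γ (P.pts (a + 1), Q.cell θ b s))).diag) P.m

/-- The holonomy of `Γ` for the partitions `P` (of the first) and `Q` (of the second factor) of
`[0,1]²` and the chart assignment `idx`: the rows of rectangles, with the transition rows of the
horizontal edges between them, composed from the bottom to the top. -/
def hol (θ : ℝ → ℝ) (Γ : ℝ × ℝ → M) (P Q : UnitPartition) (idx : ℕ → ℕ → ι) : Sq G E :=
  C.vchain (𝓐.holRow θ Γ P Q idx)
    (fun b => 𝓐.tauRow θ (fun t => Γ (t, Q.pts (b + 1))) P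
      (fun a => idx a b) (fun a => idx a (b + 1))) Q.m

end CubicalBundle.Connection

end

/-!
# Holonomy of cubical 2-bundles with connection

All the assertions are statements about composites of squares. They are reduced to four local facts:
the homotopy addition equation for a cube over a square in two charts (`isCube_localHol`), over a
curve in four charts (`isCube_psiSq`) and over a point in eight charts (`isCube_vertex`, an axiom of
the bundle), and the behaviour of local holonomies and transition squares under changes of
parameters. The first two cubes need analysis, the rest is algebra in the crossed module.

**Analysis.** Path-ordered exponentials of continuous coefficients exist (`exists_isPathExp`), they
are unique (`IsPathExp.pathExp_eq`), and their derivative with respect to a parameter is given by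
Duhamel's formula (`hasLogDerivWithinAt_pathExp_param`). Together with the fact that the bracket is
the derivative of the adjoint action (`dactL_conj`) this yields the non-abelian Stokes theorem on
the unit square (`IsSqConn.isPathExp_boundary`): the transport of a 1-form around the boundary is
the path-ordered exponential of the integrals of its transported curvature. For a pair with
vanishing fake curvature the curvature is `∂b`; hence the surface-ordered exponential fills the
boundary (`IsFakeFlat.bd_surfPath`), and local holonomies are squares in the crossed module.

Stokes' theorem, applied to an auxiliary 1-form with values in `𝔢`, also compares the
surface-ordered exponentials of a pair and of its shift by `η` (`IsFakeFlat.surfPath_shift`), and it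
turns the transition element of a curve into an ordinary path-ordered exponential
(`surfExp_eq_transPath`). The first result is the homotopy addition equation of the cube over a
square in two charts. For the cube over a curve in four charts, both sides of the equation are
curves in `E` as the end point moves, and the compatibility of `η` and `ψ` says that they have the
same logarithmic derivative.

**Algebra.** By the Peiffer identity, cubes compose in two directions (`IsCube.hcomp`,
`IsCube.vcomp`) and can be reflected (`IsCube.swap`). The composite of all the local cubes has the
two global holonomies as lower and upper faces and the transition rows as side faces
(`isCube_hol`). If the boundary is mapped to one point and the charts along it are constant, the
side faces are equal thin squares, and the homotopy addition equation reduces to the action of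
`φ` (`IsCube.eq_gact`).

The independence of the reparametrization and the invariance under subdivision follow from the
substitution rule for path-ordered exponentials (`localHol_strip`, `localHol_hcomp`, `tau_comp`).
The squares between the halves of a divided rectangle or edge join equal charts, so they are thin
(`tau_self`, `psiSq_self₁`, `psiSq_self₂`), and the interchange law (`vcomp_hcomp`) merges the
halves of a divided row.
-/

open Set Manifold
open scoped ContDiff Topology

noncomputable section

/-! ### Velocities of curves in manifolds -/

section Velocity

variable {W W' W'' N N' N'' : Type*}
  [NormedAddCommGroup W] [NormedSpace ℝ W] [TopologicalSpace N] [ChartedSpace W N]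
  [NormedAddCommGroup W'] [NormedSpace ℝ W'] [TopologicalSpace N'] [ChartedSpace W' N']
  [NormedAddCommGroup W''] [NormedSpace ℝ W''] [TopologicalSpace N''] [ChartedSpace W'' N'']

/-- The derivative of a map between manifolds, as a map between the model spaces. -/
def mfd (W W' : Type*) {N N' : Type*}
    [NormedAddCommGroup W] [NormedSpace ℝ W] [TopologicalSpace N] [ChartedSpace W N]
    [NormedAddCommGroup W'] [NormedSpace ℝ W'] [TopologicalSpace N'] [ChartedSpace W' N']
    (F : N → N') (x : N) : W →L[ℝ] W' := mfderiv 𝓘(ℝ, W) 𝓘(ℝ, W') F x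

/-- The curve `f` has the velocity `X` at `t` within `s`. -/
def HasVelWithinAt (f : ℝ → N) (X : W) (s : Set ℝ) (t : ℝ) : Prop :=
  HasMFDerivWithinAt 𝓘(ℝ, ℝ) 𝓘(ℝ, W) f s t ((1 : ℝ →L[ℝ] ℝ).smulRight X)

theorem HasMFDerivWithinAt.hasVelWithinAt {f : ℝ → N} {L : ℝ →L[ℝ] W} {s : Set ℝ} {t : ℝ}
    (h : HasMFDerivWithinAt 𝓘(ℝ, ℝ) 𝓘(ℝ, W) f s t L) {X : W} (hX : L 1 = X) :
    HasVelWithinAt f X s t := by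
  have : L = (1 : ℝ →L[ℝ] ℝ).smulRight X := by ext; simp [hX]
  subst this
  exact h

theorem HasVelWithinAt.continuousWithinAt {f : ℝ → N} {X : W} {s : Set ℝ} {t : ℝ}
    (h : HasVelWithinAt f X s t) : ContinuousWithinAt f s t :=
  HasMFDerivWithinAt.continuousWithinAt h

theorem HasVelWithinAt.congr {f f' : ℝ → N} {X : W} {s : Set ℝ} {t : ℝ}
    (h : HasVelWithinAt f X s t) (hf : ∀ τ ∈ s, f' τ = f τ) (ht : f' t = f t) :
    HasVelWithinAt f' X s t := by
  have := HasMFDerivWithinAt.congr_of_eventuallyEq h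
    (Filter.eventually_of_mem self_mem_nhdsWithin hf) ht
  exact this

theorem hasVelWithinAt_iff_hasDerivWithinAt {f : ℝ → W} {X : W} {s : Set ℝ} {t : ℝ} :
    HasVelWithinAt (N := W) f X s t ↔ HasDerivWithinAt f X s t := by
  unfold HasVelWithinAt
  rw [hasDerivWithinAt_iff_hasFDerivWithinAt]
  constructor
  · intro h
    have := h.hasFDerivWithinAt
    exact this
  · intro h
    exact HasFDerivWithinAt.hasMFDerivWithinAt h

theorem HasVelWithinAt.comp_map {f : ℝ → N} {X : W} {s : Set ℝ} {t : ℝ}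
    (h : HasVelWithinAt f X s t) {F : N → N'}
    (hF : MDifferentiableAt 𝓘(ℝ, W) 𝓘(ℝ, W') F (f t)) :
    HasVelWithinAt (fun τ => F (f τ)) (mfd W W' F (f t) X) s t := by
  refine HasMFDerivWithinAt.hasVelWithinAt (N := N') (W := W')
    (HasMFDerivAt.comp_hasMFDerivWithinAt t hF.hasMFDerivAt h) ?_
  change mfd W W' F (f t) ((ContinuousLinearMap.smulRight (1 : ℝ →L[ℝ] ℝ) X) 1) = _
  simp

theorem HasVelWithinAt.comp_real {f : ℝ → N} {X : W} {s s' : Set ℝ} {t : ℝ} {χ : ℝ → ℝ} {c : ℝ}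
    (h : HasVelWithinAt f X s' (χ t)) (hχ : HasDerivWithinAt χ c s t) (hs : MapsTo χ s s') :
    HasVelWithinAt (fun τ => f (χ τ)) (c • X) s t := by
  refine HasMFDerivWithinAt.hasVelWithinAt (N := N) (W := W)
    (HasMFDerivWithinAt.comp t h hχ.hasFDerivWithinAt.hasMFDerivWithinAt hs) ?_
  change (ContinuousLinearMap.smulRight (1 : ℝ →L[ℝ] ℝ) X)
    ((ContinuousLinearMap.smulRight (1 : ℝ →L[ℝ] ℝ) c) 1) = _
  simp

theorem HasVelWithinAt.unique {f : ℝ → N} {X Y : W} {s : Set ℝ} {t : ℝ}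
    (h : HasVelWithinAt f X s t) (h' : HasVelWithinAt f Y s t)
    (hs : UniqueDiffWithinAt ℝ s t) : X = Y := by
  have hu : UniqueMDiffWithinAt 𝓘(ℝ, ℝ) s t := uniqueMDiffWithinAt_iff_uniqueDiffWithinAt.2 hs
  have := UniqueMDiffWithinAt.eq hu h h'
  have : (1 : ℝ →L[ℝ] ℝ).smulRight X 1 = (1 : ℝ →L[ℝ] ℝ).smulRight Y 1 :=
    congrArg (fun L : ℝ →L[ℝ] W => L 1) this
  simpa using this

theorem hasVelWithinAt_const (x : N) (s : Set ℝ) (t : ℝ) :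
    HasVelWithinAt (fun _ : ℝ => x) (0 : W) s t :=
  HasMFDerivWithinAt.hasVelWithinAt (N := N) (W := W)
    (hasMFDerivWithinAt_const (I := 𝓘(ℝ, ℝ)) (I' := 𝓘(ℝ, W)) x s t) rfl

theorem HasVelWithinAt.comp_map₂ {f : ℝ → N} {g : ℝ → N'} {X : W} {Y : W'} {s : Set ℝ} {t : ℝ}
    (hf : HasVelWithinAt f X s t) (hg : HasVelWithinAt g Y s t) {F : N × N' → N''}
    (hF : MDifferentiableAt (𝓘(ℝ, W).prod 𝓘(ℝ, W')) 𝓘(ℝ, W'') F (f t, g t)) :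
    HasVelWithinAt (fun τ => F (f τ, g τ))
      (mfd W W'' (fun x => F (x, g t)) (f t) X + mfd W' W'' (fun y => F (f t, y)) (g t) Y) s t := by
  have h1 := HasMFDerivWithinAt.prodMk hf hg
  refine HasMFDerivWithinAt.hasVelWithinAt (N := N'') (W := W'')
    (HasMFDerivAt.comp_hasMFDerivWithinAt t hF.hasMFDerivAt h1) ?_
  have h2 := mfderiv_prod_eq_add_apply (v := ((X, Y) : W × W')) hF
  refine Eq.trans ?_ h2
  have h3 : ((1 : ℝ →L[ℝ] ℝ).smulRight X 1, (1 : ℝ →L[ℝ] ℝ).smulRight Y 1) = (X, Y) := by simp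
  rw [← h3]
  rfl

theorem mfd_comp {F : N → N'} {F' : N' → N''} {x : N}
    (hF' : MDifferentiableAt 𝓘(ℝ, W') 𝓘(ℝ, W'') F' (F x))
    (hF : MDifferentiableAt 𝓘(ℝ, W) 𝓘(ℝ, W') F x) (v : W) :
    mfd W W'' (fun y => F' (F y)) x v = mfd W' W'' F' (F x) (mfd W W' F x v) := by
  have := mfderiv_comp x hF' hF
  exact congrArg (fun L : W →L[ℝ] W'' => L v) this

theorem mfd_comp_of_eq {F : N → N'} {F' : N' → N''} {x : N} {y : N'}
    (hF' : MDifferentiableAt 𝓘(ℝ, W') 𝓘(ℝ, W'') F' y)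
    (hF : MDifferentiableAt 𝓘(ℝ, W) 𝓘(ℝ, W') F x) (hy : F x = y) (v : W) :
    mfd W W'' (fun z => F' (F z)) x v = mfd W' W'' F' y (mfd W W' F x v) := by
  subst hy
  exact mfd_comp hF' hF v

theorem mfd_comp₂ {F : N' × N'' → N} {f : N → N'} {g : N → N''} {x : N}
    (hF : MDifferentiableAt (𝓘(ℝ, W').prod 𝓘(ℝ, W'')) 𝓘(ℝ, W) F (f x, g x))
    (hf : MDifferentiableAt 𝓘(ℝ, W) 𝓘(ℝ, W') f x) (hg : MDifferentiableAt 𝓘(ℝ, W) 𝓘(ℝ, W'') g x)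
    (v : W) :
    mfd W W (fun y => F (f y, g y)) x v = mfd W' W (fun y => F (y, g x)) (f x) (mfd W W' f x v)
      + mfd W'' W (fun y => F (f x, y)) (g x) (mfd W W'' g x v) := by
  have h1 := mfderiv_comp x hF (hf.prodMk hg)
  have h2 := mfderiv_prod_eq_add_apply (v := ((mfd W W' f x v, mfd W W'' g x v) : W' × W'')) hF
  refine Eq.trans ?_ h2
  refine (congrArg (fun L : W →L[ℝ] W => L v) h1).trans ?_
  rw [hf.mfderiv_prod hg]
  rfl

theorem mfd_id (x : N) (v : W) : mfd W W (fun y : N => y) x v = v := by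
  have := mfderiv_id (I := 𝓘(ℝ, W)) (x := x)
  exact congrArg (fun L : W →L[ℝ] W => L v) this

theorem mfd_const (x : N) (y : N') (v : W) : mfd W W' (fun _ : N => y) x v = (0 : W') := by
  have := mfderiv_const (I := 𝓘(ℝ, W)) (I' := 𝓘(ℝ, W')) (x := x) (c := y)
  exact congrArg (fun L : W →L[ℝ] W' => L v) this

theorem mfd_congr {F F' : N → N'} {x : N} (h : F =ᶠ[𝓝 x] F') (v : W) :
    mfd W W' F x v = mfd W W' F' x v := by
  have := Filter.EventuallyEq.mfderiv_eq (I := 𝓘(ℝ, W)) (I' := 𝓘(ℝ, W')) h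
  exact congrArg (fun L : W →L[ℝ] W' => L v) this

/-- The derivative at a point of a chart is the identity of the tangent space, so velocities can
be computed in the chart at the point. -/
theorem hasVelWithinAt_of_extChartAt {f : ℝ → N} {X : W} {s : Set ℝ} {t : ℝ} {p : N}
    (h : HasDerivWithinAt (fun τ => extChartAt 𝓘(ℝ, W) p (f τ)) X s t)
    (hc : ContinuousWithinAt f s t) (hp : f t = p) :
    HasVelWithinAt f X s t := by
  subst hp
  refine ⟨hc, ?_⟩
  simp only [writtenInExtChartAt, extChartAt_model_space_eq_id, PartialEquiv.refl_symm,
    PartialEquiv.refl_coe, Function.comp_id, preimage_id, modelWithCornersSelf_coe, range_id,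
    inter_univ, id_eq]
  exact h

theorem HasVelWithinAt.union {f : ℝ → N} {X : W} {s s' : Set ℝ} {t : ℝ}
    (h : HasVelWithinAt f X s t) (h' : HasVelWithinAt f X s' t) :
    HasVelWithinAt f X (s ∪ s') t :=
  HasMFDerivWithinAt.union h h'

end Velocity

/-! ### Logarithmic derivatives of curves in Lie groups -/

section LogDeriv

variable {VG G : Type*} [NormedAddCommGroup VG] [NormedSpace ℝ VG]
  [TopologicalSpace G] [ChartedSpace VG G] [Group G]

/-- The curve `g` has the left logarithmic derivative `X = g⁻¹ g'` at `t` within `s`. It is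
expressed as the velocity of a curve through `1`. -/
def HasLogDerivWithinAt (g : ℝ → G) (X : VG) (s : Set ℝ) (t : ℝ) : Prop :=
  HasVelWithinAt (fun τ => (g t)⁻¹ * g τ) X s t

theorem HasLogDerivWithinAt.congr {f f' : ℝ → G} {X : VG} {s : Set ℝ} {t : ℝ}
    (h : HasLogDerivWithinAt f X s t) (hf : ∀ τ ∈ s, f' τ = f τ) (ht : f' t = f t) :
    HasLogDerivWithinAt f' X s t :=
  HasVelWithinAt.congr h (fun τ hτ => by rw [hf τ hτ, ht]) (by rw [ht])

theorem HasLogDerivWithinAt.const_mul {g : ℝ → G} {X : VG} {s : Set ℝ} {t : ℝ}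
    (h : HasLogDerivWithinAt g X s t) (k : G) : HasLogDerivWithinAt (fun τ => k * g τ) X s t :=
  HasVelWithinAt.congr h (fun τ _ => by group) (by group)

theorem HasLogDerivWithinAt.comp_real {f : ℝ → G} {X : VG} {s s' : Set ℝ} {t : ℝ} {χ : ℝ → ℝ}
    {c : ℝ} (h : HasLogDerivWithinAt f X s' (χ t)) (hχ : HasDerivWithinAt χ c s t)
    (hs : MapsTo χ s s') : HasLogDerivWithinAt (fun τ => f (χ τ)) (c • X) s t :=
  HasVelWithinAt.comp_real h hχ hs

theorem hasLogDerivWithinAt_const (k : G) (s : Set ℝ) (t : ℝ) :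
    HasLogDerivWithinAt (fun _ => k) (0 : VG) s t :=
  hasVelWithinAt_const _ _ _

theorem HasLogDerivWithinAt.map {VH H : Type*} [NormedAddCommGroup VH] [NormedSpace ℝ VH]
    [TopologicalSpace H] [ChartedSpace VH H] [Group H]
    {g : ℝ → G} {X : VG} {s : Set ℝ} {t : ℝ}
    (hg : HasLogDerivWithinAt g X s t) (F : G →* H)
    (hF : MDifferentiableAt 𝓘(ℝ, VG) 𝓘(ℝ, VH) F 1) :
    HasLogDerivWithinAt (fun τ => F (g τ)) (mfd VG VH F 1 X) s t := by
  have h1 := HasVelWithinAt.comp_map (N' := H) (W' := VH) (F := F) hg (by simpa using hF)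
  rw [inv_mul_cancel] at h1
  exact h1.congr (fun τ _ => by simp) (by simp)

variable [LieGroup 𝓘(ℝ, VG) ∞ G]

theorem mdiff_mul_left (k x : G) : MDifferentiableAt 𝓘(ℝ, VG) 𝓘(ℝ, VG) (fun y => k * y) x :=
  (contMDiff_mul_left (I := 𝓘(ℝ, VG)) (n := ∞) (a := k)).mdifferentiable (by simp) x

theorem mdiff_inv (x : G) : MDifferentiableAt 𝓘(ℝ, VG) 𝓘(ℝ, VG) (fun y : G => y⁻¹) x :=
  (contMDiff_inv 𝓘(ℝ, VG) ∞).mdifferentiable (by simp) x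

theorem contMDiff_conj (k : G) : ContMDiff 𝓘(ℝ, VG) 𝓘(ℝ, VG) ∞ (fun y => k * y * k⁻¹) :=
  (contMDiff_const.mul contMDiff_id).mul contMDiff_const

theorem mdiff_conj (k x : G) :
    MDifferentiableAt 𝓘(ℝ, VG) 𝓘(ℝ, VG) (fun y => k * y * k⁻¹) x :=
  (contMDiff_conj k).mdifferentiable (by simp) x

theorem HasLogDerivWithinAt.hasVelWithinAt {g : ℝ → G} {X : VG} {s : Set ℝ} {t : ℝ}
    (h : HasLogDerivWithinAt g X s t) :
    HasVelWithinAt g (mfd VG VG (fun y => g t * y) 1 X) s t := by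
  have h1 := HasVelWithinAt.comp_map (N' := G) (W' := VG) (F := fun y => g t * y) h
    (mdiff_mul_left _ _)
  rw [inv_mul_cancel] at h1
  exact h1.congr (fun τ _ => by group) (by group)

theorem mfd_mul_left_inv (k : G) (X : VG) :
    mfd VG VG (fun y => k⁻¹ * y) k (mfd VG VG (fun y => k * y) 1 X) = X := by
  rw [← mfd_comp_of_eq (mdiff_mul_left _ _) (mdiff_mul_left _ _) (mul_one k)]
  simp [mfd_id]

theorem HasVelWithinAt.hasLogDerivWithinAt {g : ℝ → G} {X : VG} {s : Set ℝ} {t : ℝ}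
    (h : HasVelWithinAt g X s t) :
    HasLogDerivWithinAt g (mfd VG VG (fun y => (g t)⁻¹ * y) (g t) X) s t :=
  h.comp_map (F := fun y => (g t)⁻¹ * y) (mdiff_mul_left _ _)

theorem hasLogDerivWithinAt_iff_hasVelWithinAt {g : ℝ → G} {X : VG} {s : Set ℝ} {t : ℝ} :
    HasLogDerivWithinAt g X s t ↔ HasVelWithinAt g (mfd VG VG (fun y => g t * y) 1 X) s t := by
  refine ⟨HasLogDerivWithinAt.hasVelWithinAt, fun h => ?_⟩
  have := h.hasLogDerivWithinAt
  rwa [mfd_mul_left_inv] at this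

theorem HasLogDerivWithinAt.continuousWithinAt {g : ℝ → G} {X : VG} {s : Set ℝ} {t : ℝ}
    (h : HasLogDerivWithinAt g X s t) : ContinuousWithinAt g s t :=
  h.hasVelWithinAt.continuousWithinAt

/-- The differential equation `g' = g a` says that `a` is the left logarithmic derivative of `g`. -/
theorem isPathExp_iff {a : ℝ → VG} {g : ℝ → G} :
    IsPathExp a g ↔ g 0 = 1 ∧ ∀ t ∈ Icc (0 : ℝ) 1, HasLogDerivWithinAt g (a t) (Icc 0 1) t := by
  simp only [hasLogDerivWithinAt_iff_hasVelWithinAt]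
  exact Iff.rfl

/-- The Leibniz rule `(g h)⁻¹ (g h)' = h⁻¹ (g⁻¹ g') h + h⁻¹ h'`. -/
theorem HasLogDerivWithinAt.mul {g h : ℝ → G} {X Y : VG} {s : Set ℝ} {t : ℝ}
    (hg : HasLogDerivWithinAt g X s t) (hh : HasLogDerivWithinAt h Y s t) :
    HasLogDerivWithinAt (fun τ => g τ * h τ) (adj (h t)⁻¹ X + Y) s t := by
  have hF : ContMDiff (𝓘(ℝ, VG).prod 𝓘(ℝ, VG)) 𝓘(ℝ, VG) ∞
      (fun p : G × G => (h t)⁻¹ * p.1 * (h t)⁻¹⁻¹ * p.2) :=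
    ((contMDiff_const.mul contMDiff_fst).mul contMDiff_const).mul contMDiff_snd
  have := HasVelWithinAt.comp_map₂ (N'' := G) (W'' := VG) hg hh (hF.mdifferentiable (by simp) _)
  simp only [inv_mul_cancel, mul_one, inv_inv, one_mul, mfd_id] at this
  have e : adj (h t)⁻¹ X = mfd VG VG (fun k => (h t)⁻¹ * k * (h t)⁻¹⁻¹) 1 X := rfl
  rw [e, inv_inv]
  exact HasVelWithinAt.congr this (fun τ _ => by group) (by group)

theorem mfd_inv_one (X : VG) : mfd VG VG (fun y : G => y⁻¹) 1 X = -X := by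
  have h := mfd_comp₂ (N := G) (W := VG) (N' := G) (W' := VG) (N'' := G) (W'' := VG)
    (F := fun p : G × G => p.1 * p.2) (f := fun y => y) (g := fun y => y⁻¹) (x := 1)
    ((contMDiff_mul 𝓘(ℝ, VG) ∞).mdifferentiable (by simp) _) mdifferentiableAt_id (mdiff_inv _) X
  simp only [mul_inv_cancel, mfd_const, inv_one, mul_one, one_mul, mfd_id] at h
  exact (neg_eq_of_add_eq_zero_right h.symm).symm

theorem HasLogDerivWithinAt.inv {g : ℝ → G} {X : VG} {s : Set ℝ} {t : ℝ}
    (hg : HasLogDerivWithinAt g X s t) :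
    HasLogDerivWithinAt (fun τ => (g τ)⁻¹) (-adj (g t) X) s t := by
  have h1 := HasVelWithinAt.comp_map (N' := G) (W' := VG) (F := fun y => g t * y⁻¹ * (g t)⁻¹) hg
    (((contMDiff_const.mul (contMDiff_inv 𝓘(ℝ, VG) ∞)).mul contMDiff_const).mdifferentiable
      (by simp) _)
  rw [inv_mul_cancel, mfd_comp_of_eq (F' := fun y => g t * y * (g t)⁻¹) (mdiff_conj _ _)
    (mdiff_inv _) inv_one, mfd_inv_one, map_neg] at h1
  exact HasVelWithinAt.congr h1 (fun τ _ => by group) (by group)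

end LogDeriv

/-! ### Actions of crossed modules on Lie algebras -/

/-- A Lie group as a crossed module over itself, with the action by conjugation. -/
def conjModule (VG G : Type*) [NormedAddCommGroup VG] [NormedSpace ℝ VG]
    [TopologicalSpace G] [ChartedSpace VG G] [Group G] [LieGroup 𝓘(ℝ, VG) ∞ G] :
    LieCrossedModule VG VG G G where
  bd := MonoidHom.id G
  act := MulAut.conj
  bd_act g e := by simp
  peiffer e f := by simp
  smooth_bd := contMDiff_id
  smooth_act := (contMDiff_fst.mul contMDiff_snd).mul contMDiff_fst.inv

namespace LieCrossedModule

variable {VG VE G E : Type*}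
  [NormedAddCommGroup VG] [NormedSpace ℝ VG] [NormedAddCommGroup VE] [NormedSpace ℝ VE]
  [TopologicalSpace G] [ChartedSpace VG G] [Group G]
  [TopologicalSpace E] [ChartedSpace VE E] [Group E]
  (C : LieCrossedModule VG VE G E)

/-- The Peiffer identity: an element moves across `f` when it is transported along the boundary
of `f`. -/
theorem mul_act (f u : E) (g : G) : f * C.act g u = C.act (C.bd f * g) u * f := by
  rw [map_mul, MulAut.mul_apply, C.peiffer, inv_mul_cancel_right]

/-- The action of `G` on `𝔢`, as continuous linear maps. -/
def lactL (g : G) : VE →L[ℝ] VE := mfd VE VE (fun e => C.act g e) 1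

/-- The differential of `∂`, as a continuous linear map. -/
def dbdL : VE →L[ℝ] VG := mfd VE VG C.bd 1

theorem lactL_apply (g : G) (v : VE) : C.lactL g v = C.lact g v := rfl

theorem mdiff_act (g : G) (e : E) :
    MDifferentiableAt 𝓘(ℝ, VE) 𝓘(ℝ, VE) (fun e => C.act g e) e :=
  (C.smooth_act.comp (contMDiff_const.prodMk contMDiff_id)).mdifferentiable (by simp) e

theorem mdiff_bd (e : E) : MDifferentiableAt 𝓘(ℝ, VE) 𝓘(ℝ, VG) C.bd e :=
  C.smooth_bd.mdifferentiable (by simp) e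

theorem lactL_one : C.lactL 1 = 1 := by
  ext v
  simp [lactL, mfd_id]

theorem lactL_mul (g h : G) (v : VE) : C.lactL (g * h) v = C.lactL g (C.lactL h v) := by
  simp only [lactL, map_mul, MulAut.mul_apply]
  exact mfd_comp_of_eq (F' := fun e => C.act g e) (C.mdiff_act _ _) (C.mdiff_act _ _)
    (map_one _) v

theorem dbdL_lactL [LieGroup 𝓘(ℝ, VG) ∞ G] (g : G) (v : VE) :
    C.dbdL (C.lactL g v) = adj g (C.dbdL v) := by
  refine (mfd_comp_of_eq (C.mdiff_bd _) (C.mdiff_act g 1) (map_one _) v).symm.trans ?_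
  simp only [C.bd_act]
  exact mfd_comp_of_eq (F' := fun e => g * e * g⁻¹) (mdiff_conj _ _) (C.mdiff_bd _) (map_one _) v

theorem lactL_bd (e : E) (v : VE) : C.lactL (C.bd e) v = adj e v := by
  simp only [lactL, C.peiffer]
  rfl

theorem _root_.HasLogDerivWithinAt.bd [LieGroup 𝓘(ℝ, VE) ∞ E] {e : ℝ → E} {X : VE} {s : Set ℝ}
    {t : ℝ} (h : HasLogDerivWithinAt e X s t) :
    HasLogDerivWithinAt (fun τ => C.bd (e τ)) (C.dbdL X) s t :=
  h.map C.bd (C.mdiff_bd _)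

theorem _root_.HasLogDerivWithinAt.act_const [LieGroup 𝓘(ℝ, VE) ∞ E] {e : ℝ → E} {X : VE}
    {s : Set ℝ} {t : ℝ} (h : HasLogDerivWithinAt e X s t) (g : G) :
    HasLogDerivWithinAt (fun τ => C.act g (e τ)) (C.lactL g X) s t :=
  h.map (C.act g).toMonoidHom (C.mdiff_act _ _)

theorem _root_.HasLogDerivWithinAt.act [LieGroup 𝓘(ℝ, VE) ∞ E] {g : ℝ → G} {e : ℝ → E} {X : VG}
    {Y : VE} {s : Set ℝ} {t : ℝ}
    (hg : HasLogDerivWithinAt g X s t) (he : HasLogDerivWithinAt e Y s t) :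
    HasLogDerivWithinAt (fun τ => C.act (g τ) (e τ))
      (C.lactL (g t) (C.dactGroup X (e t) + Y)) s t := by
  have hF : ContMDiff (𝓘(ℝ, VG).prod 𝓘(ℝ, VE)) 𝓘(ℝ, VE) ∞
      (fun p : G × E => (e t)⁻¹ * C.act p.1 (e t) * C.act p.1 p.2) :=
    (contMDiff_const.mul (C.smooth_act.comp (contMDiff_fst.prodMk contMDiff_const))).mul
      C.smooth_act
  have := HasVelWithinAt.comp_map₂ (N'' := E) (W'' := VE) hg he (hF.mdifferentiable (by simp) _)
  simp only [inv_mul_cancel, map_one, MulAut.one_apply, one_mul, mul_one, mfd_id] at this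
  have h2 := HasVelWithinAt.comp_map (N' := E) (W' := VE) (F := fun y => C.act (g t) y) this
    (C.mdiff_act _ _)
  simp only [inv_mul_cancel, map_one, MulAut.one_apply, mul_one] at h2
  refine HasVelWithinAt.congr h2 (fun τ _ => ?_) ?_
  · simp [mul_assoc]
  · simp

end LieCrossedModule

/-- A continuous linear map commutes with the derivative of a map to a vector space. -/
theorem mfd_clm {W W' V N : Type*} [NormedAddCommGroup W] [NormedSpace ℝ W]
    [NormedAddCommGroup W'] [NormedSpace ℝ W'] [NormedAddCommGroup V] [NormedSpace ℝ V]
    [TopologicalSpace N] [ChartedSpace V N]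
    {F : N → W} {x : N} (hF : MDifferentiableAt 𝓘(ℝ, V) 𝓘(ℝ, W) F x) (L : W →L[ℝ] W') (v : V) :
    mfd V W' (fun y => L (F y)) x v = L (mfd V W F x v) := by
  rw [mfd_comp (F' := fun w => L w) L.differentiableAt.mdifferentiableAt hF]
  have h : mfderiv 𝓘(ℝ, W) 𝓘(ℝ, W') (fun w => L w) (F x) = L :=
    (mfderiv_eq_fderiv).trans L.fderiv
  exact congrArg (fun L' : W →L[ℝ] W' => L' (mfd V W F x v)) h

namespace LieCrossedModule

variable {VG VE G E : Type*}
  [NormedAddCommGroup VG] [NormedSpace ℝ VG] [NormedAddCommGroup VE] [NormedSpace ℝ VE]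
  [TopologicalSpace G] [ChartedSpace VG G] [Group G] [LieGroup 𝓘(ℝ, VG) ∞ G]
  [TopologicalSpace E] [ChartedSpace VE E] [Group E] [LieGroup 𝓘(ℝ, VE) ∞ E]
  (C : LieCrossedModule VG VE G E)

theorem contMDiff_lactL : ContMDiff 𝓘(ℝ, VG) 𝓘(ℝ, VE →L[ℝ] VE) ∞ C.lactL := by
  intro g
  have : IsManifold 𝓘(ℝ, VE) ((∞ : WithTop ℕ∞) + 1) E := by
    change IsManifold 𝓘(ℝ, VE) ∞ E
    infer_instance
  have : IsManifold 𝓘(ℝ, VE) 1 E := IsManifold.of_le (n := ∞) (by simp)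
  have h := ContMDiffAt.mfderiv (I := 𝓘(ℝ, VE)) (I' := 𝓘(ℝ, VE)) (J := 𝓘(ℝ, VG)) (n := ∞) (m := ∞)
    (x₀ := g)
    (fun (g : G) (e : E) => C.act g e) (fun _ => 1) C.smooth_act.contMDiffAt contMDiffAt_const
    (by simp)
  have e : inTangentCoordinates 𝓘(ℝ, VE) 𝓘(ℝ, VE) (fun _ : G => (1 : E)) (fun x => C.act x 1)
      (fun x => mfderiv 𝓘(ℝ, VE) 𝓘(ℝ, VE) (fun e => C.act x e) 1) g = C.lactL := by
    funext x
    have h1 := inTangentCoordinates_eq (I := 𝓘(ℝ, VE)) (I' := 𝓘(ℝ, VE)) (fun _ : G => (1 : E))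
      (fun x => C.act x 1) C.lactL (x₀ := g) (x := x) (mem_chart_source _ _)
      (by simp only [map_one]; exact mem_chart_source _ _)
    refine h1.trans ?_
    ext v
    simp only [map_one, ContinuousLinearMap.comp_apply]
    rw [(tangentBundleCore 𝓘(ℝ, VE) E).coordChange_self _ _ (by simp),
      (tangentBundleCore 𝓘(ℝ, VE) E).coordChange_self _ _ (by simp)]
  rwa [e] at h

theorem mdiff_lactL (g : G) : MDifferentiableAt 𝓘(ℝ, VG) 𝓘(ℝ, VE →L[ℝ] VE) C.lactL g :=
  C.contMDiff_lactL.mdifferentiable (by simp) g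

theorem continuous_lactL : Continuous C.lactL := C.contMDiff_lactL.continuous

/-- The derived action of `𝔤` on `𝔢`, as a continuous bilinear map. -/
def dactL : VG →L[ℝ] VE →L[ℝ] VE := mfd VG (VE →L[ℝ] VE) C.lactL 1

theorem dactL_apply (X : VG) (v : VE) : C.dactL X v = C.dact X v :=
  (mfd_clm (C.mdiff_lactL 1) (ContinuousLinearMap.apply ℝ VE v) X).symm

theorem _root_.HasLogDerivWithinAt.lactL {g : ℝ → G} {X : VG} {s : Set ℝ} {t : ℝ}
    (hg : HasLogDerivWithinAt g X s t) :
    HasDerivWithinAt (fun τ => C.lactL (g τ)) ((C.lactL (g t)).comp (C.dactL X)) s t := by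
  have h1 := HasVelWithinAt.comp_map (F := C.lactL) hg (C.mdiff_lactL _)
  rw [inv_mul_cancel] at h1
  have h2 := hasVelWithinAt_iff_hasDerivWithinAt.1 h1
  have h3 := HasDerivWithinAt.clm_comp (hasDerivWithinAt_const t s (C.lactL (g t))) h2
  rw [ContinuousLinearMap.zero_comp, zero_add] at h3
  refine h3.congr (fun τ _ => ?_) ?_
  · ext v
    simp [← C.lactL_mul]
  · ext v
    simp [← C.lactL_mul]

theorem _root_.HasLogDerivWithinAt.lactL_apply {g : ℝ → G} {X : VG} {v : ℝ → VE} {v' : VE}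
    {s : Set ℝ} {t : ℝ} (hg : HasLogDerivWithinAt g X s t) (hv : HasDerivWithinAt v v' s t) :
    HasDerivWithinAt (fun τ => C.lactL (g τ) (v τ)) (C.lactL (g t) (C.dactL X (v t) + v')) s t := by
  have := (hg.lactL C).clm_apply hv
  simpa using this

/-- This is the derivative of `lactL (g k g⁻¹) (lactL g v) = lactL g (lactL k v)` at `k = 1`. -/
theorem lactL_dactL (g : G) (X : VG) (v : VE) :
    C.lactL g (C.dactL X v) = C.dactL (adj g X) (C.lactL g v) := by
  have h1 := mfd_clm (C.mdiff_lactL 1)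
    ((C.lactL g).comp (ContinuousLinearMap.apply ℝ VE v)) X
  have h2 := mfd_clm (F := fun k => C.lactL (g * k * g⁻¹)) (x := 1)
    ((C.contMDiff_lactL.comp (contMDiff_conj g)).mdifferentiable (by simp) 1)
    (ContinuousLinearMap.apply ℝ VE (C.lactL g v)) X
  rw [mfd_comp_of_eq (F' := C.lactL) (C.mdiff_lactL 1) (mdiff_conj _ _) (by simp)] at h2
  refine h1.symm.trans (Eq.trans ?_ h2)
  congr 2
  funext k
  simp [← C.lactL_mul]

theorem dactL_dbdL_eq_conj (u v : VE) :
    C.dactL (C.dbdL u) v = (conjModule VE E).dactL u v := by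
  have h2 := mfd_comp_of_eq (F' := C.lactL) (C.mdiff_lactL 1) (C.mdiff_bd 1) (map_one _) u
  have h1 : (fun e => C.lactL (C.bd e)) = (conjModule VE E).lactL := by
    funext e
    ext v
    rw [C.lactL_bd]
    rfl
  rw [h1] at h2
  exact congrArg (fun L : VE →L[ℝ] VE => L v) h2.symm

theorem dbdL_dactL_eq_conj (X : VG) (v : VE) :
    C.dbdL (C.dactL X v) = (conjModule VG G).dactL X (C.dbdL v) := by
  have h1 := mfd_clm (C.mdiff_lactL 1)
    (C.dbdL.comp (ContinuousLinearMap.apply ℝ VE v)) X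
  have h2 := mfd_clm ((conjModule VG G).mdiff_lactL 1)
    (ContinuousLinearMap.apply ℝ VG (C.dbdL v)) X
  refine h1.symm.trans (Eq.trans ?_ h2)
  congr 2
  funext k
  exact C.dbdL_lactL k v

end LieCrossedModule

/-! ### The Lie bracket as the derivative of the adjoint action -/

section Bracket

variable {VG G : Type*} [NormedAddCommGroup VG] [NormedSpace ℝ VG]
  [TopologicalSpace G] [ChartedSpace VG G] [Group G]

/-- The chart at `1`. -/
abbrev oneChart (VG G : Type*) [NormedAddCommGroup VG] [NormedSpace ℝ VG]
    [TopologicalSpace G] [ChartedSpace VG G] [Group G] : PartialEquiv G VG :=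
  extChartAt 𝓘(ℝ, VG) (1 : G)

variable (VG G) in
/-- The multiplication in the chart at `1`. -/
def chartMul (p : VG × VG) : VG :=
  oneChart VG G ((oneChart VG G).symm p.1 * (oneChart VG G).symm p.2)

variable (VG G) in
/-- The differential at `1` of the left multiplication by the element with coordinate `x`. -/
def leftD (x : VG) : VG →L[ℝ] VG :=
  fderiv ℝ (fun y => chartMul VG G (x, y)) (oneChart VG G 1)

theorem mfd_eq_fderiv {W W' : Type*} [NormedAddCommGroup W] [NormedSpace ℝ W]
    [NormedAddCommGroup W'] [NormedSpace ℝ W'] (F : W → W') (x : W) :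
    mfd W W' F x = fderiv ℝ F x := mfderiv_eq_fderiv

theorem mem_oneChart_target : oneChart VG G 1 ∈ (oneChart VG G).target := mem_extChartAt_target 1

theorem oneChart_symm_one : (oneChart VG G).symm (oneChart VG G 1) = 1 :=
  extChartAt_to_inv (I := 𝓘(ℝ, VG)) (1 : G)

theorem oneChart_target_mem_nhds {x : VG} (hx : x ∈ (oneChart VG G).target) :
    (oneChart VG G).target ∈ 𝓝 x := (isOpen_extChartAt_target (I := 𝓘(ℝ, VG)) (1 : G)).mem_nhds hx

variable [LieGroup 𝓘(ℝ, VG) ∞ G]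

theorem mdiff_oneChart {g : G} (hg : g ∈ (oneChart VG G).source) :
    MDifferentiableAt 𝓘(ℝ, VG) 𝓘(ℝ, VG) (oneChart VG G) g := by
  have : IsManifold 𝓘(ℝ, VG) 1 G := IsManifold.of_le (n := ∞) (by simp)
  exact mdifferentiableAt_extChartAt (by simpa using hg)

theorem contMDiffAt_oneChart_symm {x : VG} (hx : x ∈ (oneChart VG G).target) :
    ContMDiffAt 𝓘(ℝ, VG) 𝓘(ℝ, VG) ∞ (oneChart VG G).symm x :=
  (contMDiffOn_extChartAt_symm (n := ∞) (1 : G)).contMDiffAt (oneChart_target_mem_nhds hx)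

theorem contMDiffAt_oneChart {g : G} (hg : g ∈ (oneChart VG G).source) :
    ContMDiffAt 𝓘(ℝ, VG) 𝓘(ℝ, VG) ∞ (oneChart VG G) g :=
  contMDiffAt_extChartAt' (by simpa using hg)

theorem mdiff_oneChart_symm {x : VG} (hx : x ∈ (oneChart VG G).target) :
    MDifferentiableAt 𝓘(ℝ, VG) 𝓘(ℝ, VG) (oneChart VG G).symm x :=
  (contMDiffAt_oneChart_symm hx).mdifferentiableAt (by simp)

theorem mfd_oneChart_one (v : VG) : mfd VG VG (oneChart VG G) 1 v = v := by
  have : IsManifold 𝓘(ℝ, VG) 1 G := IsManifold.of_le (n := ∞) (by simp)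
  have := mfderiv_extChartAt_self (I := 𝓘(ℝ, VG)) (x := (1 : G))
  exact congrArg (fun L : VG →L[ℝ] VG => L v) this

theorem mfd_symm_oneChart {g : G} (hg : g ∈ (oneChart VG G).source) (v : VG) :
    mfd VG VG (oneChart VG G).symm (oneChart VG G g) (mfd VG VG (oneChart VG G) g v) = v := by
  rw [← mfd_comp_of_eq (mdiff_oneChart_symm ((oneChart VG G).map_source hg)) (mdiff_oneChart hg)
    rfl]
  refine (mfd_congr ?_ v).trans (mfd_id g v)
  filter_upwards [extChartAt_source_mem_nhds' (I := 𝓘(ℝ, VG)) hg] with y hy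
  exact (oneChart VG G).left_inv hy

theorem mfd_oneChart_symm {x : VG} (hx : x ∈ (oneChart VG G).target) (v : VG) :
    mfd VG VG (oneChart VG G) ((oneChart VG G).symm x) (mfd VG VG (oneChart VG G).symm x v)
      = v := by
  rw [← mfd_comp_of_eq (mdiff_oneChart ((oneChart VG G).map_target hx)) (mdiff_oneChart_symm hx)
    rfl]
  refine (mfd_congr ?_ v).trans (mfd_id x v)
  filter_upwards [oneChart_target_mem_nhds hx] with y hy
  exact (oneChart VG G).right_inv hy

theorem mfd_oneChart_symm_one (v : VG) :
    mfd VG VG (oneChart VG G).symm (oneChart VG G 1) v = v := by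
  have := mfd_symm_oneChart (mem_extChartAt_source (I := 𝓘(ℝ, VG)) (1 : G)) v
  rwa [mfd_oneChart_one] at this

theorem leftD_apply {x : VG} (hx : x ∈ (oneChart VG G).target) (v : VG) :
    leftD VG G x v = mfd VG VG (oneChart VG G) ((oneChart VG G).symm x)
      (mfd VG VG (fun y => (oneChart VG G).symm x * y) 1 v) := by
  have h1 := mfd_comp_of_eq (x := oneChart VG G 1) (F := (oneChart VG G).symm)
    (mdiff_mul_left ((oneChart VG G).symm x) 1) (mdiff_oneChart_symm mem_oneChart_target)
    oneChart_symm_one v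
  rw [mfd_oneChart_symm_one] at h1
  rw [← h1, ← mfd_comp_of_eq (mdiff_oneChart ((oneChart VG G).map_target hx)), mfd_eq_fderiv]
  · rfl
  · have hc : ContMDiffAt 𝓘(ℝ, VG) 𝓘(ℝ, VG) ∞
        (fun z => (oneChart VG G).symm x * (oneChart VG G).symm z) (oneChart VG G 1) :=
      contMDiffAt_const.mul (contMDiffAt_oneChart_symm mem_oneChart_target)
    exact hc.mdifferentiableAt (by simp)
  · rw [oneChart_symm_one, mul_one]

theorem contDiffAt_chartMul {p : VG × VG} (h1 : p.1 ∈ (oneChart VG G).target)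
    (h2 : p.2 ∈ (oneChart VG G).target)
    (h : (oneChart VG G).symm p.1 * (oneChart VG G).symm p.2 ∈ (oneChart VG G).source) :
    ContDiffAt ℝ ∞ (chartMul VG G) p := by
  have h3 : ContMDiffAt 𝓘(ℝ, VG × VG) 𝓘(ℝ, VG) ∞
      (fun p : VG × VG => (oneChart VG G).symm p.1 * (oneChart VG G).symm p.2) p :=
    ((contMDiffAt_oneChart_symm h1).comp p contDiff_fst.contMDiff.contMDiffAt).mul
      ((contMDiffAt_oneChart_symm h2).comp p contDiff_snd.contMDiff.contMDiffAt)
  exact ContMDiffAt.contDiffAt (ContMDiffAt.comp (x := p) (g := oneChart VG G)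
    (contMDiffAt_oneChart h) h3)

theorem contDiffAt_chartMul_one {x : VG} (hx : x ∈ (oneChart VG G).target) :
    ContDiffAt ℝ ∞ (chartMul VG G) (x, oneChart VG G 1) := by
  refine contDiffAt_chartMul hx mem_oneChart_target ?_
  simp only [oneChart_symm_one, mul_one]
  exact (oneChart VG G).map_target hx

theorem leftD_eq {x : VG} (hx : x ∈ (oneChart VG G).target) :
    leftD VG G x = (fderiv ℝ (chartMul VG G) (x, oneChart VG G 1)).comp
      (ContinuousLinearMap.inr ℝ VG VG) := by
  have h := ((contDiffAt_chartMul_one (G := G) hx).differentiableAt (by simp)).hasFDerivAt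
  exact (h.comp (oneChart VG G 1) (hasFDerivAt_prodMk_right x _)).fderiv

theorem contDiffAt_leftD {x : VG} (hx : x ∈ (oneChart VG G).target) :
    ContDiffAt ℝ ∞ (leftD VG G) x := by
  have h1 : ContDiffAt ℝ ∞ (fun x => (fderiv ℝ (chartMul VG G) (x, oneChart VG G 1)).comp
      (ContinuousLinearMap.inr ℝ VG VG)) x := by
    have h2 : ContDiffAt ℝ ∞ (fun x => fderiv ℝ (chartMul VG G) (x, oneChart VG G 1)) x :=
      ((contDiffAt_chartMul_one (G := G) hx).fderiv_right (m := ∞) (by simp)).comp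
        (f := fun x => (x, oneChart VG G 1)) x
        (contDiffAt_id.prodMk contDiffAt_const)
    exact h2.clm_comp contDiffAt_const
  refine h1.congr_of_eventuallyEq ?_
  filter_upwards [oneChart_target_mem_nhds hx] with y hy
  exact leftD_eq hy

theorem leftD_one : leftD VG G (oneChart VG G 1) = 1 := by
  ext v
  rw [leftD_apply mem_oneChart_target, oneChart_symm_one, mfd_oneChart_one]
  simp [mfd_id]

theorem inverse_mfderiv_oneChart_symm {x : VG} (hx : x ∈ (oneChart VG G).target) (v : VG) :
    (mfd VG VG (oneChart VG G).symm x).inverse v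
      = mfd VG VG (oneChart VG G) ((oneChart VG G).symm x) v := by
  have h : (mfd VG VG (oneChart VG G).symm x).inverse
      = mfd VG VG (oneChart VG G) ((oneChart VG G).symm x) := by
    refine ContinuousLinearMap.inverse_eq ?_ ?_
    · ext w
      have := mfd_symm_oneChart ((oneChart VG G).map_target hx) w
      rwa [(oneChart VG G).right_inv hx] at this
    · ext w
      exact mfd_oneChart_symm hx w
  rw [h]

/-- The bracket, defined by left invariant vector fields, in the chart at `1`. -/
theorem lieBr_eq_leftD (v w : VG) :
    lieBr G v w = fderiv ℝ (leftD VG G) (oneChart VG G 1) v w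
      - fderiv ℝ (leftD VG G) (oneChart VG G 1) w v := by
  have : IsManifold 𝓘(ℝ, VG) 1 G := IsManifold.of_le (n := ∞) (by simp)
  let A : VG → VG → VG := fun v => VectorField.mpullbackWithin 𝓘(ℝ, VG) 𝓘(ℝ, VG)
    (oneChart VG G).symm (mulInvariantVectorField (I := 𝓘(ℝ, VG)) (G := G) v) (range 𝓘(ℝ, VG))
  have key : ∀ v : VG, ∀ x ∈ (oneChart VG G).target, A v x = leftD VG G x v := by
    intro v x hx
    change VectorField.mpullbackWithin 𝓘(ℝ, VG) 𝓘(ℝ, VG)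
      (oneChart VG G).symm (mulInvariantVectorField (I := 𝓘(ℝ, VG)) (G := G) v)
      (range 𝓘(ℝ, VG)) x = _
    rw [VectorField.mpullbackWithin_apply, modelWithCornersSelf_coe, range_id, mfderivWithin_univ,
      leftD_apply hx]
    exact inverse_mfderiv_oneChart_symm hx _
  have hd : ∀ v : VG, HasFDerivAt (A v)
      ((ContinuousLinearMap.apply ℝ VG v).comp (fderiv ℝ (leftD VG G) (oneChart VG G 1)))
      (oneChart VG G 1) := by
    intro v
    have h1 := ((contDiffAt_leftD (G := G) (mem_oneChart_target (VG := VG))).differentiableAt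
      (by simp)).hasFDerivAt
    have h2 := (ContinuousLinearMap.apply ℝ VG v).hasFDerivAt.comp (oneChart VG G 1) h1
    refine h2.congr_of_eventuallyEq ?_
    filter_upwards [oneChart_target_mem_nhds (mem_oneChart_target (VG := VG) (G := G))] with x hx
    exact key v x hx
  have h0 : lieBr G v w = (mfd VG VG (oneChart VG G) 1).inverse
      (VectorField.lieBracketWithin ℝ (A v) (A w)
        ((oneChart VG G).symm ⁻¹' univ ∩ range 𝓘(ℝ, VG)) (oneChart VG G 1)) := rfl
  have h1 : ((oneChart VG G).symm ⁻¹' univ ∩ range 𝓘(ℝ, VG)) = univ := by simp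
  have h2 : mfd VG VG (oneChart VG G) 1 = ContinuousLinearMap.id ℝ VG := by
    ext v
    exact mfd_oneChart_one v
  rw [h0, h1, VectorField.lieBracketWithin_univ, VectorField.lieBracket_eq, h2,
    ContinuousLinearMap.inverse_id, ContinuousLinearMap.id_apply]
  beta_reduce
  rw [(hd v).fderiv, (hd w).fderiv, key v _ mem_oneChart_target,
    key w _ mem_oneChart_target, leftD_one]
  rfl

variable (VG G) in
/-- The differential at `1` of the right multiplication by the element with coordinate `x`. -/
def rightD (x : VG) : VG →L[ℝ] VG :=
  (fderiv ℝ (chartMul VG G) (oneChart VG G 1, x)).comp (ContinuousLinearMap.inl ℝ VG VG)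

theorem contDiffAt_one_chartMul {x : VG} (hx : x ∈ (oneChart VG G).target) :
    ContDiffAt ℝ ∞ (chartMul VG G) (oneChart VG G 1, x) := by
  refine contDiffAt_chartMul mem_oneChart_target hx ?_
  simp only [oneChart_symm_one, one_mul]
  exact (oneChart VG G).map_target hx

theorem mdiff_mul_right (k x : G) : MDifferentiableAt 𝓘(ℝ, VG) 𝓘(ℝ, VG) (fun y => y * k) x :=
  (contMDiff_mul_right (I := 𝓘(ℝ, VG)) (n := ∞) (a := k)).mdifferentiable (by simp) x

theorem rightD_apply {x : VG} (hx : x ∈ (oneChart VG G).target) (v : VG) :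
    rightD VG G x v = mfd VG VG (oneChart VG G) ((oneChart VG G).symm x)
      (mfd VG VG (fun y => y * (oneChart VG G).symm x) 1 v) := by
  have h1 := mfd_comp_of_eq (x := oneChart VG G 1) (F := (oneChart VG G).symm)
    (mdiff_mul_right ((oneChart VG G).symm x) 1) (mdiff_oneChart_symm mem_oneChart_target)
    oneChart_symm_one v
  rw [mfd_oneChart_symm_one] at h1
  rw [← h1, ← mfd_comp_of_eq (mdiff_oneChart ((oneChart VG G).map_target hx)), mfd_eq_fderiv]
  · have h := ((contDiffAt_one_chartMul (G := G) hx).differentiableAt (by simp)).hasFDerivAt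
    exact congrArg (fun L : VG →L[ℝ] VG => L v)
      (HasFDerivAt.comp (f := fun y => (y, x)) (oneChart VG G 1) h
        (hasFDerivAt_prodMk_left _ x)).fderiv.symm
  · have hc : ContMDiffAt 𝓘(ℝ, VG) 𝓘(ℝ, VG) ∞
        (fun z => (oneChart VG G).symm z * (oneChart VG G).symm x) (oneChart VG G 1) :=
      (contMDiffAt_oneChart_symm mem_oneChart_target).mul contMDiffAt_const
    exact hc.mdifferentiableAt (by simp)
  · rw [oneChart_symm_one, one_mul]

/-- The coordinate form of `(g k g⁻¹) g = g k`. -/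
theorem rightD_conj {x : VG} (hx : x ∈ (oneChart VG G).target) (v : VG) :
    rightD VG G x ((conjModule VG G).lactL ((oneChart VG G).symm x) v) = leftD VG G x v := by
  rw [rightD_apply hx, leftD_apply hx]
  congr 1
  refine (mfd_comp_of_eq (F' := fun y => y * (oneChart VG G).symm x) (mdiff_mul_right _ _)
    ((conjModule VG G).mdiff_act ((oneChart VG G).symm x) 1) (map_one _) v).symm.trans ?_
  congr 2
  funext y
  simp [conjModule]

theorem two_le_infty : (2 : WithTop ℕ∞) ≤ ∞ := WithTop.coe_le_coe.2 le_top

/-- The derivative of the adjoint action is the bracket. Let `μ` be the multiplication in the chart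
at `1`. The bracket, defined by left invariant vector fields, is
`D²μ (v, 0) (0, w) - D²μ (w, 0) (0, v)`. Differentiation of `(g k g⁻¹) g = g k`, first in `k` and
then in `g`, at `1` shows that the derivative of the adjoint action is the same expression, up to
the symmetry of `D²μ`. -/
theorem dactL_conj (v w : VG) : (conjModule VG G).dactL v w = lieBr G v w := by
  have hs := (contDiffAt_chartMul_one (G := G) (mem_oneChart_target (VG := VG))).isSymmSndFDerivAt
    (by simpa using! two_le_infty)
  have hμ : HasFDerivAt (fderiv ℝ (chartMul VG G))
      (fderiv ℝ (fderiv ℝ (chartMul VG G)) (oneChart VG G 1, oneChart VG G 1))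
      (oneChart VG G 1, oneChart VG G 1) :=
    (((contDiffAt_chartMul_one (G := G) (mem_oneChart_target (VG := VG))).fderiv_right (m := ∞)
      (by simp)).differentiableAt (by simp)).hasFDerivAt
  -- derivatives at `1` of the left and right translations and of the adjoint action
  have hL : ∀ v w, fderiv ℝ (leftD VG G) (oneChart VG G 1) v w =
      fderiv ℝ (fderiv ℝ (chartMul VG G)) (oneChart VG G 1, oneChart VG G 1) (v, 0) (0, w) := by
    intro v w
    have h1 := ((HasFDerivAt.comp (f := fun y => (y, oneChart VG G 1)) (oneChart VG G 1) hμ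
      (hasFDerivAt_prodMk_left (oneChart VG G 1) (oneChart VG G 1))).clm_comp
        (hasFDerivAt_const (ContinuousLinearMap.inr ℝ VG VG) _)).congr_of_eventuallyEq
        (f₁ := leftD VG G) (by
          filter_upwards [oneChart_target_mem_nhds (mem_oneChart_target (VG := VG) (G := G))]
            with y hy
          exact leftD_eq hy)
    rw [h1.fderiv]
    simp
  have hR : HasFDerivAt (rightD VG G) _ (oneChart VG G 1) := ((hμ.comp (oneChart VG G 1)
      (hasFDerivAt_prodMk_right (oneChart VG G 1) (oneChart VG G 1))).clm_comp
        (hasFDerivAt_const (ContinuousLinearMap.inl ℝ VG VG) _))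
  have hA : HasFDerivAt (fun x => (conjModule VG G).lactL ((oneChart VG G).symm x) w)
      ((ContinuousLinearMap.apply ℝ VG w).comp (conjModule VG G).dactL) (oneChart VG G 1) := by
    have hm : ContMDiffAt 𝓘(ℝ, VG) 𝓘(ℝ, VG →L[ℝ] VG) ∞
        (fun x => (conjModule VG G).lactL ((oneChart VG G).symm x)) (oneChart VG G 1) :=
      (conjModule VG G).contMDiff_lactL.contMDiffAt.comp _
        (contMDiffAt_oneChart_symm mem_oneChart_target)
    have h2 := (hm.contDiffAt.differentiableAt (by simp)).hasFDerivAt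
    have h3 : fderiv ℝ (fun x => (conjModule VG G).lactL ((oneChart VG G).symm x))
        (oneChart VG G 1) = (conjModule VG G).dactL := by
      ext1 u
      rw [← mfd_eq_fderiv, mfd_comp_of_eq (F' := (conjModule VG G).lactL)
        ((conjModule VG G).mdiff_lactL 1) (mdiff_oneChart_symm mem_oneChart_target)
        oneChart_symm_one, mfd_oneChart_symm_one]
      rfl
    rw [h3] at h2
    exact (ContinuousLinearMap.apply ℝ VG w).hasFDerivAt.comp _ h2
  have hL' : HasFDerivAt (fun x => leftD VG G x w) ((ContinuousLinearMap.apply ℝ VG w).comp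
      (fderiv ℝ (leftD VG G) (oneChart VG G 1))) (oneChart VG G 1) :=
    (ContinuousLinearMap.apply ℝ VG w).hasFDerivAt.comp _
      ((contDiffAt_leftD (G := G) (mem_oneChart_target (VG := VG))).differentiableAt
        (by simp)).hasFDerivAt
  have h4 := (hR.clm_apply hA).unique (hL'.congr_of_eventuallyEq (by
    filter_upwards [oneChart_target_mem_nhds (mem_oneChart_target (VG := VG) (G := G))] with y hy
    exact rightD_conj hy w))
  have h6 : rightD VG G (oneChart VG G 1) = 1 := by
    ext u
    rw [rightD_apply mem_oneChart_target, oneChart_symm_one, mfd_oneChart_one]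
    simp [mfd_id]
  rw [h6, oneChart_symm_one, (conjModule VG G).lactL_one] at h4
  have h5 := congrArg (fun L : VG →L[ℝ] VG => L v) h4
  rw [lieBr_eq_leftD, hL w v, hs]
  generalize oneChart VG G 1 = x₀ at h5 ⊢
  simp only [add_apply, ContinuousLinearMap.comp_apply,
    ContinuousLinearMap.apply_apply, ContinuousLinearMap.flip_apply,
    ContinuousLinearMap.compL_apply,
    ContinuousLinearMap.comp_zero, zero_add, one_apply_eq_self, ContinuousLinearMap.inl_apply,
    ContinuousLinearMap.inr_apply] at h5
  exact eq_sub_of_add_eq h5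

theorem lieBr_neg_swap (v w : VG) : lieBr G v w = -lieBr G w v := by
  rw [lieBr_eq_leftD, lieBr_eq_leftD]
  abel

end Bracket

namespace LieCrossedModule

variable {VG VE G E : Type*}
  [NormedAddCommGroup VG] [NormedSpace ℝ VG] [NormedAddCommGroup VE] [NormedSpace ℝ VE]
  [TopologicalSpace G] [ChartedSpace VG G] [Group G] [LieGroup 𝓘(ℝ, VG) ∞ G]
  [TopologicalSpace E] [ChartedSpace VE E] [Group E] [LieGroup 𝓘(ℝ, VE) ∞ E]
  (C : LieCrossedModule VG VE G E)

theorem dactL_dbdL (u v : VE) : C.dactL (C.dbdL u) v = lieBr E u v := by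
  rw [C.dactL_dbdL_eq_conj, dactL_conj]

theorem dbdL_dactL (X : VG) (v : VE) : C.dbdL (C.dactL X v) = lieBr G X (C.dbdL v) := by
  rw [C.dbdL_dactL_eq_conj, dactL_conj]

theorem lactL_lieBr (g : G) (u v : VE) :
    C.lactL g (lieBr E u v) = lieBr E (C.lactL g u) (C.lactL g v) := by
  rw [← C.dactL_dbdL, C.lactL_dactL, ← C.dactL_dbdL, C.dbdL_lactL]

end LieCrossedModule

/-! ### Path-ordered exponentials: uniqueness and existence -/

section PathExp

variable {VG G : Type*} [NormedAddCommGroup VG] [NormedSpace ℝ VG]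
  [TopologicalSpace G] [ChartedSpace VG G]

theorem eventually_eq_of_hasVelWithinAt_zero [IsManifold 𝓘(ℝ, VG) 1 G] {f : ℝ → G} {a b : ℝ}
    (hf : ∀ t ∈ Icc a b, HasVelWithinAt f (0 : VG) (Icc a b) t) {t : ℝ} (ht : t ∈ Icc a b) :
    ∀ᶠ τ in 𝓝[Icc a b] t, f τ = f t := by
  have h1 := (hf t ht).continuousWithinAt.preimage_mem_nhdsWithin
    (extChartAt_source_mem_nhds (I := 𝓘(ℝ, VG)) (f t))
  obtain ⟨ε, hε, h2⟩ := Metric.mem_nhdsWithin_iff.1 h1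
  have h3 : ∀ τ ∈ Metric.ball t ε ∩ Icc a b,
      HasDerivWithinAt (fun τ => extChartAt 𝓘(ℝ, VG) (f t) (f τ)) 0
        (Metric.ball t ε ∩ Icc a b) τ := by
    intro τ hτ
    have := (hf τ hτ.2).comp_map (F := extChartAt 𝓘(ℝ, VG) (f t))
      (mdifferentiableAt_extChartAt (by simpa using h2 hτ))
    rw [map_zero] at this
    exact (hasVelWithinAt_iff_hasDerivWithinAt.1 this).mono inter_subset_right
  filter_upwards [inter_mem_nhdsWithin (Icc a b) (Metric.ball_mem_nhds t hε)] with τ hτ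
  have h4 := Convex.norm_image_sub_le_of_norm_hasDerivWithin_le (C := 0) h3 (by simp)
    ((convex_ball t ε).inter (convex_Icc a b)) ⟨Metric.mem_ball_self hε, ht⟩ ⟨hτ.2, hτ.1⟩
  rw [zero_mul] at h4
  exact (extChartAt 𝓘(ℝ, VG) (f t)).injOn (h2 ⟨hτ.2, hτ.1⟩)
    (h2 ⟨Metric.mem_ball_self hε, ht⟩) (sub_eq_zero.1 (norm_le_zero_iff.1 h4))

theorem eq_of_hasVelWithinAt_zero [IsManifold 𝓘(ℝ, VG) 1 G] {f : ℝ → G} {a b : ℝ}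
    (hf : ∀ t ∈ Icc a b, HasVelWithinAt f (0 : VG) (Icc a b) t) {t u : ℝ} (ht : t ∈ Icc a b)
    (hu : u ∈ Icc a b) : f t = f u := by
  refine IsPreconnected.induction₂' isPreconnected_Icc (fun x y => f x = f y) ?_
    (fun x y z _ _ _ h1 h2 => h1.trans h2) ht hu
  intro x hx
  filter_upwards [eventually_eq_of_hasVelWithinAt_zero hf hx] with y hy
  exact ⟨hy.symm, hy⟩

variable [Group G]

theorem HasLogDerivWithinAt.mono_of_mem {g : ℝ → G} {X : VG} {s s' : Set ℝ} {t : ℝ}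
    (h : HasLogDerivWithinAt g X s t) (hs : s ∈ 𝓝[s'] t) : HasLogDerivWithinAt g X s' t :=
  HasMFDerivWithinAt.mono_of_mem_nhdsWithin h hs

variable [LieGroup 𝓘(ℝ, VG) ∞ G]

/-- A curve is determined by its initial value and its logarithmic derivative, since `g h⁻¹` has
derivative zero. -/
theorem eq_of_hasLogDerivWithinAt {g h : ℝ → G} {X : ℝ → VG} {a b : ℝ}
    (hg : ∀ t ∈ Icc a b, HasLogDerivWithinAt g (X t) (Icc a b) t)
    (hh : ∀ t ∈ Icc a b, HasLogDerivWithinAt h (X t) (Icc a b) t)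
    (h0 : g a = h a) {t : ℝ} (ht : t ∈ Icc a b) : g t = h t := by
  have : IsManifold 𝓘(ℝ, VG) 1 G := IsManifold.of_le (n := ∞) (by simp)
  have h1 : ∀ t ∈ Icc a b, HasVelWithinAt (fun τ => g τ * (h τ)⁻¹) (0 : VG) (Icc a b) t := by
    intro t ht
    have := ((hg t ht).mul (hh t ht).inv)
    rw [inv_inv, add_neg_cancel] at this
    have := this.hasVelWithinAt
    rwa [map_zero] at this
  have h2 := eq_of_hasVelWithinAt_zero h1 ht (left_mem_Icc.2 (ht.1.trans ht.2))
  simp only [h0, mul_inv_cancel] at h2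
  exact mul_inv_eq_one.1 h2

theorem IsPathExp.pathExp_eq {a : ℝ → VG} {g : ℝ → G} (h : IsPathExp a g) {t : ℝ}
    (ht : t ∈ Icc (0 : ℝ) 1) : pathExp G a t = g t := by
  have h1 : IsPathExp a (pathExp G a) := by
    have hex : ∃ g : ℝ → G, IsPathExp a g := ⟨g, h⟩
    unfold pathExp
    rw [dif_pos hex]
    exact hex.choose_spec
  rw [isPathExp_iff] at h h1
  exact eq_of_hasLogDerivWithinAt h1.2 h.2 (h1.1.trans h.1.symm) ht

theorem hasDerivWithinAt_integral_Icc {F : Type*} [NormedAddCommGroup F] [NormedSpace ℝ F]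
    [CompleteSpace F] {c : ℝ → F} (hc : ContinuousOn c (Icc 0 1)) {t : ℝ}
    (ht : t ∈ Icc (0 : ℝ) 1) :
    HasDerivWithinAt (fun t => ∫ τ in (0 : ℝ)..t, c τ) (c t) (Icc 0 1) t := by
  have : Fact (t ∈ Icc (0 : ℝ) 1) := ⟨ht⟩
  apply intervalIntegral.integral_hasDerivWithinAt_right _
    (hc.stronglyMeasurableAtFilter_nhdsWithin measurableSet_Icc t) (hc _ ht)
  apply ContinuousOn.intervalIntegrable
  exact hc.mono (uIcc_subset_Icc (by simp) ht)

variable (G) in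
/-- The chart coordinates of solutions of `g' = g c` with a small coefficient `c`, from the
Picard–Lindelöf theorem. The smallness of `c` keeps the solution in the chart on all of `[0,1]`.
The last estimate says that the solution is `∫ c` up to second order; the differentiability with
respect to parameters rests on it. -/
theorem exists_coord_solution [CompleteSpace VG] : ∃ δ > 0, ∃ K ≥ 0, ∀ m ≥ 0, m ≤ δ →
    ∀ c : ℝ → VG, ContinuousOn c (Icc 0 1) → (∀ t ∈ Icc (0 : ℝ) 1, ‖c t‖ ≤ m) →
    ∃ x : ℝ → VG, x 0 = oneChart VG G 1 ∧ ∀ t ∈ Icc (0 : ℝ) 1,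
      HasDerivWithinAt x (leftD VG G (x t) (c t)) (Icc 0 1) t ∧ x t ∈ (oneChart VG G).target ∧
      ‖x t - oneChart VG G 1‖ ≤ 2 * m ∧
      ‖x t - oneChart VG G 1 - ∫ τ in (0 : ℝ)..t, c τ‖ ≤ K * m ^ 2 := by
  set x₀ := oneChart VG G 1 with hx₀
  obtain ⟨K, s, hs, hK⟩ := ((contDiffAt_leftD (G := G) (mem_oneChart_target
    (VG := VG))).of_le (m := 1) (by simp)).exists_lipschitzOnWith
  obtain ⟨r, hr, hrs⟩ := Metric.nhds_basis_closedBall.mem_iff.1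
    (Filter.inter_mem hs (oneChart_target_mem_nhds (mem_oneChart_target (VG := VG) (G := G))))
  -- a radius on which the differential of the left translations differs from `1` by at most `1`
  set a : ℝ := min r (1 / (K + 1)) with ha
  have ha0 : 0 < a := lt_min hr (by positivity)
  have hball : Metric.closedBall x₀ a ⊆ Metric.closedBall x₀ r :=
    Metric.closedBall_subset_closedBall (min_le_left _ _)
  have hKa : K * a ≤ 1 := by
    calc (K : ℝ) * a ≤ K * (1 / (K + 1)) := by gcongr; exact min_le_right _ _
      _ ≤ 1 := by rw [mul_one_div, div_le_one (by positivity)]; linarith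
  have hlip : ∀ x ∈ Metric.closedBall x₀ a, ‖leftD VG G x - 1‖ ≤ K * ‖x - x₀‖ := by
    intro x hx
    have := hK.norm_sub_le (hrs (hball hx)).1
      (hrs (hball (Metric.mem_closedBall_self ha0.le))).1
    rwa [leftD_one] at this
  have hnorm : ∀ x ∈ Metric.closedBall x₀ a, ‖leftD VG G x‖ ≤ 2 := by
    intro x hx
    have h1 := hlip x hx
    have h2 : ‖x - x₀‖ ≤ a := by simpa [dist_eq_norm] using hx
    have h3 : ‖leftD VG G x - 1‖ ≤ 1 :=
      h1.trans ((by gcongr : (K : ℝ) * ‖x - x₀‖ ≤ K * a).trans hKa)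
    calc ‖leftD VG G x‖ = ‖(leftD VG G x - 1) + 1‖ := by rw [sub_add_cancel]
      _ ≤ ‖leftD VG G x - 1‖ + ‖(1 : VG →L[ℝ] VG)‖ := norm_add_le _ _
      _ ≤ 1 + 1 := add_le_add h3 ContinuousLinearMap.norm_id_le
      _ = 2 := by norm_num
  refine ⟨a / 2, by positivity, 2 * K, by positivity, fun m hm0 hm c hc hcm => ?_⟩
  lift a to NNReal using ha0.le with a'
  lift m to NNReal using hm0 with m'
  have hpl : IsPicardLindelof (fun t x => leftD VG G x (c t)) (tmin := 0) (tmax := 1)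
      ⟨0, by simp⟩ x₀ a' 0 (2 * m') (K * m') := by
    refine ⟨fun t ht => ?_, fun x _ => ?_, fun t ht x hx => ?_, ?_⟩
    · refine LipschitzOnWith.of_dist_le_mul fun x hx y hy => ?_
      rw [dist_eq_norm, dist_eq_norm, ← sub_apply]
      have h1 := hK.norm_sub_le (hrs (hball hx)).1 (hrs (hball hy)).1
      calc ‖(leftD VG G x - leftD VG G y) (c t)‖
          ≤ ‖leftD VG G x - leftD VG G y‖ * ‖c t‖ := ContinuousLinearMap.le_opNorm _ _
        _ ≤ (K * ‖x - y‖) * m' := by gcongr; exact hcm t ht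
        _ = _ := by simp; ring
    · exact (leftD VG G x).continuous.comp_continuousOn hc
    · calc ‖leftD VG G x (c t)‖ ≤ ‖leftD VG G x‖ * ‖c t‖ := ContinuousLinearMap.le_opNorm _ _
        _ ≤ 2 * m' := by gcongr; exacts [hnorm x hx, hcm t ht]
        _ = _ := by simp
    · have : (2 : ℝ) * m' ≤ a' := by linarith
      simpa using! this
  obtain ⟨α, hα⟩ := ODE.FunSpace.exists_isFixedPt_next hpl (Metric.mem_closedBall_self le_rfl)
  have hmem : ∀ t, α.compProj t ∈ Metric.closedBall x₀ (a' : ℝ) := fun t =>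
    α.compProj_mem_closedBall hpl.mul_max_le
  have heq : ∀ t ∈ Icc (0 : ℝ) 1, α.compProj t
      = ODE.picard (fun t x => leftD VG G x (c t)) 0 x₀ α.compProj t := by
    intro t ht
    conv_lhs => rw [← hα]
    rw [ODE.FunSpace.compProj_of_mem ht]
    rfl
  have hder : ∀ t ∈ Icc (0 : ℝ) 1, HasDerivWithinAt α.compProj
      (leftD VG G (α.compProj t) (c t)) (Icc 0 1) t := by
    intro t ht
    refine (ODE.hasDerivWithinAt_picard_Icc (by simp) hpl.continuousOn_uncurry
      α.continuous_compProj.continuousOn (fun t _ => hmem t) x₀ ht).congr heq (heq t ht)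
  have h0 : α.compProj 0 = x₀ := by
    rw [heq 0 (by simp)]
    simp
  have hx : ∀ t ∈ Icc (0 : ℝ) 1, ‖α.compProj t - x₀‖ ≤ 2 * m' := by
    intro t ht
    have := Convex.norm_image_sub_le_of_norm_hasDerivWithin_le hder
      (fun t ht => hpl.norm_le t ht _ (hmem t)) (convex_Icc 0 1) (left_mem_Icc.2 zero_le_one) ht
    rw [h0] at this
    refine this.trans ?_
    have h1 : ‖t - 0‖ ≤ 1 := by rw [sub_zero, Real.norm_of_nonneg ht.1]; exact ht.2
    calc ((2 * m' : NNReal) : ℝ) * ‖t - 0‖ ≤ ((2 * m' : NNReal) : ℝ) * 1 := by gcongr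
      _ = 2 * m' := by simp
  have hint := fun t (ht : t ∈ Icc (0 : ℝ) 1) => hasDerivWithinAt_integral_Icc hc ht
  refine ⟨α.compProj, h0, fun t ht => ⟨hder t ht, (hrs (hball (hmem t))).2, hx t ht, ?_⟩⟩
  have h1 := Convex.norm_image_sub_le_of_norm_hasDerivWithin_le (C := 2 * K * m' ^ 2)
    (fun t ht => ((hder t ht).sub_const x₀).sub (hint t ht)) (fun t ht => ?_)
    (convex_Icc 0 1) (left_mem_Icc.2 zero_le_one) ht
  · simp only [Pi.sub_apply, h0, sub_self, intervalIntegral.integral_same, sub_zero] at h1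
    refine h1.trans ?_
    have h2 : ‖t‖ ≤ 1 := by rw [Real.norm_of_nonneg ht.1]; exact ht.2
    exact mul_le_of_le_one_right (by positivity) h2
  · have e : leftD VG G (α.compProj t) (c t) - c t = (leftD VG G (α.compProj t) - 1) (c t) := by
      simp
    rw [e]
    calc ‖(leftD VG G (α.compProj t) - 1) (c t)‖
        ≤ ‖leftD VG G (α.compProj t) - 1‖ * ‖c t‖ := ContinuousLinearMap.le_opNorm _ _
      _ ≤ (K * (2 * m')) * m' := by
          gcongr
          exacts [(hlip _ (hmem t)).trans (by gcongr; exact hx t ht), hcm t ht]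
      _ = 2 * K * m' ^ 2 := by ring

theorem HasDerivWithinAt.hasLogDerivWithinAt_oneChart_symm {x : ℝ → VG} {c : VG} {s : Set ℝ}
    {t : ℝ} (hx : HasDerivWithinAt x (leftD VG G (x t) c) s t)
    (ht : x t ∈ (oneChart VG G).target) :
    HasLogDerivWithinAt (fun τ => (oneChart VG G).symm (x τ)) c s t := by
  rw [hasLogDerivWithinAt_iff_hasVelWithinAt]
  have h1 := (hasVelWithinAt_iff_hasDerivWithinAt.2 hx).comp_map (mdiff_oneChart_symm ht)
  rw [leftD_apply ht] at h1
  have h2 := mfd_symm_oneChart ((oneChart VG G).map_target ht)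
    (mfd VG VG (fun y => (oneChart VG G).symm (x t) * y) 1 c)
  rw [(oneChart VG G).right_inv ht] at h2
  rwa [h2] at h1

variable (G) in
/-- Path-ordered exponentials of small coefficients stay in the chart at `1`, and their
coordinates are given by the integral of the coefficient up to second order. -/
theorem exists_coord_pathExp [CompleteSpace VG] : ∃ δ > 0, ∃ K ≥ 0, ∀ m ≥ 0, m ≤ δ →
    ∀ c : ℝ → VG, ContinuousOn c (Icc 0 1) → (∀ t ∈ Icc (0 : ℝ) 1, ‖c t‖ ≤ m) →
    ∃ x : ℝ → VG, IsPathExp c (fun t => (oneChart VG G).symm (x t)) ∧ ∀ t ∈ Icc (0 : ℝ) 1,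
      x t ∈ (oneChart VG G).target ∧ ‖x t - oneChart VG G 1‖ ≤ 2 * m ∧
      ‖x t - oneChart VG G 1 - ∫ τ in (0 : ℝ)..t, c τ‖ ≤ K * m ^ 2 := by
  obtain ⟨δ, hδ, K, hK, h⟩ := exists_coord_solution (VG := VG) G
  refine ⟨δ, hδ, K, hK, fun m hm0 hm c hc hcm => ?_⟩
  obtain ⟨x, hx0, hx⟩ := h m hm0 hm c hc hcm
  refine ⟨x, isPathExp_iff.2 ⟨?_, fun t ht => ?_⟩, fun t ht => (hx t ht).2⟩
  · simp only [hx0, oneChart_symm_one]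
  · exact (hx t ht).1.hasLogDerivWithinAt_oneChart_symm (hx t ht).2.1

/-- A continuous coefficient has a path-ordered exponential: on each piece of a fine equidistant
subdivision of `[0,1]` the rescaled coefficient is small, and the solutions on the pieces are
glued by left translations. -/
theorem exists_isPathExp [CompleteSpace VG] {a : ℝ → VG} (ha : ContinuousOn a (Icc 0 1)) :
    ∃ g : ℝ → G, IsPathExp a g := by
  obtain ⟨δ, hδ, K, hK, h⟩ := exists_coord_pathExp (VG := VG) G
  obtain ⟨M, hM⟩ := isCompact_Icc.exists_bound_of_continuousOn ha
  obtain ⟨N, hN⟩ := exists_nat_gt (max (M / δ) 0)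
  have hN0 : (0 : ℝ) < N := (le_max_right _ _).trans_lt hN
  have hMN : M / N ≤ δ := by
    rw [div_le_iff₀ hN0, mul_comm, ← div_le_iff₀ hδ]
    exact ((le_max_left _ _).trans_lt hN).le
  -- solutions on `[0, k/N]`, by induction on `k`
  have key : ∀ k : ℕ, k ≤ N → ∃ g : ℝ → G, g 0 = 1 ∧
      ∀ t ∈ Icc (0 : ℝ) (k / N), HasLogDerivWithinAt g (a t) (Icc 0 (k / N)) t := by
    intro k
    induction k with
    | zero =>
      intro _
      refine ⟨fun _ => 1, rfl, fun t ht => ?_⟩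
      simp only [CharP.cast_eq_zero, zero_div, Icc_self, mem_singleton_iff] at ht ⊢
      subst ht
      -- every tangent vector is a velocity within a one-point set
      refine hasVelWithinAt_of_extChartAt (p := 1) ?_ continuousWithinAt_const (by simp)
      simp [hasDerivWithinAt_iff_hasFDerivWithinAt]
    | succ k ih =>
      intro hk
      obtain ⟨g, hg0, hg⟩ := ih (by omega)
      have hkN : ((k : ℝ) + 1) / N ≤ 1 := by
        rw [div_le_one hN0]
        exact_mod_cast hk
      have hmaps : MapsTo (fun τ : ℝ => (k + τ) / N) (Icc 0 1) (Icc 0 1) := by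
        intro τ hτ
        refine ⟨div_nonneg (add_nonneg (Nat.cast_nonneg _) hτ.1) hN0.le, le_trans ?_ hkN⟩
        exact div_le_div_of_nonneg_right (add_le_add_right hτ.2 _) hN0.le
      have hM0 : 0 ≤ M := (norm_nonneg _).trans (hM 0 (by simp))
      obtain ⟨x, hx, -⟩ := h (M / N) (by positivity) hMN (fun τ => (1 / N : ℝ) • a ((k + τ) / N))
        ((ha.comp (by fun_prop) hmaps).const_smul _) (fun τ hτ => by
          rw [norm_smul, Real.norm_of_nonneg (by positivity), one_div_mul_eq_div]
          exact div_le_div_of_nonneg_right (hM _ (hmaps hτ)) hN0.le)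
      rw [isPathExp_iff] at hx
      -- the solution on the new piece, rescaled to `[0,1]`
      set y : ℝ → G := fun t => (oneChart VG G).symm (x t) with hy
      have hkk : (k : ℝ) / N ≤ (k + 1) / N := by gcongr; linarith
      have h1 : ∀ t ∈ Icc ((k : ℝ) / N) ((k + 1) / N), HasLogDerivWithinAt
          (fun t => g (k / N) * y (N * t - k)) (a t) (Icc ((k : ℝ) / N) ((k + 1) / N)) t := by
        intro t ht
        have hm : MapsTo (fun t : ℝ => N * t - k) (Icc ((k : ℝ) / N) ((k + 1) / N)) (Icc 0 1) := by
          intro t ht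
          have h1 := (div_le_iff₀ hN0).1 ht.1
          have h2 := (le_div_iff₀ hN0).1 ht.2
          constructor <;> simp only <;> linarith
        have h2 := (hx.2 _ (hm ht)).comp_real (χ := fun t : ℝ => N * t - k) (c := N)
          (s := Icc ((k : ℝ) / N) ((k + 1) / N)) (t := t)
          (by simpa using! (((hasDerivWithinAt_id t _).const_mul (N : ℝ)).sub_const (k : ℝ))) hm
        have h3 := h2.const_mul (g (k / N))
        have e : (k + (N * t - k)) / (N : ℝ) = t := by field_simp; ring
        simp only [e, smul_smul, mul_one_div_cancel hN0.ne', one_smul] at h3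
        exact h3
      have e0 : y (N * (k / N : ℝ) - k) = 1 := by
        rw [mul_div_cancel₀ _ hN0.ne', sub_self]
        exact hx.1
      refine ⟨fun t => if t ≤ k / N then g t else g (k / N) * y (N * t - k), ?_, fun t ht => ?_⟩
      · exact (if_pos (by positivity)).trans hg0
      push_cast at ht ⊢
      have hA : ∀ τ ∈ Icc (0 : ℝ) (k / N),
          (if τ ≤ k / N then g τ else g (k / N) * y (N * τ - k)) = g τ :=
        fun τ hτ => if_pos hτ.2
      have hB : ∀ τ ∈ Icc ((k : ℝ) / N) ((k + 1) / N),
          (if τ ≤ k / N then g τ else g (k / N) * y (N * τ - k)) = g (k / N) * y (N * τ - k) := by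
        intro τ hτ
        rcases hτ.1.eq_or_lt with h2 | h2
        · rw [← h2, if_pos le_rfl, e0, mul_one]
        · rw [if_neg (not_le.2 h2)]
      have hAB : Icc (0 : ℝ) ((k + 1) / N) = Icc (0 : ℝ) (k / N) ∪ Icc (k / N : ℝ) ((k + 1) / N) :=
        (Icc_union_Icc_eq_Icc (by positivity) hkk).symm
      rcases lt_trichotomy t (k / N) with h2 | h2 | h2
      · refine ((hg t ⟨ht.1, h2.le⟩).congr hA (hA t ⟨ht.1, h2.le⟩)).mono_of_mem ?_
        filter_upwards [self_mem_nhdsWithin, mem_nhdsWithin_of_mem_nhds (Iio_mem_nhds h2)]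
          with τ h3 h4
        exact ⟨h3.1, le_of_lt h4⟩
      · rw [hAB]
        have m1 : t ∈ Icc (0 : ℝ) (k / N) := ⟨ht.1, h2.le⟩
        have m2 : t ∈ Icc ((k : ℝ) / N) ((k + 1) / N) := ⟨h2.ge, ht.2⟩
        exact HasVelWithinAt.union ((hg t m1).congr hA (hA t m1)) ((h1 t m2).congr hB (hB t m2))
      · refine ((h1 t ⟨h2.le, ht.2⟩).congr hB (hB t ⟨h2.le, ht.2⟩)).mono_of_mem ?_
        filter_upwards [self_mem_nhdsWithin, mem_nhdsWithin_of_mem_nhds (Ioi_mem_nhds h2)]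
          with τ h3 h4
        exact ⟨le_of_lt h4, h3.2⟩
  obtain ⟨g, hg0, hg⟩ := key N le_rfl
  rw [div_self hN0.ne'] at hg
  exact ⟨g, isPathExp_iff.2 ⟨hg0, hg⟩⟩

theorem isPathExp_pathExp [CompleteSpace VG] {a : ℝ → VG} (ha : ContinuousOn a (Icc 0 1)) :
    IsPathExp a (pathExp G a) := by
  have hex : ∃ g : ℝ → G, IsPathExp a g := exists_isPathExp ha
  unfold pathExp
  rw [dif_pos hex]
  exact hex.choose_spec

end PathExp

/-! ### Dependence of path-ordered exponentials on a parameter -/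

section Parameter

/-- The unit interval. -/
abbrev I01 : Set ℝ := Icc (0 : ℝ) 1

theorem I01_zero : (0 : ℝ) ∈ I01 := left_mem_Icc.2 zero_le_one

theorem I01_one : (1 : ℝ) ∈ I01 := right_mem_Icc.2 zero_le_one

section Calculus

variable {F : Type*} [NormedAddCommGroup F] [NormedSpace ℝ F]

theorem ContinuousOn.slice₁ {X : Type*} [TopologicalSpace X] {f : ℝ → ℝ → X}
    (hf : ContinuousOn (Function.uncurry f) (I01 ×ˢ I01)) {s : ℝ} (hs : s ∈ I01) :
    ContinuousOn (fun t => f t s) I01 :=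
  ContinuousOn.comp (f := fun t => (t, s)) hf (by fun_prop) (fun _ ht => ⟨ht, hs⟩)

theorem ContinuousOn.slice₂ {X : Type*} [TopologicalSpace X] {f : ℝ → ℝ → X}
    (hf : ContinuousOn (Function.uncurry f) (I01 ×ˢ I01)) {t : ℝ} (ht : t ∈ I01) :
    ContinuousOn (fun s => f t s) I01 :=
  ContinuousOn.comp (f := fun s => (t, s)) hf (by fun_prop) (fun _ hs => ⟨ht, hs⟩)

omit [NormedSpace ℝ F] in
theorem eventually_forall_norm_sub_le {f : ℝ → ℝ → F}
    (hf : ContinuousOn (Function.uncurry f) (I01 ×ˢ I01)) {s₀ : ℝ} (hs₀ : s₀ ∈ I01) {ε : ℝ}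
    (hε : 0 < ε) :
    ∃ δ > 0, ∀ s ∈ I01, |s - s₀| < δ → ∀ t ∈ I01, ‖f t s - f t s₀‖ ≤ ε := by
  have h := (isCompact_Icc.prod isCompact_Icc).uniformContinuousOn_of_continuous hf
  obtain ⟨δ, hδ, h⟩ := Metric.uniformContinuousOn_iff.1 h ε hε
  refine ⟨δ, hδ, fun s hs hsδ t ht => ?_⟩
  have := h (t, s) ⟨ht, hs⟩ (t, s₀) ⟨ht, hs₀⟩ (by simp [Prod.dist_eq, Real.dist_eq, hsδ])
  rw [dist_eq_norm] at this
  exact this.le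

/-- Differentiability in `s` at `s₀`, uniformly in `t`. -/
theorem eventually_forall_norm_sub_smul_le {f d : ℝ → ℝ → F}
    (hd : ContinuousOn (Function.uncurry d) (I01 ×ˢ I01))
    (hfd : ∀ t ∈ I01, ∀ s ∈ I01, HasDerivWithinAt (fun s => f t s) (d t s) I01 s)
    {s₀ : ℝ} (hs₀ : s₀ ∈ I01) {ε : ℝ} (hε : 0 < ε) :
    ∃ δ > 0, ∀ s ∈ I01, |s - s₀| < δ → ∀ t ∈ I01,
      ‖f t s - f t s₀ - (s - s₀) • d t s₀‖ ≤ ε * |s - s₀| := by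
  obtain ⟨δ, hδ, h⟩ := eventually_forall_norm_sub_le hd hs₀ hε
  refine ⟨δ, hδ, fun s hs hsδ t ht => ?_⟩
  have hsub : uIcc s₀ s ⊆ I01 := uIcc_subset_Icc hs₀ hs
  have h1 : ∀ x ∈ uIcc s₀ s, HasDerivWithinAt (fun x => f t x - x • d t s₀) (d t x - d t s₀)
      (uIcc s₀ s) x := by
    intro x hx
    have := ((hasDerivWithinAt_id x (uIcc s₀ s)).smul_const (d t s₀))
    rw [one_smul] at this
    exact ((hfd t ht x (hsub hx)).mono hsub).sub this
  have h2 := Convex.norm_image_sub_le_of_norm_hasDerivWithin_le h1 (C := ε) (fun x hx => by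
    refine h x (hsub hx) (lt_of_le_of_lt ?_ hsδ) t ht
    exact abs_sub_left_of_mem_uIcc hx) (convex_uIcc _ _) left_mem_uIcc right_mem_uIcc
  rw [Real.norm_eq_abs] at h2
  convert h2 using 2
  module

theorem integral_eq_sub_Icc [CompleteSpace F] {f f' : ℝ → F}
    (hf : ∀ t ∈ I01, HasDerivWithinAt f (f' t) I01 t) (hf' : ContinuousOn f' I01) {t : ℝ}
    (ht : t ∈ I01) : ∫ τ in (0 : ℝ)..t, f' τ = f t - f 0 := by
  have hsub : Icc 0 t ⊆ I01 := Icc_subset_Icc le_rfl ht.2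
  refine intervalIntegral.integral_eq_sub_of_hasDerivAt_of_le ht.1
    (fun τ hτ => ((hf τ (hsub hτ)).continuousWithinAt).mono hsub) (fun τ hτ => ?_) ?_
  · exact (hf τ ⟨hτ.1.le, hτ.2.le.trans ht.2⟩).hasDerivAt
      (Icc_mem_nhds hτ.1 (hτ.2.trans_le ht.2))
  · refine ContinuousOn.intervalIntegrable ?_
    rw [uIcc_of_le ht.1]
    exact hf'.mono hsub

omit [NormedSpace ℝ F] in
theorem intervalIntegrable_of_I01 {f : ℝ → F} (hf : ContinuousOn f I01) {t : ℝ} (ht : t ∈ I01) :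
    IntervalIntegrable f MeasureTheory.volume 0 t :=
  ContinuousOn.intervalIntegrable (hf.mono (uIcc_subset_Icc I01_zero ht))

theorem clm_integral {F' : Type*} [NormedAddCommGroup F'] [NormedSpace ℝ F'] [CompleteSpace F]
    [CompleteSpace F'] (L : F →L[ℝ] F') {f : ℝ → F}
    (hf : ContinuousOn f I01) {t : ℝ} (ht : t ∈ I01) :
    L (∫ τ in (0 : ℝ)..t, f τ) = ∫ τ in (0 : ℝ)..t, L (f τ) :=
  (L.intervalIntegral_comp_comm (intervalIntegrable_of_I01 hf ht)).symm

theorem integral_congr_I01 {f f' : ℝ → F} (h : ∀ τ ∈ I01, f τ = f' τ) {t : ℝ} (ht : t ∈ I01) :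
    ∫ τ in (0 : ℝ)..t, f τ = ∫ τ in (0 : ℝ)..t, f' τ :=
  intervalIntegral.integral_congr fun τ hτ => h τ (uIcc_subset_Icc I01_zero ht hτ)

theorem continuousOn_integral {f : ℝ → ℝ → F}
    (hf : ContinuousOn (Function.uncurry f) (I01 ×ˢ I01)) :
    ContinuousOn (Function.uncurry fun t s => ∫ τ in (0 : ℝ)..t, f τ s) (I01 ×ˢ I01) := by
  let pr : ℝ → ℝ := fun t => projIcc (0 : ℝ) 1 zero_le_one t
  have hpr : Continuous pr := continuous_subtype_val.comp continuous_projIcc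
  have hprm : ∀ t, pr t ∈ I01 := fun t => (projIcc (0 : ℝ) 1 zero_le_one t).2
  have hpre : ∀ t ∈ I01, pr t = t := fun t ht => by simp [pr, projIcc_of_mem _ ht]
  have h1 : Continuous (Function.uncurry fun (p : ℝ × ℝ) (τ : ℝ) => f (pr τ) (pr p.2)) :=
    ContinuousOn.comp_continuous (f := fun q : (ℝ × ℝ) × ℝ => (pr q.2, pr q.1.2)) hf
      (by fun_prop) (fun q => ⟨hprm _, hprm _⟩)
  have h2 : Continuous fun p : ℝ × ℝ => ∫ τ in (0 : ℝ)..p.1, f (pr τ) (pr p.2) :=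
    intervalIntegral.continuous_parametric_intervalIntegral_of_continuous h1 continuous_fst
  refine h2.continuousOn.congr fun p hp => ?_
  refine integral_congr_I01 (fun τ hτ => ?_) hp.1
  rw [hpre τ hτ, hpre p.2 hp.2]

end Calculus

variable {VG G : Type*} [NormedAddCommGroup VG] [NormedSpace ℝ VG]
  [TopologicalSpace G] [ChartedSpace VG G] [Group G] [LieGroup 𝓘(ℝ, VG) ∞ G]

variable (VG) in
/-- The adjoint action, as continuous linear maps. -/
abbrev adL (g : G) : VG →L[ℝ] VG := (conjModule VG G).lactL g

theorem adL_apply (g : G) (X : VG) : adL VG g X = adj g X := rfl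

theorem adL_one (X : VG) : adL VG (1 : G) X = X := by
  change (conjModule VG G).lactL 1 X = X
  rw [LieCrossedModule.lactL_one]
  rfl

theorem adL_mul (g h : G) (X : VG) : adL VG (g * h) X = adL VG g (adL VG h X) :=
  LieCrossedModule.lactL_mul _ _ _ _

theorem adL_inv_adL (g : G) (X : VG) : adL VG g⁻¹ (adL VG g X) = X := by
  rw [← LieCrossedModule.lactL_mul, inv_mul_cancel, LieCrossedModule.lactL_one]
  rfl

theorem adL_adL_inv (g : G) (X : VG) : adL VG g (adL VG g⁻¹ X) = X := by
  rw [← LieCrossedModule.lactL_mul, mul_inv_cancel, LieCrossedModule.lactL_one]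
  rfl

variable [CompleteSpace VG]

theorem hasLogDerivWithinAt_pathExp {a : ℝ → VG} (ha : ContinuousOn a I01) {t : ℝ}
    (ht : t ∈ I01) : HasLogDerivWithinAt (pathExp G a) (a t) I01 t :=
  (isPathExp_iff.1 (isPathExp_pathExp ha)).2 t ht

theorem pathExp_zero {a : ℝ → VG} (ha : ContinuousOn a I01) : pathExp G a 0 = 1 :=
  (isPathExp_pathExp ha).1

theorem continuousOn_pathExp {a : ℝ → VG} (ha : ContinuousOn a I01) :
    ContinuousOn (pathExp G a) I01 :=
  fun _ ht => (hasLogDerivWithinAt_pathExp ha ht).continuousWithinAt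

theorem pathExp_congr {a a' : ℝ → VG} (ha : ContinuousOn a I01) (h : ∀ t ∈ I01, a' t = a t)
    {t : ℝ} (ht : t ∈ I01) : pathExp G a' t = pathExp G a t := by
  have h1 := isPathExp_iff.1 (isPathExp_pathExp (G := G) ha)
  refine IsPathExp.pathExp_eq (isPathExp_iff.2 ⟨h1.1, fun t ht => ?_⟩) ht
  rw [h t ht]
  exact h1.2 t ht

omit [CompleteSpace VG] in
theorem pathExp_eq_one {a : ℝ → VG} (h : ∀ t ∈ I01, a t = 0) {t : ℝ} (ht : t ∈ I01) :
    pathExp G a t = 1 := by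
  refine IsPathExp.pathExp_eq (g := fun _ => 1) (isPathExp_iff.2 ⟨rfl, fun t ht => ?_⟩) ht
  rw [h t ht]
  exact hasLogDerivWithinAt_const _ _ _

/-- The ratio of two path-ordered exponentials is the path-ordered exponential of the conjugated
difference of the coefficients. -/
theorem isPathExp_ratio {a a' : ℝ → VG} (ha : ContinuousOn a I01) (ha' : ContinuousOn a' I01) :
    IsPathExp (fun t => adL VG (pathExp G a' t) (a t - a' t))
      (fun t => pathExp G a t * (pathExp G a' t)⁻¹) := by
  refine isPathExp_iff.2 ⟨by simp [pathExp_zero ha, pathExp_zero ha'], fun t ht => ?_⟩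
  have := (hasLogDerivWithinAt_pathExp (G := G) ha ht).mul
    (hasLogDerivWithinAt_pathExp (G := G) ha' ht).inv
  rw [inv_inv] at this
  rw [map_sub, sub_eq_add_neg]
  exact this

/-- The coordinates of the ratio of two path-ordered exponentials with close coefficients: up to
second order, they are the integral of the conjugated difference of the coefficients. -/
theorem exists_coord_ratio {a : ℝ → VG} (ha : ContinuousOn a I01) :
    ∃ δ > 0, ∃ K ≥ 0, ∀ m ≥ 0, m ≤ δ → ∀ a' : ℝ → VG, ContinuousOn a' I01 →
      (∀ t ∈ I01, ‖a' t - a t‖ ≤ m) → ∃ x : ℝ → VG, ∀ t ∈ I01,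
      pathExp G a' t * (pathExp G a t)⁻¹ = (oneChart VG G).symm (x t) ∧
      x t ∈ (oneChart VG G).target ∧ ‖x t - oneChart VG G 1‖ ≤ K * m ∧
      ‖x t - oneChart VG G 1 - ∫ τ in (0 : ℝ)..t, adL VG (pathExp G a τ) (a' τ - a τ)‖
        ≤ K * m ^ 2 := by
  obtain ⟨δ, hδ, K, hK, h⟩ := exists_coord_pathExp (VG := VG) G
  have hcont : ContinuousOn (fun t => adL VG (pathExp G a t)) I01 :=
    (conjModule VG G).continuous_lactL.comp_continuousOn (continuousOn_pathExp ha)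
  obtain ⟨R, hR⟩ := isCompact_Icc.exists_bound_of_continuousOn hcont
  have hR0 : 0 ≤ R := (norm_nonneg _).trans (hR 0 I01_zero)
  -- `R` bounds the adjoint action along the path, so the coefficient of the ratio is at most `R
  -- m`
  refine ⟨δ / (R + 1), by positivity, 2 * R + K * R ^ 2, by positivity,
    fun m hm0 hm a' ha' haa' => ?_⟩
  rw [le_div_iff₀ (by positivity)] at hm
  obtain ⟨x, hx, hx'⟩ := h (R * m) (by positivity) (by linarith)
    (fun t => adL VG (pathExp G a t) (a' t - a t)) (hcont.clm_apply (ha'.sub ha)) (fun t ht => by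
      refine (ContinuousLinearMap.le_opNorm _ _).trans ?_
      gcongr
      exacts [hR t ht, haa' t ht])
  refine ⟨x, fun t ht => ⟨?_, (hx' t ht).1, (hx' t ht).2.1.trans ?_, (hx' t ht).2.2.trans ?_⟩⟩
  · rw [← hx.pathExp_eq ht, (isPathExp_ratio ha' ha).pathExp_eq ht]
  · have : 0 ≤ K * R ^ 2 * m := by positivity
    linarith
  · have : 0 ≤ 2 * R * m ^ 2 := by positivity
    nlinarith

theorem eventually_ratio_mem {a : ℝ → ℝ → VG}
    (ha : ContinuousOn (Function.uncurry a) (I01 ×ˢ I01)) {s₀ : ℝ} (hs₀ : s₀ ∈ I01) {U : Set G}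
    (hU : U ∈ 𝓝 (1 : G)) :
    ∀ᶠ s in 𝓝[I01] s₀, ∀ t ∈ I01,
      pathExp G (fun t => a t s) t * (pathExp G (fun t => a t s₀) t)⁻¹ ∈ U := by
  obtain ⟨δ, hδ, K, hK, h⟩ := exists_coord_ratio (G := G) (ha.slice₁ hs₀)
  have hκ : (oneChart VG G).symm ⁻¹' U ∈ 𝓝 (oneChart VG G 1) := by
    refine (contMDiffAt_oneChart_symm (mem_oneChart_target
      (VG := VG) (G := G))).continuousAt.preimage_mem_nhds ?_
    rwa [oneChart_symm_one]
  obtain ⟨ε, hε, hball⟩ := Metric.nhds_basis_closedBall.mem_iff.1 hκ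
  obtain ⟨δ', hδ', h'⟩ := eventually_forall_norm_sub_le ha hs₀
    (lt_min hδ (by positivity : 0 < ε / (K + 1)))
  filter_upwards [inter_mem_nhdsWithin I01 (Metric.ball_mem_nhds s₀ hδ')] with s hs t ht
  obtain ⟨x, hx⟩ := h (min δ (ε / (K + 1))) (by positivity) (min_le_left _ _) _ (ha.slice₁ hs.1)
    (h' s hs.1 hs.2)
  rw [(hx t ht).1]
  refine hball ?_
  rw [Metric.mem_closedBall, dist_eq_norm]
  refine (hx t ht).2.2.1.trans ?_
  calc K * min δ (ε / (K + 1)) ≤ (K + 1) * (ε / (K + 1)) := by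
        gcongr
        · linarith
        · exact min_le_right _ _
    _ = ε := by field_simp

/-- Path-ordered exponentials depend continuously on the end point and on a parameter. -/
theorem continuousOn_pathExp_param {a : ℝ → ℝ → VG}
    (ha : ContinuousOn (Function.uncurry a) (I01 ×ˢ I01)) :
    ContinuousOn (Function.uncurry fun t s => pathExp G (fun t => a t s) t) (I01 ×ˢ I01) := by
  rintro ⟨t₀, s₀⟩ ⟨ht₀, hs₀⟩
  have : IsTopologicalGroup G := topologicalGroup_of_lieGroup 𝓘(ℝ, VG) ∞
  have h1 : Filter.Tendsto (fun p : ℝ × ℝ => pathExp G (fun t => a t p.2) p.1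
      * (pathExp G (fun t => a t s₀) p.1)⁻¹) (𝓝[I01 ×ˢ I01] (t₀, s₀)) (𝓝 1) := by
    intro U hU
    rw [Filter.mem_map]
    have h2 : Filter.Tendsto Prod.snd (𝓝[I01 ×ˢ I01] (t₀, s₀)) (𝓝[I01] s₀) :=
      (continuous_snd.continuousWithinAt).tendsto_nhdsWithin (fun p hp => hp.2)
    filter_upwards [h2.eventually (eventually_ratio_mem ha hs₀ hU), self_mem_nhdsWithin]
      with p hp hp'
    exact hp p.1 hp'.1
  have h3 : Filter.Tendsto (fun p : ℝ × ℝ => pathExp G (fun t => a t s₀) p.1)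
      (𝓝[I01 ×ˢ I01] (t₀, s₀)) (𝓝 (pathExp G (fun t => a t s₀) t₀)) :=
    (continuousOn_pathExp (ha.slice₁ hs₀) t₀ ht₀).tendsto.comp
      ((continuous_fst.continuousWithinAt).tendsto_nhdsWithin (fun p hp => hp.1))
  have h4 := h1.mul h3
  rw [one_mul] at h4
  refine h4.congr fun p => ?_
  simp [Function.uncurry]

/-- Duhamel's formula: the derivative of a path-ordered exponential with respect to a parameter. -/
theorem hasLogDerivWithinAt_pathExp_param {a d : ℝ → ℝ → VG}
    (ha : ContinuousOn (Function.uncurry a) (I01 ×ˢ I01))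
    (hd : ContinuousOn (Function.uncurry d) (I01 ×ˢ I01))
    (had : ∀ t ∈ I01, ∀ s ∈ I01, HasDerivWithinAt (fun s => a t s) (d t s) I01 s)
    {t s₀ : ℝ} (ht : t ∈ I01) (hs₀ : s₀ ∈ I01) :
    HasLogDerivWithinAt (fun s => pathExp G (fun t => a t s) t)
      (adL VG (pathExp G (fun t => a t s₀) t)⁻¹
        (∫ τ in (0 : ℝ)..t, adL VG (pathExp G (fun t => a t s₀) τ) (d τ s₀))) I01 s₀ := by
  set g : ℝ → ℝ → G := fun s t => pathExp G (fun t => a t s) t with hg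
  set w₀ : VG := ∫ τ in (0 : ℝ)..t, adL VG (g s₀ τ) (d τ s₀) with hw₀
  obtain ⟨δ, hδ, K, hK, h⟩ := exists_coord_ratio (G := G) (ha.slice₁ hs₀)
  have hAd : ContinuousOn (fun t => adL VG (g s₀ t)) I01 :=
    (conjModule VG G).continuous_lactL.comp_continuousOn (continuousOn_pathExp (ha.slice₁ hs₀))
  obtain ⟨R, hR⟩ := isCompact_Icc.exists_bound_of_continuousOn hAd
  have hR0 : 0 ≤ R := (norm_nonneg _).trans (hR 0 I01_zero)
  obtain ⟨D, hD⟩ := isCompact_Icc.exists_bound_of_continuousOn (hd.slice₁ hs₀)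
  have hD0 : 0 ≤ D := (norm_nonneg _).trans (hD 0 I01_zero)
  have hder : HasDerivWithinAt (fun s => oneChart VG G (g s t * (g s₀ t)⁻¹)) w₀ I01 s₀ := by
    rw [hasDerivWithinAt_iff_isLittleO, Asymptotics.isLittleO_iff]
    intro ε hε
    -- `ε' R` bounds the error of the coefficients, `K (D + 1)² |s - s₀|` that of the coordinates
    set ε' : ℝ := min 1 (ε / (2 * (R + 1))) with hε'
    have hε'0 : 0 < ε' := lt_min one_pos (by positivity)
    obtain ⟨δ₁, hδ₁, h₁⟩ := eventually_forall_norm_sub_smul_le hd had hs₀ hε'0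
    set δ₂ : ℝ := min (δ / (D + 1)) (ε / (2 * (K * (D + 1) ^ 2 + 1))) with hδ₂
    have hδ₂0 : 0 < δ₂ := lt_min (by positivity) (by positivity)
    filter_upwards [inter_mem_nhdsWithin I01 (Metric.ball_mem_nhds s₀ (lt_min hδ₁ hδ₂0))]
      with s hs
    have hsd : |s - s₀| < min δ₁ δ₂ := hs.2
    have hs1 := h₁ s hs.1 (hsd.trans_le (min_le_left _ _))
    have hsd2 : |s - s₀| ≤ δ₂ := (hsd.trans_le (min_le_right _ _)).le
    have hm : ∀ t ∈ I01, ‖a t s - a t s₀‖ ≤ (D + 1) * |s - s₀| := by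
      intro t ht
      calc ‖a t s - a t s₀‖ = ‖(a t s - a t s₀ - (s - s₀) • d t s₀) + (s - s₀) • d t s₀‖ := by
            rw [sub_add_cancel]
        _ ≤ ε' * |s - s₀| + |s - s₀| * D := by
            refine (norm_add_le _ _).trans (add_le_add (hs1 t ht) ?_)
            rw [norm_smul, Real.norm_eq_abs]
            gcongr
            exact hD t ht
        _ ≤ 1 * |s - s₀| + |s - s₀| * D := by gcongr; exact min_le_left _ _
        _ = (D + 1) * |s - s₀| := by ring
    have hmδ : (D + 1) * |s - s₀| ≤ δ := by
      have := hsd2.trans (min_le_left _ _)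
      rw [le_div_iff₀ (by positivity)] at this
      linarith
    obtain ⟨x, hx⟩ := h ((D + 1) * |s - s₀|) (by positivity) hmδ _ (ha.slice₁ hs.1) hm
    obtain ⟨hx1, hx2, -, hx3⟩ := hx t ht
    have hI1 : ContinuousOn (fun τ => adL VG (g s₀ τ) (a τ s - a τ s₀)) I01 :=
      hAd.clm_apply ((ha.slice₁ hs.1).sub (ha.slice₁ hs₀))
    have hI2 : ContinuousOn (fun τ => adL VG (g s₀ τ) (d τ s₀)) I01 :=
      hAd.clm_apply (hd.slice₁ hs₀)
    have hint : ‖(∫ τ in (0 : ℝ)..t, adL VG (g s₀ τ) (a τ s - a τ s₀)) - (s - s₀) • w₀‖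
        ≤ R * (ε' * |s - s₀|) := by
      have hI3 : ContinuousOn (fun τ => (s - s₀) • adL VG (g s₀ τ) (d τ s₀)) I01 :=
        hI2.const_smul _
      rw [hw₀, ← intervalIntegral.integral_smul, ← intervalIntegral.integral_sub
        (intervalIntegrable_of_I01 hI1 ht) (intervalIntegrable_of_I01 hI3 ht)]
      refine (intervalIntegral.norm_integral_le_of_norm_le_const
        (C := R * (ε' * |s - s₀|)) fun τ hτ => ?_).trans ?_
      · have hτ' : τ ∈ I01 := uIcc_subset_Icc I01_zero ht (uIoc_subset_uIcc hτ)
        rw [← map_smul, ← map_sub]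
        refine (ContinuousLinearMap.le_opNorm _ _).trans ?_
        gcongr
        exacts [hR τ hτ', hs1 τ hτ']
      · rw [sub_zero, abs_of_nonneg ht.1]
        exact mul_le_of_le_one_right (by positivity) ht.2
    have e1 : oneChart VG G (g s t * (g s₀ t)⁻¹) = x t := by
      rw [hg, hx1, (oneChart VG G).right_inv hx2]
    rw [e1, mul_inv_cancel, Real.norm_eq_abs]
    have b1 : K * ((D + 1) * |s - s₀|) ^ 2 ≤ ε / 2 * |s - s₀| := by
      have h5 := hsd2.trans (min_le_right _ _)
      rw [le_div_iff₀ (by positivity)] at h5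
      have h6 : K * (D + 1) ^ 2 * |s - s₀| ≤ ε / 2 := by
        have := abs_nonneg (s - s₀)
        linarith
      calc K * ((D + 1) * |s - s₀|) ^ 2 = (K * (D + 1) ^ 2 * |s - s₀|) * |s - s₀| := by ring
        _ ≤ ε / 2 * |s - s₀| := by gcongr
    have b2 : R * (ε' * |s - s₀|) ≤ ε / 2 * |s - s₀| := by
      have h7 : R * ε' ≤ ε / 2 := by
        calc R * ε' ≤ (R + 1) * (ε / (2 * (R + 1))) := by
              gcongr
              · linarith
              · exact min_le_right _ _
          _ = ε / 2 := by field_simp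
      calc R * (ε' * |s - s₀|) = (R * ε') * |s - s₀| := by ring
        _ ≤ ε / 2 * |s - s₀| := by gcongr
    calc ‖x t - oneChart VG G 1 - (s - s₀) • w₀‖
        = ‖(x t - oneChart VG G 1 - ∫ τ in (0 : ℝ)..t, adL VG (g s₀ τ) (a τ s - a τ s₀))
          + ((∫ τ in (0 : ℝ)..t, adL VG (g s₀ τ) (a τ s - a τ s₀)) - (s - s₀) • w₀)‖ := by
          congr 1; abel
      _ ≤ ε / 2 * |s - s₀| + ε / 2 * |s - s₀| :=
          (norm_add_le _ _).trans (add_le_add (hx3.trans b1) (hint.trans b2))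
      _ = ε * |s - s₀| := by ring
  have : IsTopologicalGroup G := topologicalGroup_of_lieGroup 𝓘(ℝ, VG) ∞
  have hc : ContinuousWithinAt (fun s => g s t * (g s₀ t)⁻¹) I01 s₀ :=
    ((continuousOn_pathExp_param (G := G) ha).slice₂ ht s₀ hs₀).mul continuousWithinAt_const
  have hr : HasVelWithinAt (fun s => g s t * (g s₀ t)⁻¹) w₀ I01 s₀ :=
    hasVelWithinAt_of_extChartAt hder hc (mul_inv_cancel _)
  have hr' : HasLogDerivWithinAt (fun s => g s t * (g s₀ t)⁻¹) w₀ I01 s₀ := by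
    refine HasVelWithinAt.congr hr (fun s _ => ?_) ?_ <;> simp
  have hf := hr'.mul (hasLogDerivWithinAt_const (g s₀ t) I01 s₀)
  rw [add_zero] at hf
  exact hf.congr (fun s _ => by simp [hg]) (by simp [hg])

end Parameter

/-! ### The non-abelian Stokes theorem on the unit square -/

section Stokes

/-- The pair `a₁ dt + a₂ ds` of continuous functions on `[0,1]²` with continuous derivatives
`d₁ = ∂a₁/∂s` and `d₂ = ∂a₂/∂t`. -/
structure IsSqConn {F : Type*} [NormedAddCommGroup F] [NormedSpace ℝ F]
    (a₁ a₂ d₁ d₂ : ℝ → ℝ → F) : Prop where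
  cont₁ : ContinuousOn (Function.uncurry a₁) (I01 ×ˢ I01)
  cont₂ : ContinuousOn (Function.uncurry a₂) (I01 ×ˢ I01)
  cont_d₁ : ContinuousOn (Function.uncurry d₁) (I01 ×ˢ I01)
  cont_d₂ : ContinuousOn (Function.uncurry d₂) (I01 ×ˢ I01)
  deriv₁ : ∀ t ∈ I01, ∀ s ∈ I01, HasDerivWithinAt (fun s => a₁ t s) (d₁ t s) I01 s
  deriv₂ : ∀ t ∈ I01, ∀ s ∈ I01, HasDerivWithinAt (fun t => a₂ t s) (d₂ t s) I01 t

variable {VG G : Type*} [NormedAddCommGroup VG] [NormedSpace ℝ VG]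
  [TopologicalSpace G] [ChartedSpace VG G] [Group G]

/-- Parallel transport from `(0,0)` upwards to `(0,s)` and then to the right to `(t,s)`. -/
def axial (G : Type*) [TopologicalSpace G] [ChartedSpace VG G] [Group G]
    (a₁ a₂ : ℝ → ℝ → VG) (t s : ℝ) : G :=
  pathExp G (fun s' => a₂ 0 s') s * pathExp G (fun t' => a₁ t' s) t

variable [LieGroup 𝓘(ℝ, VG) ∞ G] [CompleteSpace VG] {a₁ a₂ d₁ d₂ c : ℝ → ℝ → VG}

theorem continuousOn_axial (ha₁ : ContinuousOn (Function.uncurry a₁) (I01 ×ˢ I01))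
    (ha₂ : ContinuousOn (Function.uncurry a₂) (I01 ×ˢ I01)) :
    ContinuousOn (Function.uncurry (axial G a₁ a₂)) (I01 ×ˢ I01) := by
  have : IsTopologicalGroup G := topologicalGroup_of_lieGroup 𝓘(ℝ, VG) ∞
  exact ((continuousOn_pathExp (ha₂.slice₂ I01_zero)).comp continuousOn_snd
    (fun p hp => hp.2)).mul (continuousOn_pathExp_param ha₁)

theorem axial_zero (ha₁ : ContinuousOn (Function.uncurry a₁) (I01 ×ˢ I01)) {s : ℝ}
    (hs : s ∈ I01) : axial G a₁ a₂ 0 s = pathExp G (fun s' => a₂ 0 s') s := by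
  rw [axial, pathExp_zero (ha₁.slice₁ hs), mul_one]

theorem axial_bottom (ha₂ : ContinuousOn (Function.uncurry a₂) (I01 ×ˢ I01)) (t : ℝ) :
    axial G a₁ a₂ t 0 = pathExp G (fun t' => a₁ t' 0) t := by
  rw [axial, pathExp_zero (ha₂.slice₂ I01_zero), one_mul]

theorem hasLogDerivWithinAt_axial₁ (ha₁ : ContinuousOn (Function.uncurry a₁) (I01 ×ˢ I01))
    {t s : ℝ} (ht : t ∈ I01) (hs : s ∈ I01) :
    HasLogDerivWithinAt (fun t => axial G a₁ a₂ t s) (a₁ t s) I01 t :=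
  (hasLogDerivWithinAt_pathExp (ha₁.slice₁ hs) ht).const_mul _

/-- The derivative of the axial transport in the transversal direction: it differs from `a₂` by the
curvature `c` between the left edge and the point. -/
theorem IsSqConn.hasLogDerivWithinAt_axial (h : IsSqConn a₁ a₂ d₁ d₂)
    (hc : ContinuousOn (Function.uncurry c) (I01 ×ˢ I01))
    (hcurv : ∀ t ∈ I01, ∀ s ∈ I01, c t s = d₂ t s - d₁ t s + lieBr G (a₁ t s) (a₂ t s))
    {t s : ℝ} (ht : t ∈ I01) (hs : s ∈ I01) :
    HasLogDerivWithinAt (fun s => axial G a₁ a₂ t s)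
      (a₂ t s - adL VG (axial G a₁ a₂ t s)⁻¹
        (∫ τ in (0 : ℝ)..t, adL VG (axial G a₁ a₂ τ s) (c τ s))) I01 s := by
  set g : ℝ → G := fun t => pathExp G (fun t' => a₁ t' s) t with hg
  set Z : G := pathExp G (fun s' => a₂ 0 s') s with hZ
  have hAd : ContinuousOn (fun t => adL VG (g t)) I01 :=
    (conjModule VG G).continuous_lactL.comp_continuousOn (continuousOn_pathExp (h.cont₁.slice₁ hs))
  -- the covariant derivative of `a₂` in the direction `t` is `d₁ + c`; its integral turns the
  -- integral of `d₁` in the Duhamel formula into boundary terms and the integral of `c`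
  have hder : ∀ τ ∈ I01, HasDerivWithinAt (fun τ => adL VG (g τ) (a₂ τ s))
      (adL VG (g τ) (d₁ τ s) + adL VG (g τ) (c τ s)) I01 τ := by
    intro τ hτ
    have := HasLogDerivWithinAt.lactL_apply (conjModule VG G)
      (hasLogDerivWithinAt_pathExp (G := G) (h.cont₁.slice₁ hs) hτ) (h.deriv₂ τ hτ s hs)
    rw [dactL_conj] at this
    refine this.congr_deriv ?_
    rw [← map_add, hcurv τ hτ s hs]
    congr 1
    abel
  have hi1 : ContinuousOn (fun τ => adL VG (g τ) (d₁ τ s)) I01 :=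
    hAd.clm_apply (h.cont_d₁.slice₁ hs)
  have hi2 : ContinuousOn (fun τ => adL VG (g τ) (c τ s)) I01 := hAd.clm_apply (hc.slice₁ hs)
  have hint := integral_eq_sub_Icc hder (hi1.add hi2) ht
  rw [intervalIntegral.integral_add (intervalIntegrable_of_I01 hi1 ht)
    (intervalIntegrable_of_I01 hi2 ht)] at hint
  have hg0 : g 0 = 1 := pathExp_zero (h.cont₁.slice₁ hs)
  have e1 : ∫ τ in (0 : ℝ)..t, adL VG (g τ) (d₁ τ s)
      = adL VG (g t) (a₂ t s) - a₂ 0 s - ∫ τ in (0 : ℝ)..t, adL VG (g τ) (c τ s) := by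
    rw [eq_sub_iff_add_eq, hint, hg0, adL_one]
  have hmul := (hasLogDerivWithinAt_pathExp (G := G) (h.cont₂.slice₂ I01_zero) hs).mul
    (hasLogDerivWithinAt_pathExp_param (G := G) h.cont₁ h.cont_d₁ h.deriv₁ ht hs)
  refine Eq.mp (congrArg (fun X => HasLogDerivWithinAt _ X I01 s) ?_) hmul
  have e2 : ∫ τ in (0 : ℝ)..t, adL VG (axial G a₁ a₂ τ s) (c τ s)
      = adL VG Z (∫ τ in (0 : ℝ)..t, adL VG (g τ) (c τ s)) := by
    rw [clm_integral _ hi2 ht]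
    refine integral_congr_I01 (fun τ _ => ?_) ht
    exact adL_mul _ _ _
  change adL VG (g t)⁻¹ (a₂ 0 s) + adL VG (g t)⁻¹ (∫ τ in (0 : ℝ)..t, adL VG (g τ) (d₁ τ s)) = _
  rw [e1, e2, show axial G a₁ a₂ t s = Z * g t from rfl, mul_inv_rev,
    adL_mul (g t)⁻¹, adL_inv_adL, map_sub, map_sub, adL_inv_adL]
  abel

/-- The non-abelian Stokes theorem: the transport around the boundary of `[0,1] × [0,s]`, as a
function of `s`, is the path-ordered exponential of the curvature `c`, transported to `(0,0)` and
integrated over horizontal lines. -/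
theorem IsSqConn.isPathExp_boundary (h : IsSqConn a₁ a₂ d₁ d₂)
    (hc : ContinuousOn (Function.uncurry c) (I01 ×ˢ I01))
    (hcurv : ∀ t ∈ I01, ∀ s ∈ I01, c t s = d₂ t s - d₁ t s + lieBr G (a₁ t s) (a₂ t s)) :
    IsPathExp (fun s => ∫ t in (0 : ℝ)..1, adL VG (axial G a₁ a₂ t s) (c t s))
      (fun s => pathExp G (fun t => a₁ t 0) 1 * pathExp G (fun s => a₂ 1 s) s
        * (axial G a₁ a₂ 1 s)⁻¹) := by
  refine isPathExp_iff.2 ⟨?_, fun s hs => ?_⟩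
  · rw [pathExp_zero (h.cont₂.slice₂ I01_one), axial_bottom h.cont₂]
    simp
  · have := ((hasLogDerivWithinAt_pathExp (G := G) (h.cont₂.slice₂ I01_one) hs).const_mul
      (pathExp G (fun t => a₁ t 0) 1)).mul
      (h.hasLogDerivWithinAt_axial hc hcurv I01_one hs).inv
    refine Eq.mp (congrArg (fun X => HasLogDerivWithinAt _ X I01 s) ?_) this
    rw [inv_inv, ← adL_apply, ← adL_apply, map_sub, adL_adL_inv]
    abel

end Stokes

/-! ### Surface-ordered exponentials -/

section Surface

variable {VG VE G E : Type*}
  [NormedAddCommGroup VG] [NormedSpace ℝ VG] [NormedAddCommGroup VE] [NormedSpace ℝ VE]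
  [TopologicalSpace G] [ChartedSpace VG G] [Group G]
  [TopologicalSpace E] [ChartedSpace VE E] [Group E]
  (C : LieCrossedModule VG VE G E)

/-- A pair of forms `(a₁ dt + a₂ ds, b dt ∧ ds)` on `[0,1]²` with vanishing fake curvature. -/
structure IsFakeFlat (a₁ a₂ d₁ d₂ : ℝ → ℝ → VG) (b : ℝ → ℝ → VE) : Prop
    extends IsSqConn a₁ a₂ d₁ d₂ where
  cont_b : ContinuousOn (Function.uncurry b) (I01 ×ˢ I01)
  dbd_b : ∀ t ∈ I01, ∀ s ∈ I01,
    C.dbdL (b t s) = d₂ t s - d₁ t s + lieBr G (a₁ t s) (a₂ t s)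

/-- The surface-ordered exponential over `[0,1] × [0,s]`. -/
def surfPath (a₁ a₂ : ℝ → ℝ → VG) (b : ℝ → ℝ → VE) : ℝ → E :=
  pathExp E (fun s => ∫ t in (0 : ℝ)..1, C.lactL (axial G a₁ a₂ t s) (b t s))

variable {C} {a₁ a₂ d₁ d₂ : ℝ → ℝ → VG} {b : ℝ → ℝ → VE}
  [LieGroup 𝓘(ℝ, VG) ∞ G] [LieGroup 𝓘(ℝ, VE) ∞ E] [CompleteSpace VG] [CompleteSpace VE]

omit [CompleteSpace VE] in
theorem continuousOn_lactL_axial (ha₁ : ContinuousOn (Function.uncurry a₁) (I01 ×ˢ I01))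
    (ha₂ : ContinuousOn (Function.uncurry a₂) (I01 ×ˢ I01))
    (hb : ContinuousOn (Function.uncurry b) (I01 ×ˢ I01)) :
    ContinuousOn (Function.uncurry fun t s => C.lactL (axial G a₁ a₂ t s) (b t s))
      (I01 ×ˢ I01) :=
  (C.continuous_lactL.comp_continuousOn (continuousOn_axial ha₁ ha₂)).clm_apply hb

omit [CompleteSpace VE] in
theorem continuousOn_integral_lactL_axial
    (ha₁ : ContinuousOn (Function.uncurry a₁) (I01 ×ˢ I01))
    (ha₂ : ContinuousOn (Function.uncurry a₂) (I01 ×ˢ I01))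
    (hb : ContinuousOn (Function.uncurry b) (I01 ×ˢ I01)) :
    ContinuousOn (fun s => ∫ t in (0 : ℝ)..1, C.lactL (axial G a₁ a₂ t s) (b t s)) I01 :=
  (continuousOn_integral (continuousOn_lactL_axial ha₁ ha₂ hb)).slice₂ I01_one

namespace IsFakeFlat

variable (h : IsFakeFlat C a₁ a₂ d₁ d₂ b)
include h

theorem isPathExp_surfPath :
    IsPathExp (fun s => ∫ t in (0 : ℝ)..1, C.lactL (axial G a₁ a₂ t s) (b t s))
      (surfPath C a₁ a₂ b) :=
  isPathExp_pathExp (continuousOn_integral_lactL_axial h.cont₁ h.cont₂ h.cont_b)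

omit [LieGroup 𝓘(ℝ, VG) ∞ G] [LieGroup 𝓘(ℝ, VE) ∞ E] [CompleteSpace VG] [CompleteSpace VE] in
theorem cont_dbd : ContinuousOn (Function.uncurry fun t s => C.dbdL (b t s)) (I01 ×ˢ I01) :=
  C.dbdL.continuous.comp_continuousOn h.cont_b

theorem dbdL_integral {t s : ℝ} (ht : t ∈ I01) (hs : s ∈ I01) :
    C.dbdL (∫ τ in (0 : ℝ)..t, C.lactL (axial G a₁ a₂ τ s) (b τ s))
      = ∫ τ in (0 : ℝ)..t, adL VG (axial G a₁ a₂ τ s) (C.dbdL (b τ s)) := by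
  rw [clm_integral _ ((continuousOn_lactL_axial h.cont₁ h.cont₂ h.cont_b).slice₁ hs) ht]
  exact integral_congr_I01 (fun τ _ => C.dbdL_lactL _ _) ht

/-- The surface-ordered exponential is a filler of the holonomy around the boundary. -/
theorem bd_surfPath {s : ℝ} (hs : s ∈ I01) :
    C.bd (surfPath C a₁ a₂ b s) = pathExp G (fun t => a₁ t 0) 1 * pathExp G (fun s => a₂ 1 s) s
        * (axial G a₁ a₂ 1 s)⁻¹ := by
  have h1 := isPathExp_iff.1 h.isPathExp_surfPath
  rw [← (h.isPathExp_boundary h.cont_dbd h.dbd_b).pathExp_eq hs]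
  symm
  refine IsPathExp.pathExp_eq (g := fun s => C.bd (surfPath C a₁ a₂ b s))
    (isPathExp_iff.2 ⟨by rw [h1.1, map_one], fun s hs => ?_⟩) hs
  have := (h1.2 s hs).bd C
  rwa [h.dbdL_integral I01_one hs] at this

/-- The transversal derivative of the axial transport of a section `v` of `𝔢`: the covariant
derivative of `v`, transported, with a commutator of the curvature part. -/
theorem hasDerivWithinAt_lactL_axial {v : ℝ → VE} {v' : VE} {t s : ℝ} (ht : t ∈ I01)
    (hs : s ∈ I01) (hv : HasDerivWithinAt v v' I01 s) :
    HasDerivWithinAt (fun s => C.lactL (axial G a₁ a₂ t s) (v s))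
      (C.lactL (axial G a₁ a₂ t s) (C.dactL (a₂ t s) (v s) + v')
        - lieBr E (∫ τ in (0 : ℝ)..t, C.lactL (axial G a₁ a₂ τ s) (b τ s))
            (C.lactL (axial G a₁ a₂ t s) (v s))) I01 s := by
  have := HasLogDerivWithinAt.lactL_apply C
    (h.hasLogDerivWithinAt_axial h.cont_dbd h.dbd_b ht hs) hv
  refine this.congr_deriv ?_
  rw [map_sub, sub_apply, ← h.dbdL_integral ht hs, map_add, map_sub, map_add,
    C.lactL_dactL _ (adL VG _ _), ← adL_apply, adL_adL_inv, C.dactL_dbdL]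
  abel

end IsFakeFlat

end Surface

/-! ### Transition elements along curves -/

section Transition

variable {VG VE G E : Type*}
  [NormedAddCommGroup VG] [NormedSpace ℝ VG] [NormedAddCommGroup VE] [NormedSpace ℝ VE]
  [TopologicalSpace G] [ChartedSpace VG G] [Group G]
  [TopologicalSpace E] [ChartedSpace VE E] [Group E]

section Bracket

variable [LieGroup 𝓘(ℝ, VE) ∞ E]

theorem continuousOn_lieBr {X : Type*} [TopologicalSpace X] {f g : X → VE} {s : Set X}
    (hf : ContinuousOn f s) (hg : ContinuousOn g s) :
    ContinuousOn (fun x => lieBr E (f x) (g x)) s := by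
  simp_rw [← dactL_conj (G := E)]
  exact ((conjModule VE E).dactL.continuous.comp_continuousOn hf).clm_apply hg

theorem lieBr_add_left (u u' v : VE) : lieBr E (u + u') v = lieBr E u v + lieBr E u' v := by
  simp_rw [← dactL_conj (G := E), map_add, add_apply]

theorem lieBr_add_right (u v v' : VE) : lieBr E u (v + v') = lieBr E u v + lieBr E u v' := by
  simp_rw [← dactL_conj (G := E), map_add]

theorem lieBr_neg_left (u v : VE) : lieBr E (-u) v = -lieBr E u v := by
  simp_rw [← dactL_conj (G := E), map_neg, neg_apply]

theorem lieBr_neg_right (u v : VE) : lieBr E u (-v) = -lieBr E u v := by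
  simp_rw [← dactL_conj (G := E), map_neg]

theorem lieBr_smul_left (r : ℝ) (u v : VE) : lieBr E (r • u) v = r • lieBr E u v := by
  simp_rw [← dactL_conj (G := E), map_smul, smul_apply]

theorem lieBr_zero_right (u : VE) : lieBr E u 0 = 0 := by
  rw [← dactL_conj (G := E), map_zero]

end Bracket

variable (C : LieCrossedModule VG VE G E)

/-- The transition element of the 1-form `α` and its shift by `∂y`, as a path-ordered exponential:
the solution of `F' = - F (h ▷ y)`, where `h` is the holonomy of `α + ∂y`. -/
def transPath (α : ℝ → VG) (y : ℝ → VE) : ℝ → E :=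
  pathExp E (fun t => -C.lactL (pathExp G (fun t => α t + C.dbdL (y t)) t) (y t))

variable {C} [LieGroup 𝓘(ℝ, VG) ∞ G] [LieGroup 𝓘(ℝ, VE) ∞ E] [CompleteSpace VG] [CompleteSpace VE]
  {α : ℝ → VG} {y : ℝ → VE}

omit [CompleteSpace VE] in
theorem continuousOn_transCoeff (hα : ContinuousOn α I01) (hy : ContinuousOn y I01) :
    ContinuousOn (fun t => -C.lactL (pathExp G (fun t => α t + C.dbdL (y t)) t) (y t)) I01 :=
  ((C.continuous_lactL.comp_continuousOn (continuousOn_pathExp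
    (hα.add (C.dbdL.continuous.comp_continuousOn hy)))).clm_apply hy).neg

/-- The transition element fills the bigon between the holonomies of `α` and of `α + ∂y`. -/
theorem bd_transPath (hα : ContinuousOn α I01) (hy : ContinuousOn y I01) {t : ℝ} (ht : t ∈ I01) :
    C.bd (transPath C α y t)
      = pathExp G α t * (pathExp G (fun t => α t + C.dbdL (y t)) t)⁻¹ := by
  have hα' : ContinuousOn (fun t => α t + C.dbdL (y t)) I01 :=
    hα.add (C.dbdL.continuous.comp_continuousOn hy)
  have h1 := isPathExp_iff.1 (isPathExp_pathExp (G := E) (continuousOn_transCoeff (C := C) hα hy))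
  rw [← (isPathExp_ratio (G := G) hα hα').pathExp_eq ht]
  symm
  refine IsPathExp.pathExp_eq (g := fun s => C.bd (transPath C α y s))
    (isPathExp_iff.2 ⟨?_, fun s hs => ?_⟩) ht
  · rw [transPath, h1.1, map_one]
  · have := (h1.2 s hs).bd C
    refine Eq.mp (congrArg (fun X => HasLogDerivWithinAt _ X I01 s) ?_) this
    rw [map_neg, C.dbdL_lactL, sub_add_cancel_left, map_neg]
    rfl

/-- The surface-ordered exponential over `γ × id` that defines the transition element is a
path-ordered exponential, by Stokes' theorem for a flat connection with values in `𝔢`. -/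
theorem surfExp_eq_transPath (hα : ContinuousOn α I01) (hy : ContinuousOn y I01) :
    surfExp C (fun t z => α t + z • C.dbd (y t)) (fun _ _ => 0) (fun t _ => -y t)
      = transPath C α y 1 := by
  set a₁ : ℝ → ℝ → VG := fun t z => α t + z • C.dbdL (y t) with ha₁
  set a₂ : ℝ → ℝ → VG := fun _ _ => 0 with ha₂
  set b : ℝ → ℝ → VE := fun t _ => -y t with hb
  have cy : ContinuousOn (Function.uncurry fun t (_ : ℝ) => y t) (I01 ×ˢ I01) :=
    hy.comp continuousOn_fst (fun p hp => hp.1)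
  have cdy : ContinuousOn (Function.uncurry fun t (_ : ℝ) => C.dbdL (y t)) (I01 ×ˢ I01) :=
    C.dbdL.continuous.comp_continuousOn cy
  have ca₁ : ContinuousOn (Function.uncurry a₁) (I01 ×ˢ I01) :=
    (hα.comp continuousOn_fst (fun p hp => hp.1)).add (continuousOn_snd.smul cdy)
  have h : IsFakeFlat C a₁ a₂ (fun t _ => C.dbdL (y t)) (fun _ _ => 0) b :=
    { cont₁ := ca₁
      cont₂ := continuousOn_const
      cont_d₁ := cdy
      cont_d₂ := continuousOn_const
      deriv₁ := fun t _ s _ => by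
        have := ((hasDerivWithinAt_id s I01).smul_const (C.dbdL (y t))).const_add (α t)
        rwa [one_smul] at this
      deriv₂ := fun t _ s _ => hasDerivWithinAt_const _ _ _
      cont_b := cy.neg
      dbd_b := fun t _ s _ => by
        simp [hb, ha₂, lieBr_zero_right] }
  set k := axial G a₁ a₂ with hk
  set w : ℝ → ℝ → VE := fun t z => C.lactL (k t z) (y t) with hw
  set I : ℝ → ℝ → VE := fun t z => ∫ τ in (0 : ℝ)..t, C.lactL (k τ z) (b τ z) with hI
  have cw : ContinuousOn (Function.uncurry w) (I01 ×ˢ I01) :=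
    continuousOn_lactL_axial h.cont₁ h.cont₂ cy
  have cb : ContinuousOn (Function.uncurry fun t z => C.lactL (k t z) (b t z)) (I01 ×ˢ I01) :=
    continuousOn_lactL_axial h.cont₁ h.cont₂ h.cont_b
  have cI : ContinuousOn (Function.uncurry I) (I01 ×ˢ I01) := continuousOn_integral cb
  -- with `w = k ▷ y` and `I` the integral of `k ▷ b`, the connection `-z w dt + I dz` is flat; it
  -- vanishes on the left and bottom edges, its transport along the right edge is the
  -- surface-ordered exponential, and along the top edge the transition element
  have hε : IsSqConn (fun t z => -(z • w t z)) I
      (fun t z => -(w t z + z • -lieBr E (I t z) (w t z))) (fun t z => C.lactL (k t z) (b t z)) :=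
    { cont₁ := (continuousOn_snd.smul cw).neg
      cont₂ := cI
      cont_d₁ := (cw.add (continuousOn_snd.smul (continuousOn_lieBr (E := E) cI cw).neg)).neg
      cont_d₂ := cb
      deriv₁ := fun t ht s hs => by
        have := h.hasDerivWithinAt_lactL_axial ht hs (hasDerivWithinAt_const s I01 (y t))
        refine ((hasDerivWithinAt_id s I01).smul this).neg.congr_deriv ?_
        simp [ha₂, hw, hI, hk, add_comm]
      deriv₂ := fun t ht s hs => hasDerivWithinAt_integral_Icc (cb.slice₁ hs) ht }
  have hcurv : ∀ t ∈ I01, ∀ s ∈ I01, (0 : VE) = C.lactL (k t s) (b t s)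
      - -(w t s + s • -lieBr E (I t s) (w t s)) + lieBr E (-(s • w t s)) (I t s) := by
    intro t _ s _
    rw [lieBr_neg_left, lieBr_smul_left, lieBr_neg_swap (w t s), hb, map_neg]
    simp [hw]
  have hS := (hε.isPathExp_boundary (G := E) (c := fun _ _ => 0) continuousOn_const
    hcurv).pathExp_eq I01_one
  rw [pathExp_eq_one (fun s _ => by simp) I01_one,
    pathExp_eq_one (a := fun t => -((0 : ℝ) • w t 0)) (fun s _ => by simp) I01_one, one_mul,
    axial, pathExp_eq_one (a := fun s' => I 0 s') (fun s _ => by simp [hI]) I01_one, one_mul] at hS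
  have hS' := eq_of_mul_inv_eq_one hS.symm
  change pathExp E (fun s => I 1 s) 1 = _
  rw [hS', transPath]
  refine pathExp_congr (continuousOn_transCoeff hα hy) (fun t ht => ?_) I01_one
  have : k t 1 = pathExp G (fun t => α t + C.dbdL (y t)) t := by
    rw [hk, axial, pathExp_eq_one (fun s _ => rfl) I01_one, one_mul]
    simp [ha₁]
  simp [hw, this]

end Transition

/-! ### Surface-ordered exponentials and gauge transformations -/

section Gauge

variable {VG VE G E : Type*}
  [NormedAddCommGroup VG] [NormedSpace ℝ VG] [NormedAddCommGroup VE] [NormedSpace ℝ VE]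
  [TopologicalSpace G] [ChartedSpace VG G] [Group G]
  [TopologicalSpace E] [ChartedSpace VE E] [Group E]
  (C : LieCrossedModule VG VE G E)

/-- The component `b + dη + ½ η ∧ η + a ∧ η` of the shift by `η` of the pair `(a, b)`; here
`m₁ = ∂η₁/∂s` and `m₂ = ∂η₂/∂t`. -/
def shiftB (a₁ a₂ : ℝ → ℝ → VG) (b η₁ η₂ m₁ m₂ : ℝ → ℝ → VE) (t s : ℝ) : VE :=
  b t s + (m₂ t s - m₁ t s) + lieBr E (η₁ t s) (η₂ t s)
    + (C.dactL (a₁ t s) (η₂ t s) - C.dactL (a₂ t s) (η₁ t s))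

variable {C} [LieGroup 𝓘(ℝ, VG) ∞ G] [LieGroup 𝓘(ℝ, VE) ∞ E]
  {a₁ a₂ d₁ d₂ : ℝ → ℝ → VG} {b η₁ η₂ m₁ m₂ : ℝ → ℝ → VE}

theorem dbdL_lieBr (u v : VE) : C.dbdL (lieBr E u v) = lieBr G (C.dbdL u) (C.dbdL v) := by
  rw [← C.dactL_dbdL, C.dbdL_dactL]

/-- The shift `(a + ∂η, b + dη + ½ η ∧ η + a ∧ η)` has vanishing fake curvature again. -/
theorem IsFakeFlat.shift (h : IsFakeFlat C a₁ a₂ d₁ d₂ b) (hη : IsSqConn η₁ η₂ m₁ m₂) :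
    IsFakeFlat C (fun t s => a₁ t s + C.dbdL (η₁ t s)) (fun t s => a₂ t s + C.dbdL (η₂ t s))
      (fun t s => d₁ t s + C.dbdL (m₁ t s)) (fun t s => d₂ t s + C.dbdL (m₂ t s))
      (shiftB C a₁ a₂ b η₁ η₂ m₁ m₂) where
  cont₁ := h.cont₁.add (C.dbdL.continuous.comp_continuousOn hη.cont₁)
  cont₂ := h.cont₂.add (C.dbdL.continuous.comp_continuousOn hη.cont₂)
  cont_d₁ := h.cont_d₁.add (C.dbdL.continuous.comp_continuousOn hη.cont_d₁)
  cont_d₂ := h.cont_d₂.add (C.dbdL.continuous.comp_continuousOn hη.cont_d₂)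
  deriv₁ t ht s hs := (h.deriv₁ t ht s hs).add
    (C.dbdL.hasFDerivAt.comp_hasDerivWithinAt s (hη.deriv₁ t ht s hs))
  deriv₂ t ht s hs := (h.deriv₂ t ht s hs).add
    (C.dbdL.hasFDerivAt.comp_hasDerivWithinAt t (hη.deriv₂ t ht s hs))
  cont_b := ((h.cont_b.add (hη.cont_d₂.sub hη.cont_d₁)).add
    (continuousOn_lieBr hη.cont₁ hη.cont₂)).add
      (((C.dactL.continuous.comp_continuousOn h.cont₁).clm_apply hη.cont₂).sub
        ((C.dactL.continuous.comp_continuousOn h.cont₂).clm_apply hη.cont₁))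
  dbd_b t ht s hs := by
    simp only [shiftB, map_add, map_sub, h.dbd_b t ht s hs, dbdL_lieBr, C.dbdL_dactL,
      lieBr_add_left, lieBr_add_right]
    rw [lieBr_neg_swap (C.dbdL (η₁ t s)) (a₂ t s)]
    abel

variable [CompleteSpace VG] [CompleteSpace VE]

/-- The holonomies of a pair and of its shift by `η` differ by the transition elements along the
four sides; this is Stokes' theorem for a connection with values in `𝔢` and curvature `k ▷ b`. -/
theorem IsFakeFlat.surfPath_shift (h : IsFakeFlat C a₁ a₂ d₁ d₂ b) (hη : IsSqConn η₁ η₂ m₁ m₂) :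
    C.act (pathExp G (fun t => a₁ t 0) 1)
        (transPath C (fun s => a₂ 1 s) (fun s => η₂ 1 s) 1)
      * transPath C (fun t => a₁ t 0) (fun t => η₁ t 0) 1
      * surfPath C (fun t s => a₁ t s + C.dbdL (η₁ t s)) (fun t s => a₂ t s + C.dbdL (η₂ t s))
          (shiftB C a₁ a₂ b η₁ η₂ m₁ m₂) 1
    = surfPath C a₁ a₂ b 1
      * C.act (pathExp G (fun s => a₂ 0 s) 1)
        (transPath C (fun t => a₁ t 1) (fun t => η₁ t 1) 1)
      * transPath C (fun s => a₂ 0 s) (fun s => η₂ 0 s) 1 := by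
  have h' := h.shift hη
  set a₁' : ℝ → ℝ → VG := fun t s => a₁ t s + C.dbdL (η₁ t s) with ha₁'
  set a₂' : ℝ → ℝ → VG := fun t s => a₂ t s + C.dbdL (η₂ t s) with ha₂'
  set b' := shiftB C a₁ a₂ b η₁ η₂ m₁ m₂ with hb'
  set k := axial G a₁' a₂' with hk
  set w₁ : ℝ → ℝ → VE := fun t s => C.lactL (k t s) (η₁ t s) with hw₁
  set w₂ : ℝ → ℝ → VE := fun t s => C.lactL (k t s) (η₂ t s) with hw₂
  set β : ℝ → ℝ → VE := fun t s => C.lactL (k t s) (b' t s) with hβ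
  set I : ℝ → ℝ → VE := fun t s => ∫ τ in (0 : ℝ)..t, β τ s with hI
  have ck : ContinuousOn (Function.uncurry fun t s => C.lactL (k t s)) (I01 ×ˢ I01) :=
    C.continuous_lactL.comp_continuousOn (continuousOn_axial h'.cont₁ h'.cont₂)
  have cw₁ : ContinuousOn (Function.uncurry w₁) (I01 ×ˢ I01) := ck.clm_apply hη.cont₁
  have cw₂ : ContinuousOn (Function.uncurry w₂) (I01 ×ˢ I01) := ck.clm_apply hη.cont₂
  have cβ : ContinuousOn (Function.uncurry β) (I01 ×ˢ I01) := ck.clm_apply h'.cont_b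
  have cI : ContinuousOn (Function.uncurry I) (I01 ×ˢ I01) := continuousOn_integral cβ
  -- the auxiliary connection `-w₁ dt + (-w₂ + I) ds`, where `w₁`, `w₂` and `β` are the components
  -- of the shift and of `b'` transported to `(0,0)` along `k`
  have hε : IsSqConn (fun t s => -w₁ t s) (fun t s => -w₂ t s + I t s)
      (fun t s => -(C.lactL (k t s) (C.dactL (a₂' t s) (η₁ t s) + m₁ t s)
        - lieBr E (I t s) (w₁ t s)))
      (fun t s => -C.lactL (k t s) (C.dactL (a₁' t s) (η₂ t s) + m₂ t s) + β t s) :=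
    { cont₁ := cw₁.neg
      cont₂ := cw₂.neg.add cI
      cont_d₁ := ((ck.clm_apply (((C.dactL.continuous.comp_continuousOn h'.cont₂).clm_apply
        hη.cont₁).add hη.cont_d₁)).sub (continuousOn_lieBr cI cw₁)).neg
      cont_d₂ := (ck.clm_apply (((C.dactL.continuous.comp_continuousOn h'.cont₁).clm_apply
        hη.cont₂).add hη.cont_d₂)).neg.add cβ
      deriv₁ := fun t ht s hs =>
        (h'.hasDerivWithinAt_lactL_axial ht hs (hη.deriv₁ t ht s hs)).neg
      deriv₂ := fun t ht s hs =>
        (HasLogDerivWithinAt.lactL_apply C (hasLogDerivWithinAt_axial₁ h'.cont₁ ht hs)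
          (hη.deriv₂ t ht s hs)).neg.add (hasDerivWithinAt_integral_Icc (cβ.slice₁ hs) ht) }
  -- its curvature is `k ▷ b`
  have hcurv : ∀ t ∈ I01, ∀ s ∈ I01, C.lactL (k t s) (b t s)
      = (-C.lactL (k t s) (C.dactL (a₁' t s) (η₂ t s) + m₂ t s) + β t s)
      - -(C.lactL (k t s) (C.dactL (a₂' t s) (η₁ t s) + m₁ t s) - lieBr E (I t s) (w₁ t s))
      + lieBr E (-w₁ t s) (-w₂ t s + I t s) := by
    intro t _ s _
    rw [lieBr_add_right, lieBr_neg_left, lieBr_neg_left, lieBr_neg_right,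
      lieBr_neg_swap (I t s), hw₁, hw₂, ← C.lactL_lieBr, hβ, hb']
    simp only [shiftB, ha₁', ha₂', map_add, map_sub, add_apply, C.dactL_dbdL]
    rw [lieBr_neg_swap (η₂ t s) (η₁ t s), map_neg]
    abel
  have cc : ContinuousOn (Function.uncurry fun t s => C.lactL (k t s) (b t s)) (I01 ×ˢ I01) :=
    ck.clm_apply h.cont_b
  have hS := (hε.isPathExp_boundary (G := E) cc hcurv).pathExp_eq I01_one
  -- holonomies of the shifted form along horizontal and vertical lines
  set H : ℝ → ℝ → G := fun s t => pathExp G (fun t' => a₁' t' s) t with hH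
  set K : ℝ → ℝ → G := fun t s => pathExp G (fun s' => a₂' t s') s with hK
  have sη₁ : ∀ s ∈ I01, ContinuousOn (fun t => η₁ t s) I01 := fun s hs => hη.cont₁.slice₁ hs
  have sη₂ : ∀ t ∈ I01, ContinuousOn (fun s => η₂ t s) I01 := fun t ht => hη.cont₂.slice₂ ht
  have sa₁ : ∀ s ∈ I01, ContinuousOn (fun t => a₁ t s) I01 := fun s hs => h.cont₁.slice₁ hs
  have sa₂ : ∀ t ∈ I01, ContinuousOn (fun s => a₂ t s) I01 := fun t ht => h.cont₂.slice₂ ht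
  -- the left edge
  have eZ : ∀ s ∈ I01, pathExp E (fun s => -w₂ 0 s + I 0 s) s
      = transPath C (fun s => a₂ 0 s) (fun s => η₂ 0 s) s := by
    intro s hs
    refine pathExp_congr (continuousOn_transCoeff (sa₂ 0 I01_zero) (sη₂ 0 I01_zero))
      (fun s hs => ?_) hs
    simp only [hI, intervalIntegral.integral_same, add_zero, hw₂]
    rw [hk, axial_zero h'.cont₁ hs]
  -- the horizontal lines
  have eH : ∀ s ∈ I01, ∀ t ∈ I01, pathExp E (fun t => -w₁ t s) t
      = C.act (K 0 s) (transPath C (fun t => a₁ t s) (fun t => η₁ t s) t) := by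
    intro s hs t ht
    have h1 := isPathExp_iff.1 (isPathExp_pathExp (G := E)
      (continuousOn_transCoeff (C := C) (sa₁ s hs) (sη₁ s hs)))
    refine IsPathExp.pathExp_eq (g := fun t => C.act (K 0 s)
      (transPath C (fun t => a₁ t s) (fun t => η₁ t s) t)) (isPathExp_iff.2 ⟨?_, fun t ht => ?_⟩) ht
    · rw [transPath, h1.1, map_one]
    · have := (h1.2 t ht).act_const C (K 0 s)
      refine Eq.mp (congrArg (fun X => HasLogDerivWithinAt _ X I01 t) ?_) this
      rw [map_neg, ← C.lactL_mul]
      rfl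
  -- the right edge
  have ew := isPathExp_iff.1 h'.isPathExp_surfPath
  have eY : pathExp E (fun s => -w₂ 1 s + I 1 s) 1 = C.act (H 0 1)
      (transPath C (fun s => a₂ 1 s) (fun s => η₂ 1 s) 1) * surfPath C a₁' a₂' b' 1 := by
    have h1 := isPathExp_iff.1 (isPathExp_pathExp (G := E)
      (continuousOn_transCoeff (C := C) (sa₂ 1 I01_one) (sη₂ 1 I01_one)))
    refine IsPathExp.pathExp_eq (g := fun s => C.act (H 0 1)
      (transPath C (fun s => a₂ 1 s) (fun s => η₂ 1 s) s) * surfPath C a₁' a₂' b' s)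
      (isPathExp_iff.2 ⟨?_, fun s hs => ?_⟩) I01_one
    · rw [transPath, h1.1, map_one, ew.1, mul_one]
    · have := ((h1.2 s hs).act_const C (H 0 1)).mul (ew.2 s hs)
      refine Eq.mp (congrArg (fun X => HasLogDerivWithinAt _ X I01 s) ?_) this
      congr 1
      rw [← C.lactL_bd, map_inv, h'.bd_surfPath hs, map_neg, map_neg, ← C.lactL_mul, ← C.lactL_mul]
      simp only [hw₂]
      congr 3
      simp [hH, hk, ha₁', ha₂', mul_assoc]
  -- the curvature term is the integrand of the first holonomy
  have eB : ∀ t ∈ I01, ∀ s ∈ I01, C.bd (axial E (fun t s => -w₁ t s)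
      (fun t s => -w₂ t s + I t s) t s) * k t s = axial G a₁ a₂ t s := by
    intro t ht s hs
    rw [axial, eZ s hs, eH s hs t ht, map_mul, C.bd_act,
      bd_transPath (sa₂ 0 I01_zero) (sη₂ 0 I01_zero) hs, bd_transPath (sa₁ s hs) (sη₁ s hs) ht]
    simp [hk, hK, ha₁', ha₂', axial, mul_assoc]
  have eF : surfPath C a₁ a₂ b 1 = pathExp E (fun s => ∫ t in (0 : ℝ)..1,
      adL VE (axial E (fun t s => -w₁ t s) (fun t s => -w₂ t s + I t s) t s)
        (C.lactL (k t s) (b t s))) 1 := by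
    symm
    refine pathExp_congr (continuousOn_integral_lactL_axial h.cont₁ h.cont₂ h.cont_b)
      (fun s hs => integral_congr_I01 (fun t ht => ?_) I01_one) I01_one
    rw [← eB t ht s hs, C.lactL_mul, C.lactL_bd]
    rfl
  rw [← eF, eY, axial, eZ 1 I01_one, eH 1 I01_one 1 I01_one, eH 0 I01_zero 1 I01_one] at hS
  have hK00 : K 0 0 = 1 := pathExp_zero (h'.cont₂.slice₂ I01_zero)
  rw [hK00, map_one, MulAut.one_apply] at hS
  -- crossing a face with the Peiffer identity
  rw [C.mul_act, bd_transPath (sa₂ 0 I01_zero) (sη₂ 0 I01_zero) I01_one, ← mul_assoc, C.mul_act,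
    bd_transPath (sa₁ 0 I01_zero) (sη₁ 0 I01_zero) I01_one, inv_mul_cancel_right] at hS
  rw [hS]
  simp only [hK, ha₂', mul_assoc, mul_inv_rev, inv_mul_cancel, mul_one]

end Gauge

/-! ### Pull-backs of differential forms to the unit square -/

section PullBack

theorem uniqueDiffOn_sq : UniqueDiffOn ℝ (I01 ×ˢ I01) :=
  (uniqueDiffOn_Icc zero_lt_one).prod (uniqueDiffOn_Icc zero_lt_one)

theorem closure_interior_sq {p : ℝ × ℝ} (hp : p ∈ I01 ×ˢ I01) :
    p ∈ closure (interior (I01 ×ˢ I01)) := by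
  rw [interior_prod_eq, interior_Icc, closure_prod_eq, closure_Ioo zero_ne_one]
  exact hp

section Partial

variable {F : Type*} [NormedAddCommGroup F] [NormedSpace ℝ F] {f : ℝ × ℝ → F}
  {L : ℝ × ℝ →L[ℝ] F} {t s : ℝ}

theorem HasFDerivWithinAt.partial₁ (h : HasFDerivWithinAt f L (I01 ×ˢ I01) (t, s))
    (hs : s ∈ I01) : HasDerivWithinAt (fun t => f (t, s)) (L (1, 0)) I01 t :=
  HasFDerivWithinAt.comp_hasDerivWithinAt (f := fun t => (t, s)) t h
    ((hasDerivWithinAt_id t _).prodMk (hasDerivWithinAt_const t _ s)) (fun _ ht => ⟨ht, hs⟩)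

theorem HasFDerivWithinAt.partial₂ (h : HasFDerivWithinAt f L (I01 ×ˢ I01) (t, s))
    (ht : t ∈ I01) : HasDerivWithinAt (fun s => f (t, s)) (L (0, 1)) I01 s :=
  HasFDerivWithinAt.comp_hasDerivWithinAt (f := fun s => (t, s)) s h
    ((hasDerivWithinAt_const s _ t).prodMk (hasDerivWithinAt_id s _)) (fun _ hs => ⟨ht, hs⟩)

end Partial

variable {V M F : Type*} [NormedAddCommGroup V] [NormedSpace ℝ V]
  [TopologicalSpace M] [ChartedSpace V M] [NormedAddCommGroup F] [NormedSpace ℝ F]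

variable (V) in
/-- A smooth map from the unit square to a subset `W` of a manifold. -/
structure IsSmoothSq (S : ℝ → ℝ → M) (W : Set M) : Prop where
  smooth : ContMDiffOn 𝓘(ℝ, ℝ × ℝ) 𝓘(ℝ, V) ∞ (Function.uncurry S) (I01 ×ˢ I01)
  mem : ∀ t ∈ I01, ∀ s ∈ I01, S t s ∈ W

theorem ContMDiffWithinAt.hasVelWithinAt_vel {γ : ℝ → M} {t : ℝ}
    (h : ContMDiffWithinAt 𝓘(ℝ, ℝ) 𝓘(ℝ, V) ∞ γ I01 t) :
    HasVelWithinAt (W := V) γ (vel V γ t) I01 t :=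
  HasMFDerivWithinAt.hasVelWithinAt (W := V)
    (h.mdifferentiableWithinAt (by simp)).hasMFDerivWithinAt rfl

theorem HasVelWithinAt.vel_eq {γ : ℝ → M} {X : V} {t : ℝ} (h : HasVelWithinAt γ X I01 t)
    (ht : t ∈ I01) : (vel V γ t : V) = X := by
  have h1 : HasVelWithinAt (W := V) γ (vel V γ t) I01 t :=
    HasMFDerivWithinAt.hasVelWithinAt (W := V)
      (HasMFDerivWithinAt.mdifferentiableWithinAt h).hasMFDerivWithinAt rfl
  exact h1.unique h (uniqueDiffOn_Icc zero_lt_one t ht)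

namespace IsSmoothSq

variable {S : ℝ → ℝ → M} {W : Set M} (h : IsSmoothSq V S W) {t s : ℝ}
include h

theorem smooth₁ (hs : s ∈ I01) : ContMDiffOn 𝓘(ℝ, ℝ) 𝓘(ℝ, V) ∞ (fun t => S t s) I01 :=
  h.smooth.comp (f := fun t => (t, s))
    (contMDiff_iff_contDiff.2 (contDiff_id.prodMk contDiff_const)).contMDiffOn
    (fun _ ht => ⟨ht, hs⟩)

theorem smooth₂ (ht : t ∈ I01) : ContMDiffOn 𝓘(ℝ, ℝ) 𝓘(ℝ, V) ∞ (fun s => S t s) I01 :=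
  h.smooth.comp (f := fun s => (t, s))
    (contMDiff_iff_contDiff.2 (contDiff_const.prodMk contDiff_id)).contMDiffOn
    (fun _ hs => ⟨ht, hs⟩)

theorem hasVel₁ (ht : t ∈ I01) (hs : s ∈ I01) :
    HasVelWithinAt (W := V) (fun t => S t s) (vel V (fun t => S t s) t) I01 t :=
  (h.smooth₁ hs t ht).hasVelWithinAt_vel

theorem hasVel₂ (ht : t ∈ I01) (hs : s ∈ I01) :
    HasVelWithinAt (W := V) (fun s => S t s) (vel V (fun s => S t s) s) I01 s :=
  (h.smooth₂ ht s hs).hasVelWithinAt_vel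

end IsSmoothSq

variable [IsManifold 𝓘(ℝ, V) ∞ M]

omit [NormedAddCommGroup F] [NormedSpace ℝ F] in
theorem mdiff_extChart {x₀ x : M} (hx : x ∈ (extChartAt 𝓘(ℝ, V) x₀).source) :
    MDifferentiableAt 𝓘(ℝ, V) 𝓘(ℝ, V) (extChartAt 𝓘(ℝ, V) x₀) x := by
  have : IsManifold 𝓘(ℝ, V) 1 M := IsManifold.of_le (n := ∞) (by simp)
  exact mdifferentiableAt_extChartAt (by simpa using hx)

theorem mfd_symm_extChart {x₀ x : M} (hx : x ∈ (extChartAt 𝓘(ℝ, V) x₀).source) (v : V) :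
    mfd V V (extChartAt 𝓘(ℝ, V) x₀).symm (extChartAt 𝓘(ℝ, V) x₀ x)
      (mfd V V (extChartAt 𝓘(ℝ, V) x₀) x v) = v := by
  have h1 : MDifferentiableAt 𝓘(ℝ, V) 𝓘(ℝ, V) (extChartAt 𝓘(ℝ, V) x₀).symm
      (extChartAt 𝓘(ℝ, V) x₀ x) :=
    ((contMDiffOn_extChartAt_symm (n := ∞) x₀).contMDiffAt
      ((isOpen_extChartAt_target (I := 𝓘(ℝ, V)) x₀).mem_nhds
        ((extChartAt 𝓘(ℝ, V) x₀).map_source hx))).mdifferentiableAt (by simp)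
  rw [← mfd_comp_of_eq h1 (mdiff_extChart hx) rfl]
  refine (mfd_congr ?_ v).trans (mfd_id x v)
  filter_upwards [extChartAt_source_mem_nhds' (I := 𝓘(ℝ, V)) hx] with y hy
  exact (extChartAt 𝓘(ℝ, V) x₀).left_inv hy

/-- A form can be evaluated in the chart at any point `x₀`. -/
theorem chartForm_apply {k : ℕ} (w : DForm V M k F) {x₀ x : M}
    (hx : x ∈ (extChartAt 𝓘(ℝ, V) x₀).source) (v : Fin k → V) :
    chartForm w x₀ (extChartAt 𝓘(ℝ, V) x₀ x)
      (fun i => mfd V V (extChartAt 𝓘(ℝ, V) x₀) x (v i)) = w x v := by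
  have h1 : chartForm w x₀ (extChartAt 𝓘(ℝ, V) x₀ x)
      (fun i => mfd V V (extChartAt 𝓘(ℝ, V) x₀) x (v i))
      = (w ((extChartAt 𝓘(ℝ, V) x₀).symm (extChartAt 𝓘(ℝ, V) x₀ x)) : V [⋀^Fin k]→L[ℝ] F)
        (fun i => mfd V V (extChartAt 𝓘(ℝ, V) x₀).symm (extChartAt 𝓘(ℝ, V) x₀ x)
          (mfd V V (extChartAt 𝓘(ℝ, V) x₀) x (v i))) := rfl
  rw [h1]
  simp_rw [mfd_symm_extChart hx]
  have h2 := (extChartAt 𝓘(ℝ, V) x₀).left_inv hx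
  exact congrArg (fun y => (w y : V [⋀^Fin k]→L[ℝ] F) v) h2

omit [IsManifold 𝓘(ℝ, V) ∞ M] in
theorem SmoothFormOn.contDiffAt {k : ℕ} {w : DForm V M k F} {W : Set M} (hw : SmoothFormOn w W)
    (hW : IsOpen W) {x₀ : M} (hx : x₀ ∈ W) :
    ContDiffAt ℝ ∞ (chartForm w x₀) (extChartAt 𝓘(ℝ, V) x₀ x₀) := by
  refine (hw x₀).contDiffAt (Filter.inter_mem
    ((isOpen_extChartAt_target (I := 𝓘(ℝ, V)) x₀).mem_nhds (mem_extChartAt_target x₀)) ?_)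
  refine (continuousAt_extChartAt_symm x₀).preimage_mem_nhds (hW.mem_nhds ?_)
  rwa [extChartAt_to_inv]

namespace IsSmoothSq

variable {S : ℝ → ℝ → M} {W : Set M} (h : IsSmoothSq V S W) {t s t₀ s₀ : ℝ}
include h

omit [IsManifold 𝓘(ℝ, V) ∞ M] in
theorem eventually_mem_source (ht₀ : t₀ ∈ I01) (hs₀ : s₀ ∈ I01) :
    ∀ᶠ p in 𝓝[I01 ×ˢ I01] (t₀, s₀), S p.1 p.2 ∈ (extChartAt 𝓘(ℝ, V) (S t₀ s₀)).source :=
  (h.smooth.continuousOn (t₀, s₀) ⟨ht₀, hs₀⟩).preimage_mem_nhdsWithin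
    (extChartAt_source_mem_nhds (I := 𝓘(ℝ, V)) (S t₀ s₀))

theorem contDiffWithinAt_chart (ht : t ∈ I01) (hs : s ∈ I01) {x₀ : M}
    (hx : S t s ∈ (extChartAt 𝓘(ℝ, V) x₀).source) :
    ContDiffWithinAt ℝ ∞ (fun p : ℝ × ℝ => extChartAt 𝓘(ℝ, V) x₀ (S p.1 p.2)) (I01 ×ˢ I01)
      (t, s) := by
  have h1 : ContMDiffAt 𝓘(ℝ, V) 𝓘(ℝ, V) ∞ (extChartAt 𝓘(ℝ, V) x₀) (S t s) :=
    contMDiffAt_extChartAt' (by simpa using hx)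
  have h2 := ContMDiffAt.comp_contMDiffWithinAt (g := extChartAt 𝓘(ℝ, V) x₀)
    (f := Function.uncurry S) (t, s) h1 (h.smooth (t, s) ⟨ht, hs⟩)
  exact contMDiffWithinAt_iff_contDiffWithinAt.1 h2

theorem mfd_vel₁ (ht : t ∈ I01) (hs : s ∈ I01) {x₀ : M}
    (hx : S t s ∈ (extChartAt 𝓘(ℝ, V) x₀).source) :
    mfd V V (extChartAt 𝓘(ℝ, V) x₀) (S t s) (vel V (fun t => S t s) t)
      = fderivWithin ℝ (fun p : ℝ × ℝ => extChartAt 𝓘(ℝ, V) x₀ (S p.1 p.2)) (I01 ×ˢ I01) (t, s)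
          (1, 0) := by
  have h1 := hasVelWithinAt_iff_hasDerivWithinAt.1
    ((h.hasVel₁ ht hs).comp_map (W' := V) (mdiff_extChart hx))
  have h2 := (((h.contDiffWithinAt_chart ht hs hx).differentiableWithinAt
    (by simp)).hasFDerivWithinAt).partial₁ hs
  exact (uniqueDiffOn_Icc zero_lt_one t ht).eq_deriv _ h1 h2

theorem mfd_vel₂ (ht : t ∈ I01) (hs : s ∈ I01) {x₀ : M}
    (hx : S t s ∈ (extChartAt 𝓘(ℝ, V) x₀).source) :
    mfd V V (extChartAt 𝓘(ℝ, V) x₀) (S t s) (vel V (fun s => S t s) s)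
      = fderivWithin ℝ (fun p : ℝ × ℝ => extChartAt 𝓘(ℝ, V) x₀ (S p.1 p.2)) (I01 ×ˢ I01) (t, s)
          (0, 1) := by
  have h1 := hasVelWithinAt_iff_hasDerivWithinAt.1
    ((h.hasVel₂ ht hs).comp_map (W' := V) (mdiff_extChart hx))
  have h2 := (((h.contDiffWithinAt_chart ht hs hx).differentiableWithinAt
    (by simp)).hasFDerivWithinAt).partial₂ ht
  exact (uniqueDiffOn_Icc zero_lt_one s hs).eq_deriv _ h1 h2

end IsSmoothSq

/-- A 1-form in the chart at `x₀`, as a function with values in the linear maps. -/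
def chartOneForm (w : DForm V M 1 F) (x₀ : M) (y : V) : V →L[ℝ] F :=
  (ContinuousAlternatingMap.ofSubsingletonLIE (𝕜 := ℝ) (E := V) (F := F) (0 : Fin 1)).symm
    (chartForm w x₀ y)

omit [IsManifold 𝓘(ℝ, V) ∞ M] in
theorem chartOneForm_apply (w : DForm V M 1 F) (x₀ : M) (y v : V) :
    chartOneForm w x₀ y v = chartForm w x₀ y ![v] := by
  have : (![v] : Fin 1 → V) = fun _ => v := by ext i; fin_cases i; rfl
  rw [this]
  rfl

omit [IsManifold 𝓘(ℝ, V) ∞ M] in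
theorem SmoothFormOn.contDiffAt_chartOneForm {w : DForm V M 1 F} {W : Set M}
    (hw : SmoothFormOn w W) (hW : IsOpen W) {x₀ : M} (hx : x₀ ∈ W) :
    ContDiffAt ℝ ∞ (chartOneForm w x₀) (extChartAt 𝓘(ℝ, V) x₀ x₀) :=
  (ContinuousAlternatingMap.ofSubsingletonLIE (𝕜 := ℝ) (E := V) (F := F)
    (0 : Fin 1)).symm.contDiff.contDiffAt.comp _ (hw.contDiffAt hW hx)

namespace IsSmoothSq

variable {S : ℝ → ℝ → M} {W : Set M} (h : IsSmoothSq V S W) {t s t₀ s₀ : ℝ}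
include h

theorem pull₁_eq₁ (w : DForm V M 1 F) (ht : t ∈ I01) (hs : s ∈ I01) {x₀ : M}
    (hx : S t s ∈ (extChartAt 𝓘(ℝ, V) x₀).source) :
    pull₁ w (fun t => S t s) t = chartOneForm w x₀ (extChartAt 𝓘(ℝ, V) x₀ (S t s))
      (fderivWithin ℝ (fun p : ℝ × ℝ => extChartAt 𝓘(ℝ, V) x₀ (S p.1 p.2)) (I01 ×ˢ I01) (t, s)
        (1, 0)) := by
  rw [← h.mfd_vel₁ ht hs hx, chartOneForm_apply]
  refine (chartForm_apply w hx ![(vel V (fun t => S t s) t : V)]).symm.trans ?_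
  congr 1
  ext i
  fin_cases i
  rfl

theorem pull₁_eq₂ (w : DForm V M 1 F) (ht : t ∈ I01) (hs : s ∈ I01) {x₀ : M}
    (hx : S t s ∈ (extChartAt 𝓘(ℝ, V) x₀).source) :
    pull₁ w (fun s => S t s) s = chartOneForm w x₀ (extChartAt 𝓘(ℝ, V) x₀ (S t s))
      (fderivWithin ℝ (fun p : ℝ × ℝ => extChartAt 𝓘(ℝ, V) x₀ (S p.1 p.2)) (I01 ×ˢ I01) (t, s)
        (0, 1)) := by
  rw [← h.mfd_vel₂ ht hs hx, chartOneForm_apply]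
  refine (chartForm_apply w hx ![(vel V (fun s => S t s) s : V)]).symm.trans ?_
  congr 1
  ext i
  fin_cases i
  rfl

theorem pull₂_eq (w : DForm V M 2 F) (ht : t ∈ I01) (hs : s ∈ I01) {x₀ : M}
    (hx : S t s ∈ (extChartAt 𝓘(ℝ, V) x₀).source) :
    pull₂ w S t s = chartForm w x₀ (extChartAt 𝓘(ℝ, V) x₀ (S t s))
      ![fderivWithin ℝ (fun p : ℝ × ℝ => extChartAt 𝓘(ℝ, V) x₀ (S p.1 p.2)) (I01 ×ˢ I01) (t, s)
        (1, 0), fderivWithin ℝ (fun p : ℝ × ℝ => extChartAt 𝓘(ℝ, V) x₀ (S p.1 p.2)) (I01 ×ˢ I01)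
        (t, s) (0, 1)] := by
  rw [← h.mfd_vel₁ ht hs hx, ← h.mfd_vel₂ ht hs hx]
  refine (chartForm_apply w hx
    ![(vel V (fun t => S t s) t : V), (vel V (fun s => S t s) s : V)]).symm.trans ?_
  congr 1
  ext i
  fin_cases i <;> rfl

theorem contDiffWithinAt_fderivWithin (ht : t ∈ I01) (hs : s ∈ I01) {x₀ : M}
    (hx : S t s ∈ (extChartAt 𝓘(ℝ, V) x₀).source) :
    ContDiffWithinAt ℝ ∞ (fderivWithin ℝ (fun p : ℝ × ℝ => extChartAt 𝓘(ℝ, V) x₀ (S p.1 p.2))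
      (I01 ×ˢ I01)) (I01 ×ˢ I01) (t, s) :=
  (h.contDiffWithinAt_chart ht hs hx).fderivWithin_right uniqueDiffOn_sq (by simp) ⟨ht, hs⟩

theorem eventually_pull₁_eq₁ (w : DForm V M 1 F) (ht : t₀ ∈ I01) (hs : s₀ ∈ I01) :
    ∀ᶠ p : ℝ × ℝ in 𝓝[I01 ×ˢ I01] (t₀, s₀), pull₁ w (fun t => S t p.2) p.1
      = chartOneForm w (S t₀ s₀) (extChartAt 𝓘(ℝ, V) (S t₀ s₀) (S p.1 p.2))
      (fderivWithin ℝ (fun p : ℝ × ℝ => extChartAt 𝓘(ℝ, V) (S t₀ s₀) (S p.1 p.2)) (I01 ×ˢ I01) p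
        (1, 0)) := by
  filter_upwards [h.eventually_mem_source ht hs, self_mem_nhdsWithin] with p hp hp'
  exact h.pull₁_eq₁ w hp'.1 hp'.2 hp

theorem eventually_pull₁_eq₂ (w : DForm V M 1 F) (ht : t₀ ∈ I01) (hs : s₀ ∈ I01) :
    ∀ᶠ p : ℝ × ℝ in 𝓝[I01 ×ˢ I01] (t₀, s₀), pull₁ w (fun s => S p.1 s) p.2
      = chartOneForm w (S t₀ s₀) (extChartAt 𝓘(ℝ, V) (S t₀ s₀) (S p.1 p.2))
      (fderivWithin ℝ (fun p : ℝ × ℝ => extChartAt 𝓘(ℝ, V) (S t₀ s₀) (S p.1 p.2)) (I01 ×ˢ I01) p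
        (0, 1)) := by
  filter_upwards [h.eventually_mem_source ht hs, self_mem_nhdsWithin] with p hp hp'
  exact h.pull₁_eq₂ w hp'.1 hp'.2 hp

variable (hW : IsOpen W)
include hW

theorem contDiffWithinAt_oneForm {w : DForm V M 1 F} (hw : SmoothFormOn w W) (ht : t₀ ∈ I01)
    (hs : s₀ ∈ I01) : ContDiffWithinAt ℝ ∞ (fun p : ℝ × ℝ => chartOneForm w (S t₀ s₀)
      (extChartAt 𝓘(ℝ, V) (S t₀ s₀) (S p.1 p.2))) (I01 ×ˢ I01) (t₀, s₀) :=
  ContDiffAt.comp_contDiffWithinAt (g := chartOneForm w (S t₀ s₀))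
    (f := fun p : ℝ × ℝ => extChartAt 𝓘(ℝ, V) (S t₀ s₀) (S p.1 p.2)) (t₀, s₀)
    (hw.contDiffAt_chartOneForm hW (h.mem t₀ ht s₀ hs))
    (h.contDiffWithinAt_chart ht hs (mem_extChartAt_source _))

theorem contDiffOn_pull₁₁ {w : DForm V M 1 F} (hw : SmoothFormOn w W) :
    ContDiffOn ℝ ∞ (fun p : ℝ × ℝ => pull₁ w (fun t => S t p.2) p.1) (I01 ×ˢ I01) := by
  rintro ⟨t₀, s₀⟩ ⟨ht, hs⟩
  refine ContDiffWithinAt.congr_of_eventuallyEq_of_mem ?_ (h.eventually_pull₁_eq₁ w ht hs) ⟨ht, hs⟩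
  exact (h.contDiffWithinAt_oneForm hW hw ht hs).clm_apply
    ((h.contDiffWithinAt_fderivWithin ht hs (mem_extChartAt_source _)).clm_apply
      contDiffWithinAt_const)

theorem contDiffOn_pull₁₂ {w : DForm V M 1 F} (hw : SmoothFormOn w W) :
    ContDiffOn ℝ ∞ (fun p : ℝ × ℝ => pull₁ w (fun s => S p.1 s) p.2) (I01 ×ˢ I01) := by
  rintro ⟨t₀, s₀⟩ ⟨ht, hs⟩
  refine ContDiffWithinAt.congr_of_eventuallyEq_of_mem ?_ (h.eventually_pull₁_eq₂ w ht hs) ⟨ht, hs⟩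
  exact (h.contDiffWithinAt_oneForm hW hw ht hs).clm_apply
    ((h.contDiffWithinAt_fderivWithin ht hs (mem_extChartAt_source _)).clm_apply
      contDiffWithinAt_const)

theorem continuousOn_pull₂ {w : DForm V M 2 F} (hw : SmoothFormOn w W) :
    ContinuousOn (Function.uncurry (pull₂ w S)) (I01 ×ˢ I01) := by
  rintro ⟨t₀, s₀⟩ ⟨ht, hs⟩
  have h1 : ContinuousWithinAt (fun p : ℝ × ℝ => chartForm w (S t₀ s₀)
      (extChartAt 𝓘(ℝ, V) (S t₀ s₀) (S p.1 p.2))) (I01 ×ˢ I01) (t₀, s₀) :=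
    ContinuousAt.comp_continuousWithinAt (x := (t₀, s₀)) (g := chartForm w (S t₀ s₀))
      (f := fun p : ℝ × ℝ =>
      extChartAt 𝓘(ℝ, V) (S t₀ s₀) (S p.1 p.2))
      (hw.contDiffAt hW (h.mem t₀ ht s₀ hs)).continuousAt
      (h.contDiffWithinAt_chart ht hs (mem_extChartAt_source _)).continuousWithinAt
  have h2 := (h.contDiffWithinAt_fderivWithin ht hs
    (mem_extChartAt_source (I := 𝓘(ℝ, V)) (S t₀ s₀))).continuousWithinAt
  have h3 : ContinuousWithinAt (fun p : ℝ × ℝ =>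
      (![fderivWithin ℝ (fun p : ℝ × ℝ => extChartAt 𝓘(ℝ, V) (S t₀ s₀) (S p.1 p.2)) (I01 ×ˢ I01) p
        (1, 0), fderivWithin ℝ (fun p : ℝ × ℝ => extChartAt 𝓘(ℝ, V) (S t₀ s₀) (S p.1 p.2))
        (I01 ×ˢ I01) p (0, 1)] : Fin 2 → V)) (I01 ×ˢ I01) (t₀, s₀) := by
    rw [continuousWithinAt_pi]
    intro i
    fin_cases i
    exacts [h2.clm_apply continuousWithinAt_const, h2.clm_apply continuousWithinAt_const]
  have h4 := h1.eval h3
  refine h4.congr_of_eventuallyEq_of_mem ?_ ⟨ht, hs⟩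
  filter_upwards [h.eventually_mem_source ht hs, self_mem_nhdsWithin] with p hp hp'
  exact h.pull₂_eq w hp'.1 hp'.2 hp

/-- The pull-back of a smooth 1-form to the square, with its partial derivatives. -/
theorem isSqConn_pull₁ {w : DForm V M 1 F} (hw : SmoothFormOn w W) :
    IsSqConn (fun t s => pull₁ w (fun t' => S t' s) t) (fun t s => pull₁ w (fun s' => S t s') s)
      (fun t s => fderivWithin ℝ (fun p : ℝ × ℝ => pull₁ w (fun t => S t p.2) p.1) (I01 ×ˢ I01)
        (t, s) (0, 1))
      (fun t s => fderivWithin ℝ (fun p : ℝ × ℝ => pull₁ w (fun s => S p.1 s) p.2) (I01 ×ˢ I01)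
        (t, s) (1, 0)) where
  cont₁ := (h.contDiffOn_pull₁₁ hW hw).continuousOn
  cont₂ := (h.contDiffOn_pull₁₂ hW hw).continuousOn
  cont_d₁ := ((h.contDiffOn_pull₁₁ hW hw).continuousOn_fderivWithin uniqueDiffOn_sq
    (by simp)).clm_apply continuousOn_const
  cont_d₂ := ((h.contDiffOn_pull₁₂ hW hw).continuousOn_fderivWithin uniqueDiffOn_sq
    (by simp)).clm_apply continuousOn_const
  deriv₁ t ht s hs := HasFDerivWithinAt.partial₂
    (((h.contDiffOn_pull₁₁ hW hw).differentiableOn (by simp)) (t, s) ⟨ht, hs⟩).hasFDerivWithinAt ht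
  deriv₂ t ht s hs := HasFDerivWithinAt.partial₁
    (((h.contDiffOn_pull₁₂ hW hw).differentiableOn (by simp)) (t, s) ⟨ht, hs⟩).hasFDerivWithinAt hs

/-- The pull-back of the exterior derivative is the exterior derivative of the pull-back. -/
theorem pull₂_dForm {w : DForm V M 1 F} (hw : SmoothFormOn w W) (ht : t ∈ I01) (hs : s ∈ I01) :
    pull₂ (dForm w) S t s
      = fderivWithin ℝ (fun p : ℝ × ℝ => pull₁ w (fun s => S p.1 s) p.2) (I01 ×ˢ I01) (t, s) (1, 0)
      - fderivWithin ℝ (fun p : ℝ × ℝ => pull₁ w (fun t => S t p.2) p.1) (I01 ×ˢ I01) (t, s)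
        (0, 1) := by
  have hu : UniqueDiffWithinAt ℝ (I01 ×ˢ I01) (t, s) := uniqueDiffOn_sq (t, s) ⟨ht, hs⟩
  have hx := mem_extChartAt_source (I := 𝓘(ℝ, V)) (S t s)
  set κ := extChartAt 𝓘(ℝ, V) (S t s) with hκ
  set Ŝ : ℝ × ℝ → V := fun p => κ (S p.1 p.2) with hŜ
  have hS := h.contDiffWithinAt_chart ht hs hx
  have hdS := h.contDiffWithinAt_fderivWithin ht hs hx
  have hS' : HasFDerivWithinAt Ŝ (fderivWithin ℝ Ŝ (I01 ×ˢ I01) (t, s)) (I01 ×ˢ I01) (t, s) :=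
    (hS.differentiableWithinAt (by simp)).hasFDerivWithinAt
  have hdS' : HasFDerivWithinAt (fderivWithin ℝ Ŝ (I01 ×ˢ I01))
      (fderivWithin ℝ (fderivWithin ℝ Ŝ (I01 ×ˢ I01)) (I01 ×ˢ I01) (t, s)) (I01 ×ˢ I01) (t, s) :=
    (hdS.differentiableWithinAt (by simp)).hasFDerivWithinAt
  -- the second derivatives of the square are symmetric, so they cancel in the exterior derivative
  -- of the pull-back
  have hsymm := hS.isSymmSndFDerivWithinAt (by simpa using two_le_infty) uniqueDiffOn_sq
    (closure_interior_sq ⟨ht, hs⟩) ⟨ht, hs⟩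
  have hw1 := ((hw.contDiffAt hW (h.mem t ht s hs)).differentiableAt (by simp)).hasFDerivAt
  set D := fderiv ℝ (chartForm w (S t s)) (κ (S t s)) with hD
  have hω₀ : HasFDerivAt (chartOneForm w (S t s))
      ((ContinuousAlternatingMap.ofSubsingletonLIE (𝕜 := ℝ) (E := V) (F := F)
        (0 : Fin 1)).symm.toContinuousLinearEquiv.toContinuousLinearMap ∘L D) (κ (S t s)) :=
    (ContinuousAlternatingMap.ofSubsingletonLIE (𝕜 := ℝ) (E := V) (F := F)
      (0 : Fin 1)).symm.toContinuousLinearEquiv.toContinuousLinearMap.hasFDerivAt.comp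
      (κ (S t s)) hw1
  have hω := HasFDerivAt.comp_hasFDerivWithinAt (g := chartOneForm w (S t s)) (f := Ŝ) (t, s)
    hω₀ hS'
  have e1 := ((hω.clm_apply (hdS'.clm_apply (hasFDerivWithinAt_const ((1, 0) : ℝ × ℝ) (t, s)
    _))).congr_of_eventuallyEq (h.eventually_pull₁_eq₁ w ht hs)
      (h.pull₁_eq₁ w ht hs hx)).fderivWithin hu
  have e2 := ((hω.clm_apply (hdS'.clm_apply (hasFDerivWithinAt_const ((0, 1) : ℝ × ℝ) (t, s)
    _))).congr_of_eventuallyEq (h.eventually_pull₁_eq₂ w ht hs)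
      (h.pull₁_eq₂ w ht hs hx)).fderivWithin hu
  have e3 : pull₂ (dForm w) S t s = D (fderivWithin ℝ Ŝ (I01 ×ˢ I01) (t, s) (1, 0))
        ![fderivWithin ℝ Ŝ (I01 ×ˢ I01) (t, s) (0, 1)]
      - D (fderivWithin ℝ Ŝ (I01 ×ˢ I01) (t, s) (0, 1))
        ![fderivWithin ℝ Ŝ (I01 ×ˢ I01) (t, s) (1, 0)] := by
    rw [← h.mfd_vel₁ ht hs hx, ← h.mfd_vel₂ ht hs hx]
    have e4 : pull₂ (dForm w) S t s = extDeriv (chartForm w (S t s)) (κ (S t s))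
      ![mfd V V κ (S t s) (vel V (fun t => S t s) t),
        mfd V V κ (S t s) (vel V (fun s => S t s) s)] := by
      have : (![mfd V V κ (S t s) (vel V (fun t => S t s) t),
          mfd V V κ (S t s) (vel V (fun s => S t s) s)] : Fin 2 → V)
          = fun i => mfd V V κ (S t s)
            ((![(vel V (fun t => S t s) t : V), (vel V (fun s => S t s) s : V)] :
              Fin 2 → V) i) := by
        ext i
        fin_cases i <;> rfl
      rw [this]
      rfl
    rw [e4, extDeriv, ContinuousAlternatingMap.alternatizeUncurryFin_apply, Fin.sum_univ_two]
    simp only [Fin.coe_ofNat_eq_mod, Nat.zero_mod, pow_zero, one_smul, Nat.mod_succ, pow_one,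
      neg_smul, sub_eq_add_neg]
    congr 2
    · congr 1
      ext i
      fin_cases i
      rfl
  rw [e1, e2, e3]
  have hL : ∀ (f : V [⋀^Fin 1]→L[ℝ] F) (v : V),
      (ContinuousAlternatingMap.ofSubsingletonLIE (𝕜 := ℝ) (E := V) (F := F)
        (0 : Fin 1)).symm f v = f ![v] := by
    intro f v
    have : (![v] : Fin 1 → V) = fun _ => v := by ext i; fin_cases i; rfl
    rw [this]
    rfl
  -- `S₁ 0` is the derivative of the constant vector field in the product rule
  set S₁ := fderivWithin ℝ Ŝ (I01 ×ˢ I01) (t, s)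
  set S₂ := fderivWithin ℝ (fderivWithin ℝ Ŝ (I01 ×ˢ I01)) (I01 ×ˢ I01) (t, s)
  have hsymm' : S₂ (1, 0) (0, 1) = S₂ (0, 1) (1, 0) := hsymm (1, 0) (0, 1)
  set Λ := (ContinuousAlternatingMap.ofSubsingletonLIE (𝕜 := ℝ) (E := V) (F := F)
    (0 : Fin 1)).symm
  change _ = (chartOneForm w (S t s) (Ŝ (t, s)) (S₁ 0 + S₂ (1, 0) (0, 1))
      + Λ (D (S₁ (1, 0))) (S₁ (0, 1)))
    - (chartOneForm w (S t s) (Ŝ (t, s)) (S₁ 0 + S₂ (0, 1) (1, 0))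
      + Λ (D (S₁ (0, 1))) (S₁ (1, 0)))
  rw [hsymm', hL, hL, add_sub_add_left_eq_sub]

end IsSmoothSq

end PullBack

/-! ### Composition of squares and cubes -/

namespace LieCrossedModule

variable {VG VE G E : Type*}
  [NormedAddCommGroup VG] [NormedSpace ℝ VG] [NormedAddCommGroup VE] [NormedSpace ℝ VE]
  [TopologicalSpace G] [ChartedSpace VG G] [Group G]
  [TopologicalSpace E] [ChartedSpace VE E] [Group E]
  (C : LieCrossedModule VG VE G E)

theorem act_act (g h : G) (u : E) : C.act g (C.act h u) = C.act (g * h) u := by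
  rw [map_mul, MulAut.mul_apply]

variable {C}

theorem SqFlat.eq {s : Sq G E} (h : C.SqFlat s) : C.bd s.e * (s.Z * s.W) = s.X * s.Y := by
  rw [← h, mul_assoc, mul_inv_cancel_left]

theorem sqFlat_iff {s : Sq G E} : C.SqFlat s ↔ C.bd s.e * (s.Z * s.W) = s.X * s.Y :=
  ⟨SqFlat.eq, fun h => by rw [SqFlat, mul_assoc, ← h, inv_mul_cancel_left]⟩

/-- Moving an element from above a flat square to the right of it. -/
theorem SqFlat.mul_act {s : Sq G E} (h : C.SqFlat s) (u : E) :
    s.e * C.act (s.Z * s.W) u = C.act (s.X * s.Y) u * s.e := by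
  rw [C.mul_act, h.eq]

theorem SqFlat.hcomp {s t : Sq G E} (hs : C.SqFlat s) (ht : C.SqFlat t) (h : s.Y = t.Z) :
    C.SqFlat (C.hcomp s t) := by
  rw [sqFlat_iff] at *
  simp only [LieCrossedModule.hcomp, map_mul, C.bd_act]
  calc s.X * C.bd t.e * s.X⁻¹ * C.bd s.e * (s.Z * (s.W * t.W))
      = s.X * C.bd t.e * s.X⁻¹ * (C.bd s.e * (s.Z * s.W)) * t.W := by group
    _ = s.X * (C.bd t.e * (t.Z * t.W)) := by rw [hs, h]; group
    _ = s.X * t.X * t.Y := by rw [ht]; group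

theorem SqFlat.diag {s : Sq G E} (hs : C.SqFlat s) : C.SqFlat s.diag := by
  rw [sqFlat_iff] at *
  simp only [Sq.diag, map_inv]
  rw [← hs]
  group

theorem SqFlat.vcomp {s t : Sq G E} (hs : C.SqFlat s) (ht : C.SqFlat t) (h : s.W = t.X) :
    C.SqFlat (C.vcomp s t) := by
  rw [sqFlat_iff] at *
  simp only [LieCrossedModule.vcomp, map_mul, C.bd_act]
  calc C.bd s.e * (s.Z * C.bd t.e * s.Z⁻¹) * (s.Z * t.Z * t.W)
      = C.bd s.e * (s.Z * (C.bd t.e * (t.Z * t.W))) := by group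
    _ = (C.bd s.e * (s.Z * s.W)) * t.Y := by rw [ht, h]; group
    _ = s.X * (s.Y * t.Y) := by rw [hs]; group

variable (C) in
theorem hcomp_assoc (s t u : Sq G E) : C.hcomp (C.hcomp s t) u = C.hcomp s (C.hcomp t u) := by
  simp only [LieCrossedModule.hcomp, map_mul, MulAut.mul_apply, mul_assoc]

variable (C) in
theorem vcomp_assoc (s t u : Sq G E) : C.vcomp (C.vcomp s t) u = C.vcomp s (C.vcomp t u) := by
  simp only [LieCrossedModule.vcomp, map_mul, MulAut.mul_apply, mul_assoc]

variable (C) in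
theorem diag_hcomp (s t : Sq G E) : (C.hcomp s t).diag = C.vcomp s.diag t.diag := by
  simp only [LieCrossedModule.hcomp, LieCrossedModule.vcomp, Sq.diag, mul_inv_rev, map_inv]

/-- Moving an element from above a flat square to the right of it, inside a product. -/
theorem SqFlat.mul_act_mul {s : Sq G E} (h : C.SqFlat s) (u v : E) :
    s.e * (C.act s.Z (C.act s.W u) * v) = C.act s.X (C.act s.Y u) * (s.e * v) := by
  rw [← mul_assoc, ← mul_assoc, C.act_act, C.act_act, h.mul_act]

/-- The interchange law. -/
theorem vcomp_hcomp {s t s' t' : Sq G E} (hs : C.SqFlat s) (h : s.Y = t.Z) (h' : s.W = s'.X) :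
    C.vcomp (C.hcomp s t) (C.hcomp s' t') = C.hcomp (C.vcomp s s') (C.vcomp t t') := by
  simp only [LieCrossedModule.hcomp, LieCrossedModule.vcomp, map_mul, Sq.mk.injEq, true_and,
    mul_assoc]
  rw [← h, ← h', hs.mul_act_mul]

theorem hchain_Z (f g : ℕ → Sq G E) (n : ℕ) : (C.hchain f g n).Z = (f 0).Z := by
  induction n with
  | zero => rfl
  | succ n ih => exact ih

theorem hchain_Y (f g : ℕ → Sq G E) (n : ℕ) : (C.hchain f g n).Y = (f n).Y := by
  cases n <;> rfl

theorem hchain_congr {f g f' g' : ℕ → Sq G E} {n : ℕ} (hf : ∀ a ≤ n, f a = f' a)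
    (hg : ∀ a < n, g a = g' a) : C.hchain f g n = C.hchain f' g' n := by
  induction n with
  | zero => exact hf 0 le_rfl
  | succ n ih =>
    rw [hchain, hchain, ih (fun a ha => hf a (by omega)) (fun a ha => hg a (by omega)),
      hf _ le_rfl, hg n (by omega)]

theorem vchain_congr {f g f' g' : ℕ → Sq G E} {n : ℕ} (hf : ∀ a ≤ n, f a = f' a)
    (hg : ∀ a < n, g a = g' a) : C.vchain f g n = C.vchain f' g' n := by
  induction n with
  | zero => exact hf 0 le_rfl
  | succ n ih =>
    rw [vchain, vchain, ih (fun a ha => hf a (by omega)) (fun a ha => hg a (by omega)),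
      hf _ le_rfl, hg n (by omega)]

theorem hchain_W_eq_X {f g f' g' : ℕ → Sq G E} {n : ℕ} (hf : ∀ a ≤ n, (f a).W = (f' a).X)
    (hg : ∀ a < n, (g a).W = (g' a).X) : (C.hchain f g n).W = (C.hchain f' g' n).X := by
  induction n with
  | zero => exact hf 0 le_rfl
  | succ n ih =>
    change (C.hchain f g n).W * (g n).W * (f (n + 1)).W
      = (C.hchain f' g' n).X * (g' n).X * (f' (n + 1)).X
    rw [ih (fun a ha => hf a (by omega)) (fun a ha => hg a (by omega)),
      hf _ le_rfl, hg n (by omega)]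

theorem sqFlat_hchain {f g : ℕ → Sq G E} {n : ℕ} (hf : ∀ a ≤ n, C.SqFlat (f a))
    (hg : ∀ a < n, C.SqFlat (g a)) (h : ∀ a < n, (f a).Y = (g a).Z)
    (h' : ∀ a < n, (g a).Y = (f (a + 1)).Z) : C.SqFlat (C.hchain f g n) := by
  induction n with
  | zero => exact hf 0 le_rfl
  | succ n ih =>
    refine ((ih (fun a ha => hf a (by omega)) (fun a ha => hg a (by omega))
      (fun a ha => h a (by omega)) (fun a ha => h' a (by omega))).hcomp (hg n (by omega)) ?_).hcomp
      (hf _ le_rfl) (h' n (by omega))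
    rw [hchain_Y]
    exact h n (by omega)

/-- Horizontal composites of two rows on top of each other. -/
theorem vcomp_hchain {f g f' g' : ℕ → Sq G E} {n : ℕ} (hf : ∀ a ≤ n, C.SqFlat (f a))
    (hg : ∀ a < n, C.SqFlat (g a)) (h : ∀ a < n, (f a).Y = (g a).Z)
    (h' : ∀ a < n, (g a).Y = (f (a + 1)).Z) (hff : ∀ a ≤ n, (f a).W = (f' a).X)
    (hgg : ∀ a < n, (g a).W = (g' a).X) :
    C.vcomp (C.hchain f g n) (C.hchain f' g' n)
      = C.hchain (fun a => C.vcomp (f a) (f' a)) (fun a => C.vcomp (g a) (g' a)) n := by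
  induction n with
  | zero => rfl
  | succ n ih =>
    have h1 : C.SqFlat (C.hchain f g n) := sqFlat_hchain (fun a ha => hf a (by omega))
      (fun a ha => hg a (by omega)) (fun a ha => h a (by omega)) (fun a ha => h' a (by omega))
    have h2 : (C.hchain f g n).W = (C.hchain f' g' n).X :=
      hchain_W_eq_X (fun a ha => hff a (by omega)) (fun a ha => hgg a (by omega))
    have h3 : (C.hchain f g n).Y = (g n).Z := by
      rw [hchain_Y]
      exact h n (by omega)
    rw [hchain, hchain, hchain, vcomp_hcomp (h1.hcomp (hg n (by omega)) h3) (h' n (by omega)) ?_,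
      vcomp_hcomp h1 h3 h2, ih (fun a ha => hf a (by omega)) (fun a ha => hg a (by omega))
        (fun a ha => h a (by omega)) (fun a ha => h' a (by omega))
        (fun a ha => hff a (by omega)) (fun a ha => hgg a (by omega))]
    change (C.hchain f g n).W * (g n).W = (C.hchain f' g' n).X * (g' n).X
    rw [h2, hgg n (by omega)]

/-- Replacement of the square number `k` of a row by a composite of three squares. -/
theorem hchain_insert {f g f' g' : ℕ → Sq G E} {k n : ℕ} (hk : k ≤ n)
    (hf : ∀ a < k, f' a = f a) (hg : ∀ a < k, g' a = g a)
    (hins : C.hcomp (C.hcomp (f' k) (g' k)) (f' (k + 1)) = f k)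
    (hf' : ∀ a, k < a → a ≤ n → f' (a + 1) = f a) (hg' : ∀ a, k ≤ a → a < n → g' (a + 1) = g a) :
    C.hchain f' g' (n + 1) = C.hchain f g n := by
  induction n with
  | zero =>
    obtain rfl : k = 0 := by omega
    exact hins
  | succ n ih =>
    rcases Nat.lt_or_ge n k with h | h
    · obtain rfl : k = n + 1 := by omega
      rw [hchain, hchain, hchain, hchain_congr (fun a ha => hf a (by omega))
        (fun a ha => hg a (by omega)), hg n (by omega), ← hins]
      simp only [hcomp_assoc]
    · rw [hchain, ih h (fun a h1 h2 => hf' a h1 (by omega)) (fun a h1 h2 => hg' a h1 (by omega)),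
        hf' (n + 1) (by omega) le_rfl, hg' n h (by omega), hchain]

/-- Replacement of the square number `k` of a column by a composite of three squares. -/
theorem vchain_insert {f g f' g' : ℕ → Sq G E} {k n : ℕ} (hk : k ≤ n)
    (hf : ∀ a < k, f' a = f a) (hg : ∀ a < k, g' a = g a)
    (hins : C.vcomp (C.vcomp (f' k) (g' k)) (f' (k + 1)) = f k)
    (hf' : ∀ a, k < a → a ≤ n → f' (a + 1) = f a) (hg' : ∀ a, k ≤ a → a < n → g' (a + 1) = g a) :
    C.vchain f' g' (n + 1) = C.vchain f g n := by
  induction n with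
  | zero =>
    obtain rfl : k = 0 := by omega
    exact hins
  | succ n ih =>
    rcases Nat.lt_or_ge n k with h | h
    · obtain rfl : k = n + 1 := by omega
      rw [vchain, vchain, vchain, vchain_congr (fun a ha => hf a (by omega))
        (fun a ha => hg a (by omega)), hg n (by omega), ← hins]
      simp only [vcomp_assoc]
    · rw [vchain, ih h (fun a h1 h2 => hf' a h1 (by omega)) (fun a h1 h2 => hg' a h1 (by omega)),
        hf' (n + 1) (by omega) le_rfl, hg' n h (by omega), vchain]

variable (C) in
/-- The six squares `l, r` (left, right), `f, b` (front, back) and `d, u` (down, up) are the faces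
orthogonal to the first, second and third direction of a flat colouring of the cube. The
homotopy addition equation is stated with the side faces distributed over both sides. -/
structure IsCube (l r f b d u : Sq G E) : Prop where
  q₀₀ : l.X = d.Z
  q₀₁ : l.W = u.Z
  q₁₀ : r.X = d.Y
  q₁₁ : r.W = u.Y
  p₀₀ : f.X = d.X
  p₀₁ : f.W = u.X
  p₁₀ : b.X = d.W
  p₁₁ : b.W = u.W
  r₀₀ : l.Z = f.Z
  r₀₁ : l.Y = b.Z
  r₁₀ : r.Z = f.Y
  r₁₁ : r.Y = b.Y
  flat_l : C.SqFlat l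
  flat_r : C.SqFlat r
  flat_f : C.SqFlat f
  flat_b : C.SqFlat b
  flat_d : C.SqFlat d
  flat_u : C.SqFlat u
  eq : C.act d.X r.e * f.e * C.act l.Z u.e = d.e * C.act d.Z b.e * l.e

/-- The homotopy addition equation for a cube with a flat left face. -/
theorem homotopyAddition_iff {T : Cube G E} (h : C.SqFlat (T.face₁ false)) :
    C.HomotopyAddition T ↔
      C.act (T.p false false) (T.f₁ true) * T.f₂ false * C.act (T.r false false) (T.f₃ true)
        = T.f₃ false * C.act (T.q false false) (T.f₂ true) * T.f₁ false := by
  have h1 := h.mul_act (C.act (T.r false true)⁻¹ (T.f₂ true))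
  rw [C.act_act, C.act_act] at h1
  change T.f₁ false * C.act (T.r false false * T.q false true * (T.r false true)⁻¹) (T.f₂ true)
    = C.act (T.q false false * T.r false true * (T.r false true)⁻¹) (T.f₂ true) * T.f₁ false at h1
  rw [mul_inv_cancel_right] at h1
  rw [mul_assoc (T.f₃ false), ← h1]
  simp only [HomotopyAddition, Cube.face₁, Cube.face₂, Cube.face₃, LieCrossedModule.vcomp,
    LieCrossedModule.hcomp, Sq.llCorner, Sq.lrCorner, Sq.ulCorner, Sq.urCorner, Sq.diag, reflV,
    rot, Sq.mk.injEq, one_mul, mul_one, map_one, MulAut.one_apply, inv_inv, true_and]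
  rw [← (C.act (T.r false false)).injective.eq_iff]
  simp only [map_mul, map_inv, MulAut.mul_apply, mul_assoc, MulAut.apply_inv_self]
  constructor
  · intro h
    rw [h]
    simp
  · intro h
    rw [← h]
    simp

theorem isCube_of_cubeFlat {T : Cube G E} (h : C.CubeFlat T) :
    C.IsCube (T.face₁ false) (T.face₁ true) (T.face₂ false) (T.face₂ true) (T.face₃ false)
      (T.face₃ true) where
  q₀₀ := rfl
  q₀₁ := rfl
  q₁₀ := rfl
  q₁₁ := rfl
  p₀₀ := rfl
  p₀₁ := rfl
  p₁₀ := rfl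
  p₁₁ := rfl
  r₀₀ := rfl
  r₀₁ := rfl
  r₁₀ := rfl
  r₁₁ := rfl
  flat_l := (h.1 _).1
  flat_r := (h.1 _).1
  flat_f := (h.1 _).2.1
  flat_b := (h.1 _).2.1
  flat_d := (h.1 _).2.2
  flat_u := (h.1 _).2.2
  eq := (homotopyAddition_iff (h.1 false).1).1 h.2

namespace IsCube

variable {l r f b d u l' r' f' b' d' u' m : Sq G E}

/-- The colouring of the cube with the given faces. -/
theorem exists_cubeFlat (h : C.IsCube l r f b d u) :
    ∃ T : Cube G E, C.CubeFlat T ∧ T.face₃ false = d ∧ T.face₃ true = u ∧ T.face₁ false = l ∧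
      T.face₁ true = r ∧ T.face₂ false = f ∧ T.face₂ true = b := by
  obtain ⟨lX, lY, lZ, lW, le⟩ := l
  obtain ⟨rX, rY, rZ, rW, re⟩ := r
  obtain ⟨fX, fY, fZ, fW, fe⟩ := f
  obtain ⟨bX, bY, bZ, bW, be⟩ := b
  obtain ⟨dX, dY, dZ, dW, de⟩ := d
  obtain ⟨uX, uY, uZ, uW, ue⟩ := u
  obtain ⟨q₀₀, q₀₁, q₁₀, q₁₁, p₀₀, p₀₁, p₁₀, p₁₁, r₀₀, r₀₁, r₁₀, r₁₁, hl, hr, hf, hb, hd, hu,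
    e⟩ := h
  dsimp only at q₀₀ q₀₁ q₁₀ q₁₁ p₀₀ p₀₁ p₁₀ p₁₁ r₀₀ r₀₁ r₁₀ r₁₁ e
  subst q₀₀ q₀₁ q₁₀ q₁₁ p₀₀ p₀₁ p₁₀ p₁₁ r₀₀ r₀₁ r₁₀ r₁₁
  refine ⟨⟨fun x₂ x₃ => bif x₂ then (bif x₃ then bW else bX) else (bif x₃ then fW else fX),
    fun x₁ x₃ => bif x₁ then (bif x₃ then rW else rX) else (bif x₃ then lW else lX),
    fun x₁ x₂ => bif x₁ then (bif x₂ then rY else rZ) else (bif x₂ then lY else lZ),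
    fun x => bif x then re else le, fun x => bif x then be else fe,
    fun x => bif x then ue else de⟩, ⟨?_, ?_⟩, rfl, rfl, rfl, rfl, rfl, rfl⟩
  · rintro (_ | _)
    exacts [⟨hl, hf, hd⟩, ⟨hr, hb, hu⟩]
  · exact (homotopyAddition_iff hl).2 e

/-- The mirror image of a cube under the exchange of the first two directions. -/
theorem swap (h : C.IsCube l r f b d u) : C.IsCube f b l r d.diag u.diag where
  q₀₀ := h.p₀₀
  q₀₁ := h.p₀₁
  q₁₀ := h.p₁₀
  q₁₁ := h.p₁₁
  p₀₀ := h.q₀₀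
  p₀₁ := h.q₀₁
  p₁₀ := h.q₁₀
  p₁₁ := h.q₁₁
  r₀₀ := h.r₀₀.symm
  r₀₁ := h.r₁₀.symm
  r₁₀ := h.r₀₁.symm
  r₁₁ := h.r₁₁.symm
  flat_l := h.flat_f
  flat_r := h.flat_b
  flat_f := h.flat_l
  flat_b := h.flat_r
  flat_d := h.flat_d.diag
  flat_u := h.flat_u.diag
  eq := by
    have := h.eq
    rw [h.r₀₀] at this
    change C.act d.Z b.e * l.e * C.act f.Z u.e⁻¹ = d.e⁻¹ * C.act d.X r.e * f.e
    rw [map_inv, mul_inv_eq_iff_eq_mul, mul_assoc, mul_assoc, ← mul_assoc _ f.e, this]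
    group

/-- Composition of cubes in the first direction. -/
theorem hcomp (h : C.IsCube l m f b d u) (h' : C.IsCube m r f' b' d' u') :
    C.IsCube l r (C.hcomp f f') (C.hcomp b b') (C.hcomp d d') (C.hcomp u u') where
  q₀₀ := h.q₀₀
  q₀₁ := h.q₀₁
  q₁₀ := h'.q₁₀
  q₁₁ := h'.q₁₁
  p₀₀ := congrArg₂ (· * ·) h.p₀₀ h'.p₀₀
  p₀₁ := congrArg₂ (· * ·) h.p₀₁ h'.p₀₁
  p₁₀ := congrArg₂ (· * ·) h.p₁₀ h'.p₁₀
  p₁₁ := congrArg₂ (· * ·) h.p₁₁ h'.p₁₁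
  r₀₀ := h.r₀₀
  r₀₁ := h.r₀₁
  r₁₀ := h'.r₁₀
  r₁₁ := h'.r₁₁
  flat_l := h.flat_l
  flat_r := h'.flat_r
  flat_f := h.flat_f.hcomp h'.flat_f (h.r₁₀.symm.trans h'.r₀₀)
  flat_b := h.flat_b.hcomp h'.flat_b (h.r₁₁.symm.trans h'.r₀₁)
  flat_d := h.flat_d.hcomp h'.flat_d (h.q₁₀.symm.trans h'.q₀₀)
  flat_u := h.flat_u.hcomp h'.flat_u (h.q₁₁.symm.trans h'.q₀₁)
  eq := by
    have e' := congrArg (C.act d.X) h'.eq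
    have hf := h.flat_f.mul_act_mul u'.e (C.act l.Z u.e)
    have hd := h.flat_d.mul_act_mul b'.e (C.act d.Z b.e * l.e)
    have e := h.eq
    simp only [LieCrossedModule.hcomp, map_mul, MulAut.mul_apply, mul_assoc] at e e' ⊢
    rw [h.p₀₀, ← h.r₁₀, h.p₀₁, ← h.r₀₀] at hf
    rw [← h.p₁₀, ← h.q₁₀] at hd
    rw [h.p₀₀, hf, hd, ← e]
    simp only [← mul_assoc] at e' ⊢
    rw [e', h'.q₀₀]

/-- Composition of cubes in the second direction. -/
theorem vcomp (h : C.IsCube l r f m d u) (h' : C.IsCube l' r' m b d' u') :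
    C.IsCube (C.hcomp l l') (C.hcomp r r') f b (C.vcomp d d') (C.vcomp u u') where
  q₀₀ := congrArg₂ (· * ·) h.q₀₀ h'.q₀₀
  q₀₁ := congrArg₂ (· * ·) h.q₀₁ h'.q₀₁
  q₁₀ := congrArg₂ (· * ·) h.q₁₀ h'.q₁₀
  q₁₁ := congrArg₂ (· * ·) h.q₁₁ h'.q₁₁
  p₀₀ := h.p₀₀
  p₀₁ := h.p₀₁
  p₁₀ := h'.p₁₀
  p₁₁ := h'.p₁₁
  r₀₀ := h.r₀₀
  r₀₁ := h'.r₀₁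
  r₁₀ := h.r₁₀
  r₁₁ := h'.r₁₁
  flat_l := h.flat_l.hcomp h'.flat_l (h.r₀₁.trans h'.r₀₀.symm)
  flat_r := h.flat_r.hcomp h'.flat_r (h.r₁₁.trans h'.r₁₀.symm)
  flat_f := h.flat_f
  flat_b := h'.flat_b
  flat_d := h.flat_d.vcomp h'.flat_d (h.p₁₀.symm.trans h'.p₀₀)
  flat_u := h.flat_u.vcomp h'.flat_u (h.p₁₁.symm.trans h'.p₀₁)
  eq := by
    have e' := congrArg (C.act d.Z) h'.eq
    have hl := h.flat_l.mul_act u'.e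
    have hd := h.flat_d.mul_act r'.e
    have e := h.eq
    simp only [LieCrossedModule.vcomp, LieCrossedModule.hcomp, map_mul, MulAut.mul_apply] at *
    rw [h.q₀₁, h.q₀₀, h.r₀₁, ← h'.r₀₀] at hl
    rw [← h.p₁₀, ← h.q₁₀, h'.p₀₀] at hd
    rw [h.q₀₀]
    calc _ = C.act d.X (C.act r.X r'.e) * (C.act d.X r.e * f.e * C.act l.Z u.e)
          * C.act l.Z (C.act u.Z u'.e) := by simp only [mul_assoc]
      _ = C.act d.X (C.act r.X r'.e) * d.e * C.act d.Z m.e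
          * (l.e * C.act l.Z (C.act u.Z u'.e)) := by rw [e]; simp only [mul_assoc]
      _ = d.e * (C.act d.Z (C.act d'.X r'.e) * C.act d.Z m.e * C.act d.Z (C.act l'.Z u'.e))
          * l.e := by rw [hl, ← hd]; simp only [mul_assoc]
      _ = _ := by rw [e']; simp only [mul_assoc]

/-- The composite of a row of cubes that share their left and right faces. -/
theorem hchain {l r f b d u f' b' d' u' : ℕ → Sq G E} {n : ℕ}
    (h : ∀ a ≤ n, C.IsCube (l a) (r a) (f a) (b a) (d a) (u a))
    (h' : ∀ a < n, C.IsCube (r a) (l (a + 1)) (f' a) (b' a) (d' a) (u' a)) :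
    C.IsCube (l 0) (r n) (C.hchain f f' n) (C.hchain b b' n) (C.hchain d d' n)
      (C.hchain u u' n) := by
  induction n with
  | zero => exact h 0 le_rfl
  | succ n ih =>
    exact ((ih (fun a ha => h a (by omega)) (fun a ha => h' a (by omega))).hcomp
      (h' n (by omega))).hcomp (h _ le_rfl)

/-- The composite of a column of cubes that share their front and back faces. -/
theorem vchain {l r f b d u l' r' d' u' : ℕ → Sq G E} {n : ℕ}
    (h : ∀ a ≤ n, C.IsCube (l a) (r a) (f a) (b a) (d a) (u a))
    (h' : ∀ a < n, C.IsCube (l' a) (r' a) (b a) (f (a + 1)) (d' a) (u' a)) :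
    C.IsCube (C.hchain l l' n) (C.hchain r r' n) (f 0) (b n) (C.vchain d d' n)
      (C.vchain u u' n) := by
  induction n with
  | zero => exact h 0 le_rfl
  | succ n ih =>
    exact ((ih (fun a ha => h a (by omega)) (fun a ha => h' a (by omega))).vcomp
      (h' n (by omega))).vcomp (h _ le_rfl)

end IsCube

end LieCrossedModule

/-! ### Cubes of holonomies -/

section Holonomy

variable {VG VE G E : Type*}
  [NormedAddCommGroup VG] [NormedSpace ℝ VG] [NormedAddCommGroup VE] [NormedSpace ℝ VE]
  [TopologicalSpace G] [ChartedSpace VG G] [Group G]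
  [TopologicalSpace E] [ChartedSpace VE E] [Group E]
  (C : LieCrossedModule VG VE G E)

/-- The holonomy of the pair `(a₁ dt + a₂ ds, b dt ∧ ds)` over the unit square. -/
def sqHol (a₁ a₂ : ℝ → ℝ → VG) (b : ℝ → ℝ → VE) : Sq G E :=
  ⟨pathExp G (fun t => a₁ t 0) 1, pathExp G (fun s => a₂ 1 s) 1, pathExp G (fun s => a₂ 0 s) 1,
    pathExp G (fun t => a₁ t 1) 1, surfPath C a₁ a₂ b 1⟩

/-- The transition square over the unit interval, from `α` to `α'`, for the transition data
`y` and `φ`. -/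
def tauSq (α : ℝ → VG) (y : ℝ → VE) (φ : ℝ → G) (α' : ℝ → VG) : Sq G E :=
  ⟨pathExp G α 1, φ 1, φ 0, pathExp G α' 1, transPath C α y 1⟩

variable {C} [LieGroup 𝓘(ℝ, VG) ∞ G] [LieGroup 𝓘(ℝ, VE) ∞ E] [CompleteSpace VG] [CompleteSpace VE]

omit [LieGroup 𝓘(ℝ, VE) ∞ E] [CompleteSpace VE] in
/-- The path-ordered exponential of a gauge transformed 1-form. -/
theorem pathExp_gauge {α α' L : ℝ → VG} {φ : ℝ → G} (hα : ContinuousOn α I01)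
    (hφ : ∀ t ∈ I01, HasLogDerivWithinAt φ (L t) I01 t)
    (h : ∀ t ∈ I01, α' t = adL VG (φ t)⁻¹ (α t) + L t) {t : ℝ} (ht : t ∈ I01) :
    pathExp G α' t = (φ 0)⁻¹ * pathExp G α t * φ t := by
  refine IsPathExp.pathExp_eq (g := fun t => (φ 0)⁻¹ * pathExp G α t * φ t)
    (isPathExp_iff.2 ⟨by simp [pathExp_zero hα], fun t ht => ?_⟩) ht
  rw [h t ht]
  exact ((hasLogDerivWithinAt_pathExp (G := G) hα ht).const_mul _).mul (hφ t ht)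

/-- The transition square from `α` to the gauge transformed 1-form `α'` is flat. -/
theorem sqFlat_tauSq {α α' L : ℝ → VG} {y : ℝ → VE} {φ : ℝ → G} (hα : ContinuousOn α I01)
    (hy : ContinuousOn y I01) (hφ : ∀ t ∈ I01, HasLogDerivWithinAt φ (L t) I01 t)
    (h : ∀ t ∈ I01, α' t = adL VG (φ t)⁻¹ (α t + C.dbdL (y t)) + L t) :
    C.SqFlat (tauSq C α y φ α') := by
  have hαy : ContinuousOn (fun t => α t + C.dbdL (y t)) I01 :=
    hα.add (C.dbdL.continuous.comp_continuousOn hy)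
  rw [LieCrossedModule.sqFlat_iff]
  simp only [tauSq]
  rw [bd_transPath hα hy I01_one, pathExp_gauge (G := G) hαy hφ h I01_one]
  group

variable {a₁ a₂ d₁ d₂ a₁' a₂' d₁' d₂' L₁ L₂ : ℝ → ℝ → VG} {b b' η₁ η₂ m₁ m₂ : ℝ → ℝ → VE}
  {φ : ℝ → ℝ → G}

theorem IsFakeFlat.sqFlat (h : IsFakeFlat C a₁ a₂ d₁ d₂ b) : C.SqFlat (sqHol C a₁ a₂ b) := by
  rw [LieCrossedModule.sqFlat_iff]
  simp only [sqHol]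
  rw [h.bd_surfPath I01_one, axial]
  group

/-- The cube of a gauge transformation of a pair on the unit square. The transformation is the
shift by `η`, followed by the action of `φ⁻¹`, which changes the surface-ordered exponential by
the action of its value at `(0,0)`. -/
theorem IsFakeFlat.isCube (h : IsFakeFlat C a₁ a₂ d₁ d₂ b) (hη : IsSqConn η₁ η₂ m₁ m₂)
    (h' : IsFakeFlat C a₁' a₂' d₁' d₂' b')
    (hφ₁ : ∀ t ∈ I01, ∀ s ∈ I01, HasLogDerivWithinAt (fun t => φ t s) (L₁ t s) I01 t)
    (hφ₂ : ∀ t ∈ I01, ∀ s ∈ I01, HasLogDerivWithinAt (fun s => φ t s) (L₂ t s) I01 s)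
    (ha₁ : ∀ t ∈ I01, ∀ s ∈ I01,
      a₁' t s = adL VG (φ t s)⁻¹ (a₁ t s + C.dbdL (η₁ t s)) + L₁ t s)
    (ha₂ : ∀ t ∈ I01, ∀ s ∈ I01,
      a₂' t s = adL VG (φ t s)⁻¹ (a₂ t s + C.dbdL (η₂ t s)) + L₂ t s)
    (hb : ∀ t ∈ I01, ∀ s ∈ I01,
      b' t s = C.lactL (φ t s)⁻¹ (shiftB C a₁ a₂ b η₁ η₂ m₁ m₂ t s)) :
    C.IsCube (tauSq C (fun s => a₂ 0 s) (fun s => η₂ 0 s) (fun s => φ 0 s) (fun s => a₂' 0 s))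
      (tauSq C (fun s => a₂ 1 s) (fun s => η₂ 1 s) (fun s => φ 1 s) (fun s => a₂' 1 s))
      (tauSq C (fun t => a₁ t 0) (fun t => η₁ t 0) (fun t => φ t 0) (fun t => a₁' t 0))
      (tauSq C (fun t => a₁ t 1) (fun t => η₁ t 1) (fun t => φ t 1) (fun t => a₁' t 1))
      (sqHol C a₁ a₂ b) (sqHol C a₁' a₂' b') where
  q₀₀ := rfl
  q₀₁ := rfl
  q₁₀ := rfl
  q₁₁ := rfl
  p₀₀ := rfl
  p₀₁ := rfl
  p₁₀ := rfl
  p₁₁ := rfl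
  r₀₀ := rfl
  r₀₁ := rfl
  r₁₀ := rfl
  r₁₁ := rfl
  flat_l := sqFlat_tauSq (h.cont₂.slice₂ I01_zero) (hη.cont₂.slice₂ I01_zero) (hφ₂ 0 I01_zero)
    (ha₂ 0 I01_zero)
  flat_r := sqFlat_tauSq (h.cont₂.slice₂ I01_one) (hη.cont₂.slice₂ I01_one) (hφ₂ 1 I01_one)
    (ha₂ 1 I01_one)
  flat_f := sqFlat_tauSq (h.cont₁.slice₁ I01_zero) (hη.cont₁.slice₁ I01_zero)
    (fun t ht => hφ₁ t ht 0 I01_zero) (fun t ht => ha₁ t ht 0 I01_zero)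
  flat_b := sqFlat_tauSq (h.cont₁.slice₁ I01_one) (hη.cont₁.slice₁ I01_one)
    (fun t ht => hφ₁ t ht 1 I01_one) (fun t ht => ha₁ t ht 1 I01_one)
  flat_d := h.sqFlat
  flat_u := h'.sqFlat
  eq := by
    have hs := h.shift hη
    have key := h.surfPath_shift hη
    -- the axial transports of the transformed and of the shifted 1-form
    have hk : ∀ t ∈ I01, ∀ s ∈ I01, axial G a₁' a₂' t s = (φ 0 0)⁻¹
        * axial G (fun t s => a₁ t s + C.dbdL (η₁ t s)) (fun t s => a₂ t s + C.dbdL (η₂ t s)) t s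
        * φ t s := by
      intro t ht s hs'
      rw [axial, pathExp_gauge (G := G) (hs.cont₂.slice₂ I01_zero) (hφ₂ 0 I01_zero)
        (ha₂ 0 I01_zero) hs', pathExp_gauge (G := G) (hs.cont₁.slice₁ hs')
        (fun t ht => hφ₁ t ht s hs') (fun t ht => ha₁ t ht s hs') ht, axial]
      group
    have hu : C.act (φ 0 0) (surfPath C a₁' a₂' b' 1)
        = surfPath C (fun t s => a₁ t s + C.dbdL (η₁ t s)) (fun t s => a₂ t s + C.dbdL (η₂ t s))
          (shiftB C a₁ a₂ b η₁ η₂ m₁ m₂) 1 := by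
      symm
      have h1 := isPathExp_iff.1 h'.isPathExp_surfPath
      refine IsPathExp.pathExp_eq (g := fun s => C.act (φ 0 0) (surfPath C a₁' a₂' b' s))
        (isPathExp_iff.2 ⟨by rw [h1.1, map_one], fun s hs' => ?_⟩) I01_one
      refine Eq.mp (congrArg (fun X => HasLogDerivWithinAt _ X I01 s) ?_)
        ((h1.2 s hs').act_const C (φ 0 0))
      rw [clm_integral _ ((continuousOn_lactL_axial h'.cont₁ h'.cont₂ h'.cont_b).slice₁ hs')
        I01_one]
      refine integral_congr_I01 (fun t ht => ?_) I01_one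
      rw [hk t ht s hs', hb t ht s hs', ← C.lactL_mul, ← C.lactL_mul]
      congr 2
      group
    simp only [sqHol, tauSq]
    rw [hu]
    exact key

end Holonomy

/-! ### The cubes of a connection -/

section Bundle

variable {V VG VE G E M ι : Type*} [NormedAddCommGroup V] [NormedSpace ℝ V]
  [NormedAddCommGroup VG] [NormedSpace ℝ VG] [NormedAddCommGroup VE] [NormedSpace ℝ VE]
  [TopologicalSpace G] [ChartedSpace VG G] [Group G]
  [TopologicalSpace E] [ChartedSpace VE E] [Group E]
  [TopologicalSpace M] [ChartedSpace V M]

theorem HasVelWithinAt.hasLogDerivWithinAt_logDer [LieGroup 𝓘(ℝ, VG) ∞ G] {f : M → G} {γ : ℝ → M}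
    {X : V} {s : Set ℝ} {t : ℝ} (h : HasVelWithinAt γ X s t)
    (hf : MDifferentiableAt 𝓘(ℝ, V) 𝓘(ℝ, VG) f (γ t)) :
    HasLogDerivWithinAt (fun τ => f (γ τ)) (logDer (VG := VG) f (γ t) X) s t :=
  h.comp_map (W' := VG) (F := fun y => (f (γ t))⁻¹ * f y)
    (MDifferentiableAt.comp (γ t) (mdiff_mul_left _ _) hf)

variable (V) in
/-- A smooth curve `[0,1] → M` with values in the subset `W`. -/
structure IsSmoothCurve (γ : ℝ → M) (W : Set M) : Prop where
  smooth : ContMDiffOn 𝓘(ℝ, ℝ) 𝓘(ℝ, V) ∞ γ I01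
  mem : ∀ t ∈ I01, γ t ∈ W

theorem IsSmoothCurve.mono {γ : ℝ → M} {W W' : Set M} (h : IsSmoothCurve V γ W) (hW : W ⊆ W') :
    IsSmoothCurve V γ W' :=
  ⟨h.smooth, fun t ht => hW (h.mem t ht)⟩

theorem IsSmoothSq.mono {S : ℝ → ℝ → M} {W W' : Set M} (h : IsSmoothSq V S W) (hW : W ⊆ W') :
    IsSmoothSq V S W' :=
  ⟨h.smooth, fun t ht s hs => hW (h.mem t ht s hs)⟩

theorem IsSmoothSq.curve₁ {S : ℝ → ℝ → M} {W : Set M} (h : IsSmoothSq V S W) {s : ℝ}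
    (hs : s ∈ I01) : IsSmoothCurve V (fun t => S t s) W :=
  ⟨h.smooth₁ hs, fun t ht => h.mem t ht s hs⟩

theorem IsSmoothSq.curve₂ {S : ℝ → ℝ → M} {W : Set M} (h : IsSmoothSq V S W) {t : ℝ}
    (ht : t ∈ I01) : IsSmoothCurve V (fun s => S t s) W :=
  ⟨h.smooth₂ ht, fun s hs => h.mem t ht s hs⟩

namespace IsSmoothCurve

variable {γ : ℝ → M} {W : Set M} (h : IsSmoothCurve V γ W)
include h

theorem hasVel {t : ℝ} (ht : t ∈ I01) : HasVelWithinAt (W := V) γ (vel V γ t) I01 t :=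
  (h.smooth t ht).hasVelWithinAt_vel

theorem isSmoothSq : IsSmoothSq V (fun t _ => γ t) W where
  smooth := h.smooth.comp (f := fun p : ℝ × ℝ => p.1)
    (contMDiff_iff_contDiff.2 contDiff_fst).contMDiffOn (fun _ hp => hp.1)
  mem t ht _ _ := h.mem t ht

theorem continuousOn_pull₁ {F : Type*} [NormedAddCommGroup F] [NormedSpace ℝ F]
    [IsManifold 𝓘(ℝ, V) ∞ M] {w : DForm V M 1 F} (hw : SmoothFormOn w W) (hW : IsOpen W) :
    ContinuousOn (pull₁ w γ) I01 :=
  (h.isSmoothSq.contDiffOn_pull₁₁ hW hw).continuousOn.slice₁ (f := fun t _ => pull₁ w γ t) I01_zero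

end IsSmoothCurve

namespace CubicalBundle.Connection

variable {C : LieCrossedModule VG VE G E} {U : ι → Set M} {𝓑 : CubicalBundle V C U}
  (𝓐 : 𝓑.Connection) (hU : ∀ i, IsOpen (U i))
  [IsManifold 𝓘(ℝ, V) ∞ M]
include hU

/-- The pull-back of a connection pair to a square has vanishing fake curvature. -/
theorem isFakeFlat {S : ℝ → ℝ → M} {i : ι} (h : IsSmoothSq V S (U i)) :
    IsFakeFlat C (fun t s => pull₁ (𝓐.A i) (fun t' => S t' s) t)
      (fun t s => pull₁ (𝓐.A i) (fun s' => S t s') s)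
      (fun t s => fderivWithin ℝ (fun p : ℝ × ℝ => pull₁ (𝓐.A i) (fun t => S t p.2) p.1)
        (I01 ×ˢ I01) (t, s) (0, 1))
      (fun t s => fderivWithin ℝ (fun p : ℝ × ℝ => pull₁ (𝓐.A i) (fun s => S p.1 s) p.2)
        (I01 ×ˢ I01) (t, s) (1, 0)) (pull₂ (𝓐.B i) S) where
  toIsSqConn := h.isSqConn_pull₁ (hU i) (𝓐.smooth_A i)
  cont_b := h.continuousOn_pull₂ (hU i) (𝓐.smooth_B i)
  dbd_b t ht s hs := by
    rw [← h.pull₂_dForm (hU i) (𝓐.smooth_A i) ht hs]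
    exact 𝓐.fake_curvature i (S t s) (h.mem t ht s hs) _ _

variable [LieGroup 𝓘(ℝ, VG) ∞ G]

omit [IsManifold 𝓘(ℝ, V) ∞ M] in
theorem hasLogDeriv_φ {γ : ℝ → M} {i j : ι} (h : IsSmoothCurve V γ (U i ∩ U j)) {t : ℝ}
    (ht : t ∈ I01) :
    HasLogDerivWithinAt (fun t => 𝓑.φ i j (γ t))
      (logDer (VG := VG) (𝓑.φ i j) (γ t) (vel V γ t)) I01 t :=
  (h.hasVel ht).hasLogDerivWithinAt_logDer
    (((𝓑.smooth_φ i j).contMDiffAt (((hU i).inter (hU j)).mem_nhds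
      (h.mem t ht))).mdifferentiableAt (by simp))

omit hU [IsManifold 𝓘(ℝ, V) ∞ M] in
theorem pull₁_transition {γ : ℝ → M} {i j : ι} {t : ℝ} (h : γ t ∈ U i ∩ U j) :
    pull₁ (𝓐.A j) γ t = adL VG (𝓑.φ i j (γ t))⁻¹
      (pull₁ (𝓐.A i) γ t + C.dbdL (pull₁ (𝓐.η i j) γ t))
      + logDer (𝓑.φ i j) (γ t) (vel V γ t) :=
  𝓐.A_transition i j (γ t) h (vel V γ t)

variable [LieGroup 𝓘(ℝ, VE) ∞ E] [CompleteSpace VG] [CompleteSpace VE]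

/-- The transition square of a curve as a path-ordered exponential. -/
theorem tau_eq {γ : ℝ → M} {i j : ι} (h : IsSmoothCurve V γ (U i ∩ U j)) :
    𝓐.tau i j γ = tauSq C (pull₁ (𝓐.A i) γ) (pull₁ (𝓐.η i j) γ) (fun t => 𝓑.φ i j (γ t))
      (pull₁ (𝓐.A j) γ) := by
  have := surfExp_eq_transPath (C := C)
    ((h.mono inter_subset_left).continuousOn_pull₁ (𝓐.smooth_A i) (hU i))
    (h.continuousOn_pull₁ (𝓐.smooth_η i j) ((hU i).inter (hU j)))
  rw [tau, tauSq, ← this]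
  rfl

theorem sqFlat_tau {γ : ℝ → M} {i j : ι} (h : IsSmoothCurve V γ (U i ∩ U j)) :
    C.SqFlat (𝓐.tau i j γ) := by
  rw [𝓐.tau_eq hU h]
  exact sqFlat_tauSq ((h.mono inter_subset_left).continuousOn_pull₁ (𝓐.smooth_A i) (hU i))
    (h.continuousOn_pull₁ (𝓐.smooth_η i j) ((hU i).inter (hU j)))
    (fun t ht => hasLogDeriv_φ hU h ht) (fun t ht => 𝓐.pull₁_transition (h.mem t ht))

/-- The cube over a square in the intersection of two charts. -/
theorem isCube_localHol {S : ℝ → ℝ → M} {i j : ι} (h : IsSmoothSq V S (U i ∩ U j)) :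
    C.IsCube (𝓐.tau i j (fun s => S 0 s)) (𝓐.tau i j (fun s => S 1 s))
      (𝓐.tau i j (fun t => S t 0)) (𝓐.tau i j (fun t => S t 1))
      (localHol C (𝓐.A i) (𝓐.B i) S) (localHol C (𝓐.A j) (𝓐.B j) S) := by
  rw [𝓐.tau_eq hU (h.curve₂ I01_zero), 𝓐.tau_eq hU (h.curve₂ I01_one),
    𝓐.tau_eq hU (h.curve₁ I01_zero), 𝓐.tau_eq hU (h.curve₁ I01_one)]
  have hW := (hU i).inter (hU j)
  refine (𝓐.isFakeFlat hU (h.mono inter_subset_left)).isCube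
    (h.isSqConn_pull₁ hW (𝓐.smooth_η i j)) (𝓐.isFakeFlat hU (h.mono inter_subset_right))
    (φ := fun t s => 𝓑.φ i j (S t s))
    (fun t ht s hs => hasLogDeriv_φ hU (h.curve₁ hs) ht)
    (fun t ht s hs => hasLogDeriv_φ hU (h.curve₂ ht) hs)
    (fun t ht s hs => 𝓐.pull₁_transition (γ := fun t => S t s) (h.mem t ht s hs))
    (fun t ht s hs => 𝓐.pull₁_transition (γ := fun s => S t s) (h.mem t ht s hs))
    (fun t ht s hs => ?_)
  rw [shiftB, ← h.pull₂_dForm hW (𝓐.smooth_η i j) ht hs]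
  have := 𝓐.B_transition i j (S t s) (h.mem t ht s hs) (vel V (fun t => S t s) t)
    (vel V (fun s => S t s) s)
  rw [← C.dactL_apply, ← C.dactL_apply] at this
  exact this

end CubicalBundle.Connection

end Bundle

/-! ### Cubes at vertices and along edges -/

section Bundle

variable {V VG VE G E M ι : Type*} [NormedAddCommGroup V] [NormedSpace ℝ V]
  [NormedAddCommGroup VG] [NormedSpace ℝ VG] [NormedAddCommGroup VE] [NormedSpace ℝ VE]
  [TopologicalSpace G] [ChartedSpace VG G] [Group G]
  [TopologicalSpace E] [ChartedSpace VE E] [Group E]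
  [TopologicalSpace M] [ChartedSpace V M]

namespace CubicalBundle.Connection

variable {C : LieCrossedModule VG VE G E} {U : ι → Set M} {𝓑 : CubicalBundle V C U}
  (𝓐 : 𝓑.Connection)

theorem sqFlat_psiSq {i j k l : ι} {x : M} (hx : x ∈ U i ∩ U j ∩ U k ∩ U l) :
    C.SqFlat (𝓐.psiSq i j k l x) := 𝓑.flat_sq i j k l x hx

/-- The cube at a vertex where four charts meet, for two choices of charts. -/
theorem isCube_vertex {i j k l i' j' k' l' : ι} {x : M} (hx : x ∈ U i ∩ U j ∩ U k ∩ U l)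
    (hx' : x ∈ U i' ∩ U j' ∩ U k' ∩ U l') :
    C.IsCube (𝓐.psiSq i k i' k' x) (𝓐.psiSq j l j' l' x) (𝓐.psiSq i j i' j' x)
      (𝓐.psiSq k l k' l' x) (𝓐.psiSq i j k l x) (𝓐.psiSq i' j' k' l' x) := by
  have := LieCrossedModule.isCube_of_cubeFlat (𝓑.flat_cube (fun x₁ x₂ x₃ =>
    bif x₃ then (bif x₂ then (bif x₁ then l' else k') else (bif x₁ then j' else i'))
    else (bif x₂ then (bif x₁ then l else k) else (bif x₁ then j else i))) x (by
      obtain ⟨⟨⟨h1, h2⟩, h3⟩, h4⟩ := hx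
      obtain ⟨⟨⟨h1', h2'⟩, h3'⟩, h4'⟩ := hx'
      rintro (_ | _) (_ | _) (_ | _) <;> assumption))
  exact this

variable (hU : ∀ i, IsOpen (U i)) [LieGroup 𝓘(ℝ, VG) ∞ G] [LieGroup 𝓘(ℝ, VE) ∞ E]
  [CompleteSpace VG] [CompleteSpace VE] [IsManifold 𝓘(ℝ, V) ∞ M]
include hU

section Pair

variable {γ : ℝ → M} {i j : ι} (h : IsSmoothCurve V γ (U i ∩ U j)) {t : ℝ} (ht : t ∈ I01)
include h ht

omit [LieGroup 𝓘(ℝ, VE) ∞ E] [CompleteSpace VE] in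
/-- The holonomy of the intermediate 1-form `A i + ∂ (η i j)`. -/
theorem pathExp_add_dbd :
    pathExp G (fun t => pull₁ (𝓐.A i) γ t + C.dbdL (pull₁ (𝓐.η i j) γ t)) t
      = 𝓑.φ i j (γ 0) * pathExp G (pull₁ (𝓐.A j) γ) t * (𝓑.φ i j (γ t))⁻¹ := by
  have h1 : ContinuousOn (fun t => pull₁ (𝓐.A i) γ t + C.dbdL (pull₁ (𝓐.η i j) γ t)) I01 :=
    ((h.mono inter_subset_left).continuousOn_pull₁ (𝓐.smooth_A i) (hU i)).add
    (C.dbdL.continuous.comp_continuousOn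
      (h.continuousOn_pull₁ (𝓐.smooth_η i j) ((hU i).inter (hU j))))
  rw [pathExp_gauge h1 (φ := fun t => 𝓑.φ i j (γ t)) (fun t ht => hasLogDeriv_φ hU h ht)
    (fun t ht => 𝓐.pull₁_transition (h.mem t ht)) ht]
  group

/-- The logarithmic derivative of the transition element, expressed by the holonomy of `A j`. -/
theorem hasLogDeriv_transPath :
    HasLogDerivWithinAt (transPath C (pull₁ (𝓐.A i) γ) (pull₁ (𝓐.η i j) γ))
      (-C.lactL (𝓑.φ i j (γ 0) * pathExp G (pull₁ (𝓐.A j) γ) t * (𝓑.φ i j (γ t))⁻¹)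
        (pull₁ (𝓐.η i j) γ t)) I01 t := by
  rw [← 𝓐.pathExp_add_dbd hU h ht]
  exact hasLogDerivWithinAt_pathExp (continuousOn_transCoeff
    ((h.mono inter_subset_left).continuousOn_pull₁ (𝓐.smooth_A i) (hU i))
    (h.continuousOn_pull₁ (𝓐.smooth_η i j) ((hU i).inter (hU j)))) ht

/-- The boundary of the transition element, expressed by the holonomies of `A i` and `A j`. -/
theorem bd_transPath_eq :
    C.bd (transPath C (pull₁ (𝓐.A i) γ) (pull₁ (𝓐.η i j) γ) t)
      = pathExp G (pull₁ (𝓐.A i) γ) t * (𝓑.φ i j (γ t) * (pathExp G (pull₁ (𝓐.A j) γ) t)⁻¹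
        * (𝓑.φ i j (γ 0))⁻¹) := by
  rw [bd_transPath ((h.mono inter_subset_left).continuousOn_pull₁ (𝓐.smooth_A i) (hU i))
    (h.continuousOn_pull₁ (𝓐.smooth_η i j) ((hU i).inter (hU j))) ht, 𝓐.pathExp_add_dbd hU h ht]
  group

end Pair

/-- The cube over a curve in the intersection of four charts. Both sides of the homotopy addition
equation, as functions of the end point of the curve, agree at the start of the curve, and the
compatibility of `η` and `ψ` says that they have the same logarithmic derivative. -/
theorem isCube_psiSq {γ : ℝ → M} {i j k l : ι}
    (h : IsSmoothCurve V γ (U i ∩ U j ∩ U k ∩ U l)) :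
    C.IsCube (𝓐.psiSq i j k l (γ 0)) (𝓐.psiSq i j k l (γ 1)) (𝓐.tau i k γ) (𝓐.tau j l γ)
      (𝓐.tau i j γ) (𝓐.tau k l γ) := by
  have hik : IsSmoothCurve V γ (U i ∩ U k) := h.mono fun x hx => ⟨hx.1.1.1, hx.1.2⟩
  have hjl : IsSmoothCurve V γ (U j ∩ U l) := h.mono fun x hx => ⟨hx.1.1.2, hx.2⟩
  have hij : IsSmoothCurve V γ (U i ∩ U j) := h.mono fun x hx => ⟨hx.1.1.1, hx.1.1.2⟩
  have hkl : IsSmoothCurve V γ (U k ∩ U l) := h.mono fun x hx => ⟨hx.1.2, hx.2⟩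
  refine
    { q₀₀ := rfl
      q₀₁ := rfl
      q₁₀ := rfl
      q₁₁ := rfl
      p₀₀ := rfl
      p₀₁ := rfl
      p₁₀ := rfl
      p₁₁ := rfl
      r₀₀ := rfl
      r₀₁ := rfl
      r₁₀ := rfl
      r₁₁ := rfl
      flat_l := 𝓐.sqFlat_psiSq (h.mem 0 I01_zero)
      flat_r := 𝓐.sqFlat_psiSq (h.mem 1 I01_one)
      flat_f := 𝓐.sqFlat_tau hU hik
      flat_b := 𝓐.sqFlat_tau hU hjl
      flat_d := 𝓐.sqFlat_tau hU hij
      flat_u := 𝓐.sqFlat_tau hU hkl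
      eq := ?_ }
  rw [𝓐.tau_eq hU hij, 𝓐.tau_eq hU hkl, 𝓐.tau_eq hU hik, 𝓐.tau_eq hU hjl]
  set F : ι → ι → ℝ → E := fun i j => transPath C (pull₁ (𝓐.A i) γ) (pull₁ (𝓐.η i j) γ) with hF
  set g : ι → ℝ → G := fun i => pathExp G (pull₁ (𝓐.A i) γ) with hg
  have hcA : ∀ i, IsSmoothCurve V γ (U i) → ContinuousOn (pull₁ (𝓐.A i) γ) I01 :=
    fun i h => h.continuousOn_pull₁ (𝓐.smooth_A i) (hU i)
  have hF0 : ∀ i j, IsSmoothCurve V γ (U i ∩ U j) → F i j 0 = 1 := fun i j h =>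
    pathExp_zero (continuousOn_transCoeff (hcA i (h.mono inter_subset_left))
      (h.continuousOn_pull₁ (𝓐.smooth_η i j) ((hU i).inter (hU j))))
  have hψ : ∀ t ∈ I01, HasLogDerivWithinAt (fun t => 𝓑.ψ i j k l (γ t))
      (logDer (VG := VE) (𝓑.ψ i j k l) (γ t) (vel V γ t)) I01 t := fun t ht =>
    (h.hasVel ht).hasLogDerivWithinAt_logDer
      (((𝓑.smooth_ψ i j k l).contMDiffAt ((((hU i).inter (hU j)).inter (hU k)).inter
        (hU l) |>.mem_nhds (h.mem t ht))).mdifferentiableAt (by simp))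
  have key := eq_of_hasLogDerivWithinAt (a := 0) (b := 1)
    (g := fun t => C.act (g i t) (𝓑.ψ i j k l (γ t)) * F i k t
      * C.act (𝓑.φ i k (γ 0)) (F k l t))
    (h := fun t => F i j t * C.act (𝓑.φ i j (γ 0)) (F j l t) * 𝓑.ψ i j k l (γ 0))
    (fun t ht => (((hasLogDerivWithinAt_pathExp
      (hcA i (hij.mono inter_subset_left)) ht).act C (hψ t ht)).mul
      (𝓐.hasLogDeriv_transPath hU hik ht)).mul ((𝓐.hasLogDeriv_transPath hU hkl ht).act_const C _))
    (fun t ht => by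
      refine Eq.mp (congrArg (fun X => HasLogDerivWithinAt _ X I01 t) ?_)
        (((𝓐.hasLogDeriv_transPath hU hij ht).mul
        ((𝓐.hasLogDeriv_transPath hU hjl ht).act_const C (𝓑.φ i j (γ 0)))).mul
        (hasLogDerivWithinAt_const (𝓑.ψ i j k l (γ 0)) I01 t))
      have hc := 𝓐.η_compat i j k l (γ t) (h.mem t ht) (vel V γ t)
      rw [add_comm (logDer (VG := VE) (𝓑.ψ i j k l) (γ t) (vel V γ t))] at hc
      have hc' : C.dactGroup (pull₁ (𝓐.A i) γ t) (𝓑.ψ i j k l (γ t))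
          + logDer (VG := VE) (𝓑.ψ i j k l) (γ t) (vel V γ t) = _ := hc.symm
      rw [hc']
      have hflat := (𝓑.flat_sq i j k l (γ 0) (h.mem 0 I01_zero)).eq
      simp only at hflat
      simp only [← C.lactL_bd, map_inv, C.bd_act, 𝓐.bd_transPath_eq hU hik ht,
        𝓐.bd_transPath_eq hU hkl ht, 𝓐.bd_transPath_eq hU hjl ht, hF,
        ← C.lactL_apply, map_add, map_sub, map_neg, ← C.lactL_mul, add_zero]
      have hflat' : (C.bd (𝓑.ψ i j k l (γ 0)))⁻¹ = 𝓑.φ i k (γ 0) * (𝓑.φ k l (γ 0)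
          * ((𝓑.φ j l (γ 0))⁻¹ * (𝓑.φ i j (γ 0))⁻¹)) := by
        rw [inv_eq_iff_eq_inv, eq_comm, inv_eq_iff_eq_inv, eq_inv_iff_mul_eq_one,
          ← mul_inv_rev, ← hflat]
        group
      simp only [hflat', mul_inv_rev, inv_inv, mul_assoc, inv_mul_cancel_left, inv_mul_cancel,
        mul_one]
      simp only [pull₁]
      abel)
    (by
      simp only [hF0 _ _ hik, hF0 _ _ hkl, hF0 _ _ hij, hF0 _ _ hjl, map_one, mul_one, one_mul, hg,
        pathExp_zero (hcA i (hij.mono inter_subset_left)), MulAut.one_apply])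
    I01_one
  exact key

end CubicalBundle.Connection

end Bundle

/-! ### Reparametrization and subdivision -/

section Subdivision

/-- A continuously differentiable map `χ` of the unit interval to itself, with derivative `χ'`. -/
structure IsUnitMap (χ χ' : ℝ → ℝ) : Prop where
  maps : MapsTo χ I01 I01
  deriv : ∀ t ∈ I01, HasDerivWithinAt χ (χ' t) I01 t
  cont : ContinuousOn χ' I01

theorem IsUnitMap.one_mem {χ χ' : ℝ → ℝ} (h : IsUnitMap χ χ') : χ 1 ∈ I01 := h.maps I01_one

/-- The affine parametrization of a subinterval of the unit interval. -/
theorem isUnitMap_affine {p q : ℝ} (hp : p ∈ I01) (hq : q ∈ I01) :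
    IsUnitMap (fun t => p + (q - p) * t) (fun _ => q - p) where
  maps t ht := by
    have h1 : p + (q - p) * t = (1 - t) * p + t * q := by ring
    have h2 : 0 ≤ 1 - t := sub_nonneg.2 ht.2
    refine ⟨?_, ?_⟩
    · change 0 ≤ p + (q - p) * t
      rw [h1]
      exact add_nonneg (mul_nonneg h2 hp.1) (mul_nonneg ht.1 hq.1)
    · change p + (q - p) * t ≤ 1
      rw [h1]
      calc (1 - t) * p + t * q ≤ (1 - t) * 1 + t * 1 :=
            add_le_add (mul_le_mul_of_nonneg_left hp.2 h2) (mul_le_mul_of_nonneg_left hq.2 ht.1)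
        _ = 1 := by ring
  deriv t _ := by
    simpa using ((hasDerivWithinAt_id t I01).const_mul (q - p)).const_add p
  cont := continuousOn_const

theorem isUnitMap_id : IsUnitMap (fun t => t) (fun _ => 1) :=
  ⟨fun _ h => h, fun t _ => hasDerivWithinAt_id t _, continuousOn_const⟩

theorem IsReparam.isUnitMap {θ : ℝ → ℝ} (h : IsReparam θ) :
    IsUnitMap θ (derivWithin θ I01) where
  maps t ht := ⟨by rw [← h.2.2.1]; exact h.2.1 I01_zero ht ht.1,
    by rw [← h.2.2.2]; exact h.2.1 ht I01_one ht.2⟩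
  deriv t ht := ((h.1.differentiableOn (by simp)) t ht).hasDerivWithinAt
  cont := h.1.continuousOn_derivWithin (uniqueDiffOn_Icc zero_lt_one) (by simp)

theorem integral_comp_unitMap {F : Type*} [NormedAddCommGroup F] [NormedSpace ℝ F]
    [CompleteSpace F] {f : ℝ → F} (hf : ContinuousOn f I01) {χ χ' : ℝ → ℝ} (hχ : IsUnitMap χ χ') :
    ∫ t in (0 : ℝ)..1, χ' t • f (χ t)
      = (∫ t in (0 : ℝ)..χ 1, f t) - ∫ t in (0 : ℝ)..χ 0, f t := by
  have hc : ContinuousOn χ I01 := fun t ht => (hχ.deriv t ht).continuousWithinAt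
  refine integral_eq_sub_Icc (f := fun t => ∫ τ in (0 : ℝ)..χ t, f τ) (fun t ht => ?_)
    (hχ.cont.smul (hf.comp hc hχ.maps)) I01_one
  exact HasDerivWithinAt.scomp t (hasDerivWithinAt_integral_Icc hf (hχ.maps ht)) (hχ.deriv t ht)
    hχ.maps

section Path

variable {VG VE G E : Type*}
  [NormedAddCommGroup VG] [NormedSpace ℝ VG] [NormedAddCommGroup VE] [NormedSpace ℝ VE]
  [TopologicalSpace G] [ChartedSpace VG G] [Group G]
  [TopologicalSpace E] [ChartedSpace VE E] [Group E]
  {C : LieCrossedModule VG VE G E} [LieGroup 𝓘(ℝ, VG) ∞ G] [CompleteSpace VG]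

/-- The path-ordered exponential of the pull-back of a coefficient along a map of the interval. -/
theorem pathExp_comp {a a' : ℝ → VG} (ha : ContinuousOn a I01) {χ χ' : ℝ → ℝ}
    (hχ : IsUnitMap χ χ') (h : ∀ t ∈ I01, a' t = χ' t • a (χ t)) {t : ℝ} (ht : t ∈ I01) :
    pathExp G a' t = (pathExp G a (χ 0))⁻¹ * pathExp G a (χ t) := by
  refine IsPathExp.pathExp_eq (g := fun t => (pathExp G a (χ 0))⁻¹ * pathExp G a (χ t))
    (isPathExp_iff.2 ⟨inv_mul_cancel _, fun t ht => ?_⟩) ht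
  rw [h t ht]
  exact ((hasLogDerivWithinAt_pathExp (G := G) ha (hχ.maps ht)).comp_real (hχ.deriv t ht)
    hχ.maps).const_mul _

variable [LieGroup 𝓘(ℝ, VE) ∞ E] [CompleteSpace VE]

omit [LieGroup 𝓘(ℝ, VG) ∞ G] [CompleteSpace VG] in
/-- The path-ordered exponential of a coefficient that is rescaled and acted on by `g`. -/
theorem pathExp_act_comp {X X' : ℝ → VE} (hX : ContinuousOn X I01) {χ χ' : ℝ → ℝ}
    (hχ : IsUnitMap χ χ') (g : G) (h : ∀ t ∈ I01, X' t = C.lactL g (χ' t • X (χ t))) {t : ℝ}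
    (ht : t ∈ I01) :
    pathExp E X' t = C.act g ((pathExp E X (χ 0))⁻¹ * pathExp E X (χ t)) := by
  refine IsPathExp.pathExp_eq (g := fun t => C.act g ((pathExp E X (χ 0))⁻¹ * pathExp E X (χ t)))
    (isPathExp_iff.2 ⟨by rw [inv_mul_cancel, map_one], fun t ht => ?_⟩) ht
  rw [h t ht]
  exact (((hasLogDerivWithinAt_pathExp (G := E) hX (hχ.maps ht)).comp_real (hχ.deriv t ht)
    hχ.maps).const_mul _).act_const C g

/-- The transition element of pulled back data. -/
theorem transPath_comp {α α' : ℝ → VG} {y y' : ℝ → VE} (hα : ContinuousOn α I01)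
    (hy : ContinuousOn y I01) {χ χ' : ℝ → ℝ} (hχ : IsUnitMap χ χ')
    (h : ∀ t ∈ I01, α' t = χ' t • α (χ t)) (h' : ∀ t ∈ I01, y' t = χ' t • y (χ t)) {t : ℝ}
    (ht : t ∈ I01) :
    transPath C α' y' t = C.act (pathExp G (fun t => α t + C.dbdL (y t)) (χ 0))⁻¹
      ((transPath C α y (χ 0))⁻¹ * transPath C α y (χ t)) := by
  have hαy : ContinuousOn (fun t => α t + C.dbdL (y t)) I01 :=
    hα.add (C.dbdL.continuous.comp_continuousOn hy)
  refine pathExp_act_comp (continuousOn_transCoeff hα hy) hχ _ (fun t ht => ?_) ht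
  rw [pathExp_comp hαy hχ (fun t ht => by rw [h t ht, h' t ht, map_smul, smul_add]) ht,
    C.lactL_mul, h' t ht]
  simp only [ContinuousLinearMap.map_smul, map_neg, smul_neg]

/-- The transition square of pulled back data. -/
theorem tauSq_comp {α α' β β' : ℝ → VG} {y y' : ℝ → VE} {φ : ℝ → G} (hα : ContinuousOn α I01)
    (hβ : ContinuousOn β I01)
    (hy : ContinuousOn y I01) {χ χ' : ℝ → ℝ} (hχ : IsUnitMap χ χ')
    (h : ∀ t ∈ I01, α' t = χ' t • α (χ t)) (hβ' : ∀ t ∈ I01, β' t = χ' t • β (χ t))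
    (h' : ∀ t ∈ I01, y' t = χ' t • y (χ t)) :
    tauSq C α' y' (fun t => φ (χ t)) β'
      = ⟨(pathExp G α (χ 0))⁻¹ * pathExp G α (χ 1), φ (χ 1), φ (χ 0),
        (pathExp G β (χ 0))⁻¹ * pathExp G β (χ 1),
        C.act (pathExp G (fun t => α t + C.dbdL (y t)) (χ 0))⁻¹
          ((transPath C α y (χ 0))⁻¹ * transPath C α y (χ 1))⟩ := by
  rw [tauSq, pathExp_comp hα hχ h I01_one, pathExp_comp hβ hχ hβ' I01_one,
    transPath_comp hα hy hχ h h' I01_one]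

variable {a₁ a₂ a₁' a₂' : ℝ → ℝ → VG} {b b' : ℝ → ℝ → VE}

/-- The holonomy of a horizontal strip of the unit square, in arbitrary parametrization. -/
theorem sqHol_strip (ha₁ : ContinuousOn (Function.uncurry a₁) (I01 ×ˢ I01))
    (ha₂ : ContinuousOn (Function.uncurry a₂) (I01 ×ˢ I01))
    (hb : ContinuousOn (Function.uncurry b) (I01 ×ˢ I01)) {χ₁ χ₁' χ₂ χ₂' : ℝ → ℝ}
    (hχ₁ : IsUnitMap χ₁ χ₁') (hχ₂ : IsUnitMap χ₂ χ₂') (h0 : χ₁ 0 = 0) (h1 : χ₁ 1 = 1)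
    (e₁ : ∀ t ∈ I01, ∀ s ∈ I01, a₁' t s = χ₁' t • a₁ (χ₁ t) (χ₂ s))
    (e₂ : ∀ t ∈ I01, ∀ s ∈ I01, a₂' t s = χ₂' s • a₂ (χ₁ t) (χ₂ s))
    (e_b : ∀ t ∈ I01, ∀ s ∈ I01, b' t s = (χ₁' t * χ₂' s) • b (χ₁ t) (χ₂ s)) :
    sqHol C a₁' a₂' b' =
      ⟨pathExp G (fun t => a₁ t (χ₂ 0)) 1,
        (pathExp G (fun s => a₂ 1 s) (χ₂ 0))⁻¹ * pathExp G (fun s => a₂ 1 s) (χ₂ 1),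
        (pathExp G (fun s => a₂ 0 s) (χ₂ 0))⁻¹ * pathExp G (fun s => a₂ 0 s) (χ₂ 1),
        pathExp G (fun t => a₁ t (χ₂ 1)) 1,
        C.act (pathExp G (fun s => a₂ 0 s) (χ₂ 0))⁻¹
          ((surfPath C a₁ a₂ b (χ₂ 0))⁻¹ * surfPath C a₁ a₂ b (χ₂ 1))⟩ := by
  have hH : ∀ s ∈ I01, ∀ t ∈ I01, pathExp G (fun t => a₁' t s) t
      = pathExp G (fun t => a₁ t (χ₂ s)) (χ₁ t) := by
    intro s hs t ht
    rw [pathExp_comp (ha₁.slice₁ (hχ₂.maps hs)) hχ₁ (fun t ht => e₁ t ht s hs) ht, h0,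
      pathExp_zero (ha₁.slice₁ (hχ₂.maps hs)), inv_one, one_mul]
  have hK : ∀ t ∈ I01, ∀ s ∈ I01, pathExp G (fun s => a₂' t s) s
      = (pathExp G (fun s => a₂ (χ₁ t) s) (χ₂ 0))⁻¹
        * pathExp G (fun s => a₂ (χ₁ t) s) (χ₂ s) := fun t ht s hs =>
    pathExp_comp (ha₂.slice₂ (hχ₁.maps ht)) hχ₂ (fun s hs => e₂ t ht s hs) hs
  have hsurf : surfPath C a₁' a₂' b' 1 = C.act (pathExp G (fun s => a₂ 0 s) (χ₂ 0))⁻¹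
      ((surfPath C a₁ a₂ b (χ₂ 0))⁻¹ * surfPath C a₁ a₂ b (χ₂ 1)) := by
    refine pathExp_act_comp (continuousOn_integral_lactL_axial ha₁ ha₂ hb) hχ₂ _
      (fun s hs => ?_) I01_one
    have hc : ContinuousOn (fun t => C.lactL (axial G a₁ a₂ t (χ₂ s)) (b t (χ₂ s))) I01 :=
      (continuousOn_lactL_axial ha₁ ha₂ hb).slice₁ (hχ₂.maps hs)
    have hint := integral_comp_unitMap hc hχ₁
    rw [h0, h1, intervalIntegral.integral_same, sub_zero] at hint
    have hc' : ContinuousOn (fun t => χ₁' t • C.lactL (axial G a₁ a₂ (χ₁ t) (χ₂ s))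
        (b (χ₁ t) (χ₂ s))) I01 :=
      hχ₁.cont.smul (hc.comp (fun t ht => (hχ₁.deriv t ht).continuousWithinAt) hχ₁.maps)
    rw [← hint, map_smul, clm_integral _ hc' I01_one, ← intervalIntegral.integral_smul]
    refine integral_congr_I01 (fun t ht => ?_) I01_one
    rw [e_b t ht s hs, axial, hK 0 I01_zero s hs, hH s hs t ht, h0, axial, mul_assoc,
      C.lactL_mul, map_smul, map_smul, map_smul, smul_smul, mul_comm (χ₁' t)]
  rw [sqHol, hsurf, hH _ I01_zero _ I01_one, hH _ I01_one _ I01_one, hK _ I01_zero _ I01_one,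
    hK _ I01_one _ I01_one, h0, h1]

/-- Subdivision of a square by a vertical line. -/
theorem sqHol_hcomp {aL₁ aL₂ dL₁ dL₂ aR₁ aR₂ : ℝ → ℝ → VG} {bL bR : ℝ → ℝ → VE} {c : ℝ}
    (ha₁ : ContinuousOn (Function.uncurry a₁) (I01 ×ˢ I01))
    (ha₂ : ContinuousOn (Function.uncurry a₂) (I01 ×ˢ I01))
    (hb : ContinuousOn (Function.uncurry b) (I01 ×ˢ I01))
    (hL : IsFakeFlat C aL₁ aL₂ dL₁ dL₂ bL)
    (haR₁ : ContinuousOn (Function.uncurry aR₁) (I01 ×ˢ I01))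
    (haR₂ : ContinuousOn (Function.uncurry aR₂) (I01 ×ˢ I01))
    (hbR : ContinuousOn (Function.uncurry bR) (I01 ×ˢ I01))
    {χL χL' χR χR' : ℝ → ℝ} (hχL : IsUnitMap χL χL') (hχR : IsUnitMap χR χR')
    (hL0 : χL 0 = 0) (hL1 : χL 1 = c) (hR0 : χR 0 = c) (hR1 : χR 1 = 1)
    (eL₁ : ∀ t ∈ I01, ∀ s ∈ I01, aL₁ t s = χL' t • a₁ (χL t) s)
    (eL₂ : ∀ t ∈ I01, ∀ s ∈ I01, aL₂ t s = a₂ (χL t) s)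
    (eLb : ∀ t ∈ I01, ∀ s ∈ I01, bL t s = χL' t • b (χL t) s)
    (eR₁ : ∀ t ∈ I01, ∀ s ∈ I01, aR₁ t s = χR' t • a₁ (χR t) s)
    (eR₂ : ∀ t ∈ I01, ∀ s ∈ I01, aR₂ t s = a₂ (χR t) s)
    (eRb : ∀ t ∈ I01, ∀ s ∈ I01, bR t s = χR' t • b (χR t) s) :
    C.hcomp (sqHol C aL₁ aL₂ bL) (sqHol C aR₁ aR₂ bR) = sqHol C a₁ a₂ b := by
  have hc : c ∈ I01 := hL1 ▸ hχL.one_mem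
  have hH1 : ∀ s ∈ I01, ∀ t ∈ I01, pathExp G (fun t => aL₁ t s) t
      = pathExp G (fun t => a₁ t s) (χL t) := by
    intro s hs t ht
    rw [pathExp_comp (ha₁.slice₁ hs) hχL (fun t ht => eL₁ t ht s hs) ht, hL0,
      pathExp_zero (ha₁.slice₁ hs), inv_one, one_mul]
  have hH2 : ∀ s ∈ I01, ∀ t ∈ I01, pathExp G (fun t => aR₁ t s) t
      = (pathExp G (fun t => a₁ t s) c)⁻¹ * pathExp G (fun t => a₁ t s) (χR t) := by
    intro s hs t ht
    rw [pathExp_comp (ha₁.slice₁ hs) hχR (fun t ht => eR₁ t ht s hs) ht, hR0]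
  have hK1 : ∀ t ∈ I01, ∀ s ∈ I01, pathExp G (fun s => aL₂ t s) s
      = pathExp G (fun s => a₂ (χL t) s) s := fun t ht s hs =>
    pathExp_congr (ha₂.slice₂ (hχL.maps ht)) (fun s hs => eL₂ t ht s hs) hs
  have hK2 : ∀ t ∈ I01, ∀ s ∈ I01, pathExp G (fun s => aR₂ t s) s
      = pathExp G (fun s => a₂ (χR t) s) s := fun t ht s hs =>
    pathExp_congr (ha₂.slice₂ (hχR.maps ht)) (fun s hs => eR₂ t ht s hs) hs
  set f : ℝ → ℝ → VE := fun t s => C.lactL (axial G a₁ a₂ t s) (b t s) with hf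
  have hfs : ∀ s ∈ I01, ContinuousOn (fun t => f t s) I01 := fun s hs =>
    (continuousOn_lactL_axial ha₁ ha₂ hb).slice₁ hs
  have hXL : ∀ s ∈ I01, ∫ t in (0 : ℝ)..1, C.lactL (axial G aL₁ aL₂ t s) (bL t s)
      = ∫ t in (0 : ℝ)..c, f t s := by
    intro s hs
    have := integral_comp_unitMap (hfs s hs) hχL
    rw [hL0, hL1, intervalIntegral.integral_same, sub_zero] at this
    rw [← this]
    refine integral_congr_I01 (fun t ht => ?_) I01_one
    rw [eLb t ht s hs, map_smul, axial, hH1 s hs t ht, hK1 0 I01_zero s hs, hL0]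
    rfl
  -- the axial transport of the right half begins at `(c,0)`, hence the conjugating factor
  have hXR : ∀ s ∈ I01, ∫ t in (0 : ℝ)..1, C.lactL (axial G aR₁ aR₂ t s) (bR t s)
      = C.lactL (pathExp G (fun s => a₂ c s) s * (axial G a₁ a₂ c s)⁻¹)
        ((∫ t in (0 : ℝ)..1, f t s) - ∫ t in (0 : ℝ)..c, f t s) := by
    intro s hs
    have := integral_comp_unitMap (hfs s hs) hχR
    rw [hR0, hR1] at this
    have hc' : ContinuousOn (fun t => χR' t • f (χR t) s) I01 :=
      hχR.cont.smul ((hfs s hs).comp (fun t ht => (hχR.deriv t ht).continuousWithinAt) hχR.maps)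
    rw [← this, clm_integral _ hc' I01_one]
    refine integral_congr_I01 (fun t ht => ?_) I01_one
    rw [eRb t ht s hs, map_smul, map_smul, hf, ← C.lactL_mul, axial, hH2 s hs t ht,
      hK2 0 I01_zero s hs, hR0, axial, axial]
    congr 3
    group
  have hL' := isPathExp_iff.1 hL.isPathExp_surfPath
  have hR' := isPathExp_iff.1 (isPathExp_pathExp (G := E)
    (continuousOn_integral_lactL_axial (C := C) haR₁ haR₂ hbR))
  set X := pathExp G (fun t => a₁ t 0) c with hX
  have hsurf : surfPath C a₁ a₂ b 1
      = C.act X (surfPath C aR₁ aR₂ bR 1) * surfPath C aL₁ aL₂ bL 1 := by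
    refine IsPathExp.pathExp_eq (g := fun s => C.act X (surfPath C aR₁ aR₂ bR s)
      * surfPath C aL₁ aL₂ bL s) (isPathExp_iff.2 ⟨?_, fun s hs => ?_⟩) I01_one
    · rw [surfPath, hR'.1, hL'.1, map_one, one_mul]
    · refine Eq.mp (congrArg (fun X => HasLogDerivWithinAt _ X I01 s) ?_)
        (((hR'.2 s hs).act_const C X).mul (hL'.2 s hs))
      have haxL : axial G aL₁ aL₂ 1 s = axial G a₁ a₂ c s := by
        rw [axial, hH1 s hs 1 I01_one, hK1 0 I01_zero s hs, hL0, hL1, axial]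
      rw [← C.lactL_bd, map_inv, hL.bd_surfPath hs, hXL s hs, hXR s hs, hH1 0 I01_zero 1 I01_one,
        hK1 1 I01_one s hs, haxL, hL1, ← C.lactL_mul, ← C.lactL_mul]
      have (K A : G) : (X * K * A⁻¹)⁻¹ * X * (K * A⁻¹) = 1 := by group
      rw [← hX, this, C.lactL_one, one_apply_eq_self, sub_add_cancel]
  simp only [LieCrossedModule.hcomp, sqHol]
  rw [hsurf, hH1 0 I01_zero 1 I01_one, hH1 1 I01_one 1 I01_one, hH2 0 I01_zero 1 I01_one,
    hH2 1 I01_one 1 I01_one, hK1 0 I01_zero 1 I01_one, hK2 1 I01_one 1 I01_one, hL0, hL1, hR1,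
    mul_inv_cancel_left, mul_inv_cancel_left]

end Path

end Subdivision

/-! ### Reparametrization and subdivision of local holonomies -/

section BundleSubdivision

variable {V M F : Type*} [NormedAddCommGroup V] [NormedSpace ℝ V]
  [TopologicalSpace M] [ChartedSpace V M] [NormedAddCommGroup F] [NormedSpace ℝ F]

theorem IsSmoothCurve.vel_comp {γ : ℝ → M} {W : Set M} (h : IsSmoothCurve V γ W) {χ χ' : ℝ → ℝ}
    (hχ : IsUnitMap χ χ') {t : ℝ} (ht : t ∈ I01) :
    (vel V (fun t => γ (χ t)) t : V) = χ' t • (vel V γ (χ t) : V) :=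
  ((h.hasVel (hχ.maps ht)).comp_real (hχ.deriv t ht) hχ.maps).vel_eq ht

theorem IsSmoothCurve.pull₁_comp {γ : ℝ → M} {W : Set M} (h : IsSmoothCurve V γ W) {χ χ' : ℝ → ℝ}
    (hχ : IsUnitMap χ χ') (w : DForm V M 1 F) {t : ℝ} (ht : t ∈ I01) :
    pull₁ w (fun t => γ (χ t)) t = χ' t • pull₁ w γ (χ t) := by
  have h1 := (w (γ (χ t)) : V [⋀^Fin 1]→L[ℝ] F).map_smul_univ (fun _ => χ' t)
    ![(vel V γ (χ t) : V)]
  rw [Fin.prod_univ_one] at h1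
  rw [pull₁, pull₁, ← h1]
  refine congrArg (w (γ (χ t)) : V [⋀^Fin 1]→L[ℝ] F) ?_
  ext i
  fin_cases i
  exact h.vel_comp hχ ht

theorem pull₁_const (w : DForm V M 1 F) {γ : ℝ → M} {x : M} (hγ : ∀ t ∈ I01, γ t = x) {t : ℝ}
    (ht : t ∈ I01) : pull₁ w γ t = 0 :=
  (w (γ t) : V [⋀^Fin 1]→L[ℝ] F).map_coord_zero 0
    (((hasVelWithinAt_const x I01 t).congr hγ (hγ t ht)).vel_eq ht)

theorem IsSmoothSq.pull₂_comp {S : ℝ → ℝ → M} {W : Set M} (h : IsSmoothSq V S W)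
    {χ₁ χ₁' χ₂ χ₂' : ℝ → ℝ} (hχ₁ : IsUnitMap χ₁ χ₁') (hχ₂ : IsUnitMap χ₂ χ₂')
    (w : DForm V M 2 F) {t s : ℝ} (ht : t ∈ I01) (hs : s ∈ I01) :
    pull₂ w (fun t s => S (χ₁ t) (χ₂ s)) t s = (χ₁' t * χ₂' s) • pull₂ w S (χ₁ t) (χ₂ s) := by
  have h1 := (w (S (χ₁ t) (χ₂ s)) : V [⋀^Fin 2]→L[ℝ] F).map_smul_univ ![χ₁' t, χ₂' s]
    ![(vel V (fun t => S t (χ₂ s)) (χ₁ t) : V), (vel V (fun s => S (χ₁ t) s) (χ₂ s) : V)]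
  rw [Fin.prod_univ_two] at h1
  change _ = (![χ₁' t, χ₂' s] 0 * ![χ₁' t, χ₂' s] 1) • _
  rw [pull₂, pull₂, ← h1]
  refine congrArg (w (S (χ₁ t) (χ₂ s)) : V [⋀^Fin 2]→L[ℝ] F) ?_
  ext i
  fin_cases i
  · exact (h.curve₁ (hχ₂.maps hs)).vel_comp hχ₁ ht
  · exact (h.curve₂ (hχ₁.maps ht)).vel_comp hχ₂ hs

theorem IsSmoothSq.comp {S : ℝ → ℝ → M} {W W' : Set M} (h : IsSmoothSq V S W) {χ₁ χ₂ : ℝ → ℝ}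
    (hχ₁ : ContDiffOn ℝ ∞ χ₁ I01) (hχ₂ : ContDiffOn ℝ ∞ χ₂ I01) (hm₁ : MapsTo χ₁ I01 I01)
    (hm₂ : MapsTo χ₂ I01 I01) (hW : ∀ t ∈ I01, ∀ s ∈ I01, S (χ₁ t) (χ₂ s) ∈ W') :
    IsSmoothSq V (fun t s => S (χ₁ t) (χ₂ s)) W' where
  smooth := h.smooth.comp (f := fun p : ℝ × ℝ => (χ₁ p.1, χ₂ p.2))
    (contMDiffOn_iff_contDiffOn.2
      ((hχ₁.comp contDiff_fst.contDiffOn fun _ hp => hp.1).prodMk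
        (hχ₂.comp contDiff_snd.contDiffOn fun _ hp => hp.2)))
    (fun _ hp => ⟨hm₁ hp.1, hm₂ hp.2⟩)
  mem := hW

theorem IsSmoothCurve.comp {γ : ℝ → M} {W W' : Set M} (h : IsSmoothCurve V γ W) {χ : ℝ → ℝ}
    (hχ : ContDiffOn ℝ ∞ χ I01) (hm : MapsTo χ I01 I01) (hW : ∀ t ∈ I01, γ (χ t) ∈ W') :
    IsSmoothCurve V (fun t => γ (χ t)) W' where
  smooth := h.smooth.comp (f := χ) (contMDiffOn_iff_contDiffOn.2 hχ) hm
  mem := hW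

/-- The first half of the unit interval that is divided at `c`. -/
theorem isUnitMap_left {c : ℝ} (hc : c ∈ I01) : IsUnitMap (fun t => c * t) (fun _ => c) := by
  simpa using isUnitMap_affine I01_zero hc

/-- The second half of the unit interval that is divided at `c`. -/
theorem isUnitMap_right {c : ℝ} (hc : c ∈ I01) :
    IsUnitMap (fun t => c + (1 - c) * t) (fun _ => 1 - c) :=
  isUnitMap_affine hc I01_one

namespace CubicalBundle.Connection

variable {VG VE G E ι : Type*}
  [NormedAddCommGroup VG] [NormedSpace ℝ VG] [NormedAddCommGroup VE] [NormedSpace ℝ VE]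
  [TopologicalSpace G] [ChartedSpace VG G] [Group G]
  [TopologicalSpace E] [ChartedSpace VE E] [Group E]
  {C : LieCrossedModule VG VE G E} {U : ι → Set M} {𝓑 : CubicalBundle V C U}
  (𝓐 : 𝓑.Connection) (hU : ∀ i, IsOpen (U i))
  [IsManifold 𝓘(ℝ, V) ∞ M]
  [LieGroup 𝓘(ℝ, VG) ∞ G] [LieGroup 𝓘(ℝ, VE) ∞ E] [CompleteSpace VG] [CompleteSpace VE]
include hU

section Square

variable {S : ℝ → ℝ → M} {i : ι} (h : IsSmoothSq V S (U i))
include h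

/-- The holonomy of the horizontal strip between the heights `χ₂ 0` and `χ₂ 1`, in arbitrary
parametrization. It contains both the reparametrization and the subdivision by a horizontal line. -/
theorem localHol_strip {χ₁ χ₁' χ₂ χ₂' : ℝ → ℝ} (hχ₁ : IsUnitMap χ₁ χ₁') (hχ₂ : IsUnitMap χ₂ χ₂')
    (h0 : χ₁ 0 = 0) (h1 : χ₁ 1 = 1) :
    localHol C (𝓐.A i) (𝓐.B i) (fun t s => S (χ₁ t) (χ₂ s)) =
      ⟨pathExp G (fun t => pull₁ (𝓐.A i) (fun t => S t (χ₂ 0)) t) 1,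
        (pathExp G (fun s => pull₁ (𝓐.A i) (fun s => S 1 s) s) (χ₂ 0))⁻¹
          * pathExp G (fun s => pull₁ (𝓐.A i) (fun s => S 1 s) s) (χ₂ 1),
        (pathExp G (fun s => pull₁ (𝓐.A i) (fun s => S 0 s) s) (χ₂ 0))⁻¹
          * pathExp G (fun s => pull₁ (𝓐.A i) (fun s => S 0 s) s) (χ₂ 1),
        pathExp G (fun t => pull₁ (𝓐.A i) (fun t => S t (χ₂ 1)) t) 1,
        C.act (pathExp G (fun s => pull₁ (𝓐.A i) (fun s => S 0 s) s) (χ₂ 0))⁻¹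
          ((surfPath C (fun t s => pull₁ (𝓐.A i) (fun t => S t s) t)
            (fun t s => pull₁ (𝓐.A i) (fun s => S t s) s) (pull₂ (𝓐.B i) S) (χ₂ 0))⁻¹
            * surfPath C (fun t s => pull₁ (𝓐.A i) (fun t => S t s) t)
            (fun t s => pull₁ (𝓐.A i) (fun s => S t s) s) (pull₂ (𝓐.B i) S) (χ₂ 1))⟩ :=
  have hf := 𝓐.isFakeFlat hU h
  sqHol_strip hf.cont₁ hf.cont₂ hf.cont_b hχ₁ hχ₂ h0 h1
    (fun _ ht _ hs => (h.curve₁ (hχ₂.maps hs)).pull₁_comp hχ₁ _ ht)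
    (fun _ ht _ hs => (h.curve₂ (hχ₁.maps ht)).pull₁_comp hχ₂ _ hs)
    (fun _ ht _ hs => h.pull₂_comp hχ₁ hχ₂ _ ht hs)

/-- The holonomy of a square is invariant under reparametrizations of the two factors. -/
theorem localHol_reparam {χ₁ χ₁' χ₂ χ₂' : ℝ → ℝ} (hχ₁ : IsUnitMap χ₁ χ₁')
    (hχ₂ : IsUnitMap χ₂ χ₂') (h0 : χ₁ 0 = 0) (h1 : χ₁ 1 = 1) (h0' : χ₂ 0 = 0) (h1' : χ₂ 1 = 1) :
    localHol C (𝓐.A i) (𝓐.B i) (fun t s => S (χ₁ t) (χ₂ s))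
      = localHol C (𝓐.A i) (𝓐.B i) S := by
  have e0 := 𝓐.localHol_strip hU h isUnitMap_id isUnitMap_id rfl rfl
  rw [𝓐.localHol_strip hU h hχ₁ hχ₂ h0 h1, h0', h1', e0]

/-- Subdivision of a square by a horizontal line. -/
theorem localHol_vcomp {c : ℝ} (hc : c ∈ I01) :
    C.vcomp (localHol C (𝓐.A i) (𝓐.B i) (fun t s => S t (c * s)))
      (localHol C (𝓐.A i) (𝓐.B i) (fun t s => S t (c + (1 - c) * s)))
      = localHol C (𝓐.A i) (𝓐.B i) S := by
  have hf := 𝓐.isFakeFlat hU h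
  have e1 := 𝓐.localHol_strip hU h isUnitMap_id (isUnitMap_left hc) rfl rfl
  have e2 := 𝓐.localHol_strip hU h isUnitMap_id (isUnitMap_right hc) rfl rfl
  have e0 := 𝓐.localHol_strip hU h isUnitMap_id isUnitMap_id rfl rfl
  have hs : surfPath C (fun t s => pull₁ (𝓐.A i) (fun t => S t s) t)
      (fun t s => pull₁ (𝓐.A i) (fun s => S t s) s) (pull₂ (𝓐.B i) S) 0 = 1 :=
    (isPathExp_iff.1 hf.isPathExp_surfPath).1
  have hz0 : pathExp G (fun s => pull₁ (𝓐.A i) (fun s => S 0 s) s) 0 = 1 :=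
    pathExp_zero (hf.cont₂.slice₂ I01_zero)
  have hz1 : pathExp G (fun s => pull₁ (𝓐.A i) (fun s => S 1 s) s) 0 = 1 :=
    pathExp_zero (hf.cont₂.slice₂ I01_one)
  rw [e1, e2, e0]
  simp only [LieCrossedModule.vcomp, mul_zero, mul_one, add_zero, add_sub_cancel, hs, hz0, hz1,
    inv_one, one_mul, mul_inv_cancel_left, C.act_act, mul_inv_cancel, map_one, MulAut.one_apply]

/-- Subdivision of a square by a vertical line. -/
theorem localHol_hcomp {c : ℝ} (hc : c ∈ I01) :
    C.hcomp (localHol C (𝓐.A i) (𝓐.B i) (fun t s => S (c * t) s))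
      (localHol C (𝓐.A i) (𝓐.B i) (fun t s => S (c + (1 - c) * t) s))
      = localHol C (𝓐.A i) (𝓐.B i) S := by
  have hf := 𝓐.isFakeFlat hU h
  have hl := isUnitMap_left hc
  have hr := isUnitMap_right hc
  have hL := 𝓐.isFakeFlat hU (h.comp (χ₁ := fun t => c * t) (χ₂ := fun s => s) (W' := U i)
    (by fun_prop) (by fun_prop) hl.maps
    isUnitMap_id.maps (fun t ht s hs => h.mem _ (hl.maps ht) _ hs))
  have hR := 𝓐.isFakeFlat hU (h.comp (χ₁ := fun t => c + (1 - c) * t) (χ₂ := fun s => s)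
    (W' := U i) (by fun_prop) (by fun_prop) hr.maps
    isUnitMap_id.maps (fun t ht s hs => h.mem _ (hr.maps ht) _ hs))
  exact sqHol_hcomp hf.cont₁ hf.cont₂ hf.cont_b hL hR.cont₁ hR.cont₂ hR.cont_b hl hr
    (mul_zero c) (mul_one c) (by simp) (by simp)
    (fun _ ht _ hs => (h.curve₁ hs).pull₁_comp hl _ ht)
    (fun _ _ _ _ => rfl)
    (fun _ ht _ hs => by simpa using h.pull₂_comp hl isUnitMap_id (𝓐.B i) ht hs)
    (fun _ ht _ hs => (h.curve₁ hs).pull₁_comp hr _ ht)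
    (fun _ _ _ _ => rfl)
    (fun _ ht _ hs => by simpa using h.pull₂_comp hr isUnitMap_id (𝓐.B i) ht hs)

end Square

section Curve

variable {γ : ℝ → M} {i j : ι} (h : IsSmoothCurve V γ (U i ∩ U j))
include h

/-- The transition square of the part of a curve between `χ 0` and `χ 1`. -/
theorem tau_comp {χ χ' : ℝ → ℝ} (hχ : IsUnitMap χ χ') (hχs : ContDiffOn ℝ ∞ χ I01) :
    𝓐.tau i j (fun t => γ (χ t))
      = ⟨(pathExp G (pull₁ (𝓐.A i) γ) (χ 0))⁻¹ * pathExp G (pull₁ (𝓐.A i) γ) (χ 1),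
        𝓑.φ i j (γ (χ 1)), 𝓑.φ i j (γ (χ 0)),
        (pathExp G (pull₁ (𝓐.A j) γ) (χ 0))⁻¹ * pathExp G (pull₁ (𝓐.A j) γ) (χ 1),
        C.act (pathExp G (fun t => pull₁ (𝓐.A i) γ t + C.dbdL (pull₁ (𝓐.η i j) γ t)) (χ 0))⁻¹
          ((transPath C (pull₁ (𝓐.A i) γ) (pull₁ (𝓐.η i j) γ) (χ 0))⁻¹
            * transPath C (pull₁ (𝓐.A i) γ) (pull₁ (𝓐.η i j) γ) (χ 1))⟩ := by
  rw [𝓐.tau_eq hU (h.comp hχs hχ.maps fun t ht => h.mem _ (hχ.maps ht))]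
  exact tauSq_comp (φ := fun t => 𝓑.φ i j (γ t))
    ((h.mono inter_subset_left).continuousOn_pull₁ (𝓐.smooth_A i) (hU i))
    ((h.mono inter_subset_right).continuousOn_pull₁ (𝓐.smooth_A j) (hU j))
    (h.continuousOn_pull₁ (𝓐.smooth_η i j) ((hU i).inter (hU j))) hχ
    (fun t ht => h.pull₁_comp hχ _ ht) (fun t ht => h.pull₁_comp hχ _ ht)
    (fun t ht => h.pull₁_comp hχ _ ht)

/-- The transition square of a curve is invariant under reparametrizations. -/
theorem tau_reparam {χ χ' : ℝ → ℝ} (hχ : IsUnitMap χ χ') (hχs : ContDiffOn ℝ ∞ χ I01)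
    (h0 : χ 0 = 0) (h1 : χ 1 = 1) : 𝓐.tau i j (fun t => γ (χ t)) = 𝓐.tau i j γ := by
  have e0 := 𝓐.tau_comp hU h isUnitMap_id contDiffOn_id
  rw [𝓐.tau_comp hU h hχ hχs, h0, h1, e0]

/-- Subdivision of a transition square. -/
theorem tau_hcomp {c : ℝ} (hc : c ∈ I01) :
    C.hcomp (𝓐.tau i j (fun t => γ (c * t))) (𝓐.tau i j (fun t => γ (c + (1 - c) * t)))
      = 𝓐.tau i j γ := by
  have hA : ∀ i, IsSmoothCurve V γ (U i) → ContinuousOn (pull₁ (𝓐.A i) γ) I01 :=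
    fun i h => h.continuousOn_pull₁ (𝓐.smooth_A i) (hU i)
  have hη := h.continuousOn_pull₁ (𝓐.smooth_η i j) ((hU i).inter (hU j))
  have hi := hA i (h.mono inter_subset_left)
  have hj := hA j (h.mono inter_subset_right)
  have hb := bd_transPath (C := C) hi hη hc
  have hF0 : transPath C (pull₁ (𝓐.A i) γ) (pull₁ (𝓐.η i j) γ) 0 = 1 :=
    pathExp_zero (continuousOn_transCoeff hi hη)
  have hg0 : pathExp G (fun t => pull₁ (𝓐.A i) γ t + C.dbdL (pull₁ (𝓐.η i j) γ t)) 0 = 1 :=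
    pathExp_zero (hi.add (C.dbdL.continuous.comp_continuousOn hη))
  rw [𝓐.tau_comp hU h (isUnitMap_left hc) (by fun_prop),
    𝓐.tau_comp hU h (isUnitMap_right hc) (by fun_prop), 𝓐.tau_eq hU h]
  simp only [LieCrossedModule.hcomp, tauSq, mul_zero, mul_one, add_zero, add_sub_cancel, hF0, hg0,
    pathExp_zero hi, pathExp_zero hj, inv_one, one_mul, mul_inv_cancel_left, C.act_act, map_one,
    MulAut.one_apply, ← hb, C.peiffer, inv_mul_cancel_right]

end Curve

/-- The transition square between equal charts is thin. -/
theorem tau_self {γ : ℝ → M} {i : ι} (h : IsSmoothCurve V γ (U i)) :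
    𝓐.tau i i γ = ⟨curveHol G (𝓐.A i) γ, 1, 1, curveHol G (𝓐.A i) γ, 1⟩ := by
  have hη : ∀ t ∈ I01, pull₁ (𝓐.η i i) γ t = 0 := fun t ht => by
    rw [pull₁, 𝓐.η_self i _ (h.mem t ht)]
    rfl
  have he : transPath C (pull₁ (𝓐.A i) γ) (pull₁ (𝓐.η i i) γ) 1 = 1 :=
    pathExp_eq_one (fun t ht => by rw [hη t ht, map_zero, neg_zero]) I01_one
  rw [𝓐.tau_eq hU ⟨h.smooth, fun t ht => ⟨h.mem t ht, h.mem t ht⟩⟩, tauSq, he,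
    𝓑.φ_self i _ (h.mem 1 I01_one), 𝓑.φ_self i _ (h.mem 0 I01_zero)]
  rfl

/-- The transition square of a constant curve is thin. -/
theorem tau_const {x : M} {i j : ι} {γ : ℝ → M} (hγ : ∀ t ∈ I01, γ t = x) (hx : x ∈ U i ∩ U j) :
    𝓐.tau i j γ = ⟨1, 𝓑.φ i j x, 𝓑.φ i j x, 1, 1⟩ := by
  have h : IsSmoothCurve V γ (U i ∩ U j) :=
    ⟨(contMDiffOn_const (c := x)).congr hγ, fun t ht => (hγ t ht).symm ▸ hx⟩
  have he : transPath C (pull₁ (𝓐.A i) γ) (pull₁ (𝓐.η i j) γ) 1 = 1 :=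
    pathExp_eq_one (fun t ht => by rw [pull₁_const _ hγ ht, map_zero, neg_zero]) I01_one
  rw [𝓐.tau_eq hU h, tauSq, he, pathExp_eq_one (fun t ht => pull₁_const _ hγ ht) I01_one,
    pathExp_eq_one (fun t ht => pull₁_const _ hγ ht) I01_one,
    hγ 0 I01_zero, hγ 1 I01_one]

omit hU [IsManifold 𝓘(ℝ, V) ∞ M] [LieGroup 𝓘(ℝ, VG) ∞ G] [LieGroup 𝓘(ℝ, VE) ∞ E]
  [CompleteSpace VG] [CompleteSpace VE]

theorem psiSq_self₁ {i j : ι} {x : M} (hx : x ∈ U i ∩ U j) :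
    𝓐.psiSq i i j j x = ⟨1, 𝓑.φ i j x, 𝓑.φ i j x, 1, 1⟩ := by
  rw [psiSq, (𝓑.ψ_degen i j x hx).1, 𝓑.φ_self i x hx.1, 𝓑.φ_self j x hx.2]

theorem psiSq_self₂ {i j : ι} {x : M} (hx : x ∈ U i ∩ U j) :
    𝓐.psiSq i j i j x = ⟨𝓑.φ i j x, 1, 1, 𝓑.φ i j x, 1⟩ := by
  rw [psiSq, (𝓑.ψ_degen i j x hx).2, 𝓑.φ_self i x hx.1, 𝓑.φ_self j x hx.2]

end CubicalBundle.Connection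

end BundleSubdivision

/-! ### Cells of a partition -/

theorem IsReparam.id : IsReparam (fun t => t) :=
  ⟨contDiffOn_id, monotoneOn_id, rfl, rfl⟩

namespace UnitPartition

variable (P : UnitPartition)

theorem pts_le {a b : ℕ} (h : a ≤ b) (hb : b ≤ P.m + 1) : P.pts a ≤ P.pts b := by
  induction b, h using Nat.le_induction with
  | base => rfl
  | succ n hn ih => exact (ih (by omega)).trans (P.lt n (by omega)).le

theorem pts_mem {a : ℕ} (ha : a ≤ P.m + 1) : P.pts a ∈ I01 :=
  ⟨P.pts_zero ▸ P.pts_le (Nat.zero_le a) ha, P.pts_last ▸ P.pts_le ha le_rfl⟩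

variable {θ : ℝ → ℝ}

theorem cell_mem (hθ : IsReparam θ) {a : ℕ} (ha : a ≤ P.m) {t : ℝ} (ht : t ∈ I01) :
    P.cell θ a t ∈ Icc (P.pts a) (P.pts (a + 1)) := by
  have h := hθ.isUnitMap.maps ht
  have h' := (P.lt a ha).le
  rw [cell]
  constructor
  · nlinarith [h.1]
  · nlinarith [h.2]

theorem cell_mem_I01 (hθ : IsReparam θ) {a : ℕ} (ha : a ≤ P.m) : MapsTo (P.cell θ a) I01 I01 :=
  fun _ ht => ⟨(P.pts_mem (by omega)).1.trans (P.cell_mem hθ ha ht).1,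
    (P.cell_mem hθ ha ht).2.trans (P.pts_mem (by omega)).2⟩

theorem contDiffOn_cell (hθ : IsReparam θ) (a : ℕ) : ContDiffOn ℝ ∞ (P.cell θ a) I01 :=
  contDiffOn_const.add (contDiffOn_const.mul hθ.1)

theorem cell_zero (hθ : IsReparam θ) (a : ℕ) : P.cell θ a 0 = P.pts a := by
  rw [cell, hθ.2.2.1, mul_zero, add_zero]

theorem cell_one (hθ : IsReparam θ) (a : ℕ) : P.cell θ a 1 = P.pts (a + 1) := by
  rw [cell, hθ.2.2.2, mul_one, add_sub_cancel]

theorem left_mem {a : ℕ} (ha : a ≤ P.m) : P.pts a ∈ Icc (P.pts a) (P.pts (a + 1)) :=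
  left_mem_Icc.2 (P.lt a ha).le

theorem right_mem {a : ℕ} (ha : a ≤ P.m) : P.pts (a + 1) ∈ Icc (P.pts a) (P.pts (a + 1)) :=
  right_mem_Icc.2 (P.lt a ha).le

section Insert

variable {P} {k : ℕ} {c : ℝ} (hk : k ≤ P.m) (h₁ : P.pts k < c) (h₂ : c < P.pts (k + 1))

theorem insert_pts_of_le {j : ℕ} (hj : j ≤ k) : (P.insert k c hk h₁ h₂).pts j = P.pts j :=
  if_pos hj

theorem insert_pts_self : (P.insert k c hk h₁ h₂).pts (k + 1) = c := by
  simp [insert]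

theorem insert_pts_succ {j : ℕ} (hj : k < j) :
    (P.insert k c hk h₁ h₂).pts (j + 1) = P.pts j := by
  simp only [insert]
  rw [if_neg (by omega), if_neg (by omega), Nat.add_sub_cancel]

theorem parent_of_le {j : ℕ} (hj : j ≤ k) : parent k j = j := if_pos hj

theorem parent_succ {j : ℕ} (hj : k ≤ j) : parent k (j + 1) = j := by
  rw [parent, if_neg (by omega), Nat.add_sub_cancel]

theorem insert_cell_of_lt {j : ℕ} (hj : j < k) :
    (P.insert k c hk h₁ h₂).cell θ j = P.cell θ j := by
  funext t
  rw [cell, cell, insert_pts_of_le _ _ _ hj.le, insert_pts_of_le _ _ _ hj]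

theorem insert_cell_succ {j : ℕ} (hj : k < j) :
    (P.insert k c hk h₁ h₂).cell θ (j + 1) = P.cell θ j := by
  funext t
  rw [cell, cell, insert_pts_succ _ _ _ hj, insert_pts_succ _ _ _ (by omega)]

/-- The position of the additional point in the parametrization of the divided cell. -/
def ratio (P : UnitPartition) (k : ℕ) (c : ℝ) : ℝ := (c - P.pts k) / (P.pts (k + 1) - P.pts k)

include hk h₁ h₂ in
theorem ratio_mem : P.ratio k c ∈ I01 := by
  have h : 0 < P.pts (k + 1) - P.pts k := sub_pos.2 (P.lt k hk)
  rw [ratio]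
  exact ⟨div_nonneg (by linarith) h.le, (div_le_one h).2 (by linarith)⟩

include hk in
theorem sub_mul_ratio : (P.pts (k + 1) - P.pts k) * P.ratio k c = c - P.pts k :=
  mul_div_cancel₀ _ (sub_pos.2 (P.lt k hk)).ne'

include hk in
theorem cell_ratio : P.cell (fun t => t) k (P.ratio k c) = c := by
  rw [cell, sub_mul_ratio hk, add_sub_cancel]

theorem insert_cell_left (t : ℝ) : (P.insert k c hk h₁ h₂).cell (fun t => t) k t
    = P.cell (fun t => t) k (P.ratio k c * t) := by
  rw [cell, cell, insert_pts_of_le _ _ _ le_rfl, insert_pts_self, ← sub_mul_ratio hk, mul_assoc]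

theorem insert_cell_right (t : ℝ) : (P.insert k c hk h₁ h₂).cell (fun t => t) (k + 1) t
    = P.cell (fun t => t) k (P.ratio k c + (1 - P.ratio k c) * t) := by
  have h := sub_mul_ratio (c := c) hk
  rw [cell, cell, insert_pts_self, insert_pts_succ _ _ _ (by omega)]
  linear_combination (t - 1) * h

end Insert

end UnitPartition

/-! ### Arrays of squares -/

namespace LieCrossedModule

variable {VG VE G E : Type*}
  [NormedAddCommGroup VG] [NormedSpace ℝ VG] [NormedAddCommGroup VE] [NormedSpace ℝ VE]
  [TopologicalSpace G] [ChartedSpace VG G] [Group G]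
  [TopologicalSpace E] [ChartedSpace VE E] [Group E]
  {C : LieCrossedModule VG VE G E}

theorem hchain_e_eq_one {f g : ℕ → Sq G E} {n : ℕ} (hf : ∀ a ≤ n, (f a).e = 1)
    (hg : ∀ a < n, (g a).e = 1) : (C.hchain f g n).e = 1 := by
  induction n with
  | zero => exact hf 0 le_rfl
  | succ n ih =>
    simp only [hchain, hcomp]
    rw [ih (fun a ha => hf a (by omega)) (fun a ha => hg a (by omega)), hg n (by omega),
      hf (n + 1) le_rfl, map_one, map_one, one_mul, one_mul]

theorem hchain_eq_of_idem {f g : ℕ → Sq G E} {s : Sq G E} {n : ℕ} (hf : ∀ a ≤ n, f a = s)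
    (hg : ∀ a < n, g a = s) (hs : C.hcomp s s = s) : C.hchain f g n = s := by
  induction n with
  | zero => exact hf 0 le_rfl
  | succ n ih =>
    rw [hchain, ih (fun a ha => hf a (by omega)) (fun a ha => hg a (by omega)), hg n (by omega),
      hf (n + 1) le_rfl, hs, hs]

variable (C) in
/-- A thin square is a unit for horizontal composition. -/
theorem hcomp_thin {s : Sq G E} {g : G} (h : s.Y = g) : C.hcomp s ⟨1, g, g, 1, 1⟩ = s := by
  subst h
  simp only [hcomp, mul_one, map_one, one_mul]

variable (C) in
/-- A thin square between two squares can be dropped from a column. -/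
theorem vcomp_thin_vcomp (s u : Sq G E) {t : Sq G E} (hY : t.Y = 1) (hZ : t.Z = 1)
    (he : t.e = 1) : C.vcomp (C.vcomp s t) u = C.vcomp s u := by
  simp only [vcomp, hY, hZ, he, mul_one, map_one]

/-- If all side faces of a cube are equal and thin, the upper and the lower face differ by the
action of a group element. -/
theorem IsCube.eq_gact {d u : Sq G E} {g : G}
    (h : C.IsCube ⟨1, g, g, 1, 1⟩ ⟨1, g, g, 1, 1⟩ ⟨1, g, g, 1, 1⟩ ⟨1, g, g, 1, 1⟩ d u) :
    u = C.gact g⁻¹ d := by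
  have e1 := h.q₀₀
  have e2 := h.q₀₁
  have e3 := h.q₁₀
  have e4 := h.q₁₁
  have e5 := h.p₀₀
  have e6 := h.p₀₁
  have e7 := h.p₁₀
  have e8 := h.p₁₁
  have e9 := h.eq
  simp only [map_one, one_mul, mul_one] at e1 e2 e3 e4 e5 e6 e7 e8 e9
  obtain ⟨X, Y, Z, W, e⟩ := d
  obtain ⟨X', Y', Z', W', e'⟩ := u
  simp only at e1 e2 e3 e4 e5 e6 e7 e8 e9
  subst e1 e2 e3 e4 e5 e6 e7 e8 e9
  simp only [gact, inv_inv, mul_one, inv_mul_cancel, C.act_act, map_one, MulAut.one_apply]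

end LieCrossedModule

/-! ### The global holonomy -/

/-- A cell of the finer partition lies in its parent cell. -/
theorem UnitPartition.insert_Icc_subset {P : UnitPartition} {k : ℕ} {c : ℝ} (hk : k ≤ P.m)
    (h₁ : P.pts k < c) (h₂ : c < P.pts (k + 1)) (a : ℕ) :
    Icc ((P.insert k c hk h₁ h₂).pts a) ((P.insert k c hk h₁ h₂).pts (a + 1))
      ⊆ Icc (P.pts (parent k a)) (P.pts (parent k a + 1)) := by
  rcases lt_trichotomy a k with h | rfl | h
  · rw [insert_pts_of_le hk h₁ h₂ h.le, insert_pts_of_le hk h₁ h₂ h, parent_of_le h.le]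
  · rw [insert_pts_of_le hk h₁ h₂ le_rfl, insert_pts_self hk h₁ h₂, parent_of_le le_rfl]
    exact Icc_subset_Icc le_rfl h₂.le
  · obtain ⟨b, rfl⟩ : ∃ b, a = b + 1 := ⟨a - 1, by omega⟩
    rw [parent_succ (by omega), insert_pts_succ hk h₁ h₂ (j := b + 1) (by omega)]
    refine Icc_subset_Icc ?_ le_rfl
    rcases (Nat.lt_succ_iff.1 h).eq_or_lt with rfl | h'
    · rw [insert_pts_self hk h₁ h₂]
      exact h₁.le
    · rw [insert_pts_succ hk h₁ h₂ h']

theorem UnitPartition.parent_le {k j n : ℕ} (hk : k ≤ n) (hj : j ≤ n + 1) : parent k j ≤ n := by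
  rw [parent]
  split_ifs <;> omega

theorem IsAssignment.insert_column {M ι : Type*} {U : ι → Set M} {Γ : ℝ × ℝ → M}
    {P Q : UnitPartition} {idx : ℕ → ℕ → ι} (hidx : IsAssignment U Γ P Q idx) {k : ℕ} {c : ℝ}
    (hk : k ≤ P.m) (h₁ : P.pts k < c) (h₂ : c < P.pts (k + 1)) :
    IsAssignment U Γ (P.insert k c hk h₁ h₂) Q (fun a b => idx (UnitPartition.parent k a) b) :=
  fun a ha b hb t ht s hs => hidx _ (UnitPartition.parent_le hk ha) b hb t
    (UnitPartition.insert_Icc_subset hk h₁ h₂ a ht) s hs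

theorem IsAssignment.insert_row {M ι : Type*} {U : ι → Set M} {Γ : ℝ × ℝ → M}
    {P Q : UnitPartition} {idx : ℕ → ℕ → ι} (hidx : IsAssignment U Γ P Q idx) {k : ℕ} {c : ℝ}
    (hk : k ≤ Q.m) (h₁ : Q.pts k < c) (h₂ : c < Q.pts (k + 1)) :
    IsAssignment U Γ P (Q.insert k c hk h₁ h₂) (fun a b => idx a (UnitPartition.parent k b)) :=
  fun a ha b hb t ht s hs => hidx a ha _ (UnitPartition.parent_le hk hb) t ht s
    (UnitPartition.insert_Icc_subset hk h₁ h₂ b hs)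

theorem IsAssignment.mem_vertical {M ι : Type*} {U : ι → Set M} {Γ : ℝ × ℝ → M}
    {P Q : UnitPartition} {idx : ℕ → ℕ → ι} (hidx : IsAssignment U Γ P Q idx) {a b : ℕ}
    (ha : a < P.m) (hb : b ≤ Q.m) :
    ∀ s ∈ Icc (Q.pts b) (Q.pts (b + 1)),
      Γ (P.pts (a + 1), s) ∈ U (idx a b) ∩ U (idx (a + 1) b) := fun s hs =>
  ⟨hidx a ha.le b hb _ (P.right_mem ha.le) s hs, hidx (a + 1) ha b hb _ (P.left_mem ha) s hs⟩

theorem IsAssignment.mem_horizontal {M ι : Type*} {U : ι → Set M} {Γ : ℝ × ℝ → M}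
    {P Q : UnitPartition} {idx : ℕ → ℕ → ι} (hidx : IsAssignment U Γ P Q idx) {a b : ℕ}
    (ha : a ≤ P.m) (hb : b < Q.m) :
    ∀ t ∈ Icc (P.pts a) (P.pts (a + 1)),
      Γ (t, Q.pts (b + 1)) ∈ U (idx a b) ∩ U (idx a (b + 1)) := fun t ht =>
  ⟨hidx a ha b hb.le t ht _ (Q.right_mem hb.le), hidx a ha (b + 1) hb t ht _ (Q.left_mem hb)⟩

namespace CubicalBundle.Connection

variable {V VG VE G E M ι : Type*} [NormedAddCommGroup V] [NormedSpace ℝ V]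
  [NormedAddCommGroup VG] [NormedSpace ℝ VG] [NormedAddCommGroup VE] [NormedSpace ℝ VE]
  [TopologicalSpace G] [ChartedSpace VG G] [Group G]
  [TopologicalSpace E] [ChartedSpace VE E] [Group E]
  [TopologicalSpace M] [ChartedSpace V M]
  {C : LieCrossedModule VG VE G E} {U : ι → Set M} {𝓑 : CubicalBundle V C U}
  (𝓐 : 𝓑.Connection) (hU : ∀ i, IsOpen (U i))
  [IsManifold 𝓘(ℝ, V) ∞ M]
  [LieGroup 𝓘(ℝ, VG) ∞ G] [LieGroup 𝓘(ℝ, VE) ∞ E] [CompleteSpace VG] [CompleteSpace VE]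
  {θ : ℝ → ℝ} (hθ : IsReparam θ)

section Row

variable {γ : ℝ → M} (hγ : IsSmoothCurve V γ univ) {P : UnitPartition} {i i' : ℕ → ι}
  (hi : ∀ a ≤ P.m, ∀ t ∈ Icc (P.pts a) (P.pts (a + 1)), γ t ∈ U (i a) ∩ U (i' a))

include hγ hθ in
omit [IsManifold 𝓘(ℝ, V) ∞ M] in
theorem isSmoothCurve_cell {a : ℕ} (ha : a ≤ P.m) {W : Set M}
    (hW : ∀ t ∈ Icc (P.pts a) (P.pts (a + 1)), γ t ∈ W) :
    IsSmoothCurve V (fun t => γ (P.cell θ a t)) W :=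
  hγ.comp (P.contDiffOn_cell hθ a) (P.cell_mem_I01 hθ ha)
    (fun _ ht => hW _ (P.cell_mem hθ ha ht))

include hU hθ hγ hi

theorem tauRow_reparam : 𝓐.tauRow θ γ P i i' = 𝓐.tauRow (fun t => t) γ P i i' :=
  LieCrossedModule.hchain_congr (fun a ha => 𝓐.tau_reparam hU
    (isSmoothCurve_cell IsReparam.id hγ ha (hi a ha)) hθ.isUnitMap hθ.1 hθ.2.2.1 hθ.2.2.2)
    (fun _ _ => rfl)

omit hθ in
/-- Invariance of a transition row under subdivision: the halves of the divided curve merge,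
because the square between them is thin. -/
theorem tauRow_insert {k : ℕ} {c : ℝ} (hk : k ≤ P.m) (h₁ : P.pts k < c) (h₂ : c < P.pts (k + 1)) :
    𝓐.tauRow (fun t => t) γ (P.insert k c hk h₁ h₂) (fun a => i (UnitPartition.parent k a))
      (fun a => i' (UnitPartition.parent k a)) = 𝓐.tauRow (fun t => t) γ P i i' := by
  refine LieCrossedModule.hchain_insert (k := k) hk (fun a ha => ?_) (fun a ha => ?_) ?_
    (fun a ha _ => ?_) (fun a ha _ => ?_)
  · simp only [UnitPartition.parent_of_le ha.le, UnitPartition.insert_cell_of_lt hk h₁ h₂ ha]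
  · simp only [UnitPartition.parent_of_le ha.le, UnitPartition.parent_of_le ha,
      UnitPartition.insert_pts_of_le hk h₁ h₂ ha]
  · have hc := UnitPartition.ratio_mem hk h₁ h₂
    have hs := isSmoothCurve_cell IsReparam.id hγ hk (hi k hk)
    simp only [UnitPartition.parent_of_le le_rfl, UnitPartition.parent_succ le_rfl,
      UnitPartition.insert_cell_left hk h₁ h₂, UnitPartition.insert_cell_right hk h₁ h₂,
      UnitPartition.insert_pts_self hk h₁ h₂]
    rw [𝓐.psiSq_self₁ (hi k hk c ⟨h₁.le, h₂.le⟩), C.hcomp_thin]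
    · exact 𝓐.tau_hcomp hU hs hc
    · simp only [tau, mul_one, UnitPartition.cell_ratio hk]
  · simp only [UnitPartition.parent_succ ha.le, UnitPartition.insert_cell_succ hk h₁ h₂ ha]
  · simp only [UnitPartition.parent_succ ha, UnitPartition.parent_succ (ha.trans (Nat.le_succ a)),
      UnitPartition.insert_pts_succ hk h₁ h₂ (Nat.lt_succ_of_le ha)]

end Row

section Constant

include hU in
/-- The transition row of a constant curve, with constant charts, is a thin square. -/
theorem tauRow_const {γ : ℝ → M} {x : M} (hγ : ∀ t ∈ I01, γ t = x) {P : UnitPartition}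
    {i i' : ℕ → ι} {j j' : ι} (hi : ∀ a ≤ P.m, i a = j ∧ i' a = j') (hx : x ∈ U j ∩ U j')
    (hθ : IsReparam θ) :
    𝓐.tauRow θ γ P i i' = ⟨1, 𝓑.φ j j' x, 𝓑.φ j j' x, 1, 1⟩ := by
  refine LieCrossedModule.hchain_eq_of_idem (fun a ha => ?_) (fun a ha => ?_)
    (C.hcomp_thin rfl)
  · rw [(hi a ha).1, (hi a ha).2]
    exact 𝓐.tau_const hU (fun t ht => hγ _ (P.cell_mem_I01 hθ ha ht)) hx
  · rw [(hi a ha.le).1, (hi a ha.le).2, (hi (a + 1) ha).1, (hi (a + 1) ha).2,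
      hγ _ (P.pts_mem (by omega)), 𝓐.psiSq_self₁ hx]

end Constant

section Square

variable {Γ : ℝ × ℝ → M} (hΓ : IsSmoothSq V (fun t s => Γ (t, s)) univ)
  {P Q : UnitPartition} {idx : ℕ → ℕ → ι} (hidx : IsAssignment U Γ P Q idx)

include hΓ hθ in
omit [IsManifold 𝓘(ℝ, V) ∞ M] in
theorem isSmoothSq_cell {a b : ℕ} (ha : a ≤ P.m) (hb : b ≤ Q.m) {W : Set M}
    (hW : ∀ t ∈ Icc (P.pts a) (P.pts (a + 1)), ∀ s ∈ Icc (Q.pts b) (Q.pts (b + 1)),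
      Γ (t, s) ∈ W) :
    IsSmoothSq V (fun t s => Γ (P.cell θ a t, Q.cell θ b s)) W :=
  hΓ.comp (P.contDiffOn_cell hθ a) (Q.contDiffOn_cell hθ b) (P.cell_mem_I01 hθ ha)
    (Q.cell_mem_I01 hθ hb) (fun _ ht _ hs => hW _ (P.cell_mem hθ ha ht) _ (Q.cell_mem hθ hb hs))

include hΓ hθ in
omit [IsManifold 𝓘(ℝ, V) ∞ M] in
theorem isSmoothCurve_vertical {a b : ℕ} (ha : a ≤ P.m + 1) (hb : b ≤ Q.m) {W : Set M}
    (hW : ∀ s ∈ Icc (Q.pts b) (Q.pts (b + 1)), Γ (P.pts a, s) ∈ W) :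
    IsSmoothCurve V (fun s => Γ (P.pts a, Q.cell θ b s)) W :=
  isSmoothCurve_cell (γ := fun s => Γ (P.pts a, s)) hθ (hΓ.curve₂ (P.pts_mem ha)) hb hW

include hΓ hθ in
omit [IsManifold 𝓘(ℝ, V) ∞ M] in
theorem isSmoothCurve_horizontal {a b : ℕ} (ha : a ≤ P.m) (hb : b ≤ Q.m + 1) {W : Set M}
    (hW : ∀ t ∈ Icc (P.pts a) (P.pts (a + 1)), Γ (t, Q.pts b) ∈ W) :
    IsSmoothCurve V (fun t => Γ (P.cell θ a t, Q.pts b)) W :=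
  isSmoothCurve_cell (γ := fun t => Γ (t, Q.pts b)) hθ (hΓ.curve₁ (Q.pts_mem hb)) ha hW

include hU hΓ hidx

include hθ in
theorem holRow_reparam {b : ℕ} (hb : b ≤ Q.m) :
    𝓐.holRow θ Γ P Q idx b = 𝓐.holRow (fun t => t) Γ P Q idx b :=
  LieCrossedModule.hchain_congr
    (fun a ha => 𝓐.localHol_reparam hU (isSmoothSq_cell IsReparam.id hΓ ha hb (hidx a ha b hb))
      hθ.isUnitMap hθ.isUnitMap hθ.2.2.1 hθ.2.2.2 hθ.2.2.1 hθ.2.2.2)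
    (fun a ha => congrArg Sq.diag (𝓐.tau_reparam hU
      (isSmoothCurve_vertical IsReparam.id hΓ (by omega) hb (hidx.mem_vertical ha hb))
      hθ.isUnitMap hθ.1 hθ.2.2.1 hθ.2.2.2))

include hθ in
theorem hol_reparam : 𝓐.hol θ Γ P Q idx = 𝓐.hol (fun t => t) Γ P Q idx :=
  LieCrossedModule.vchain_congr (fun b hb => 𝓐.holRow_reparam hU hθ hΓ hidx hb)
    (fun b hb => 𝓐.tauRow_reparam hU hθ (hΓ.curve₁ (Q.pts_mem (by omega)))
      (fun a ha => hidx.mem_horizontal ha hb))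

/-- Invariance of a row of rectangles under the division of a column: the halves of the divided
rectangle merge, because the square of the edge between them is thin. -/
theorem holRow_insert {k : ℕ} {c : ℝ} (hk : k ≤ P.m) (h₁ : P.pts k < c) (h₂ : c < P.pts (k + 1))
    {b : ℕ} (hb : b ≤ Q.m) :
    𝓐.holRow (fun t => t) Γ (P.insert k c hk h₁ h₂) Q
      (fun a b => idx (UnitPartition.parent k a) b) b = 𝓐.holRow (fun t => t) Γ P Q idx b := by
  refine LieCrossedModule.hchain_insert (k := k) hk (fun a ha => ?_) (fun a ha => ?_) ?_
    (fun a ha _ => ?_) (fun a ha _ => ?_)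
  · simp only [UnitPartition.parent_of_le ha.le, UnitPartition.insert_cell_of_lt hk h₁ h₂ ha]
  · simp only [UnitPartition.parent_of_le ha.le, UnitPartition.parent_of_le ha,
      UnitPartition.insert_pts_of_le hk h₁ h₂ ha]
  · have hc := UnitPartition.ratio_mem hk h₁ h₂
    have hs := isSmoothSq_cell IsReparam.id hΓ hk hb (hidx k hk b hb)
    simp only [UnitPartition.parent_of_le le_rfl, UnitPartition.parent_succ le_rfl,
      UnitPartition.insert_cell_left hk h₁ h₂, UnitPartition.insert_cell_right hk h₁ h₂,
      UnitPartition.insert_pts_self hk h₁ h₂]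
    have hcurve := hs.curve₂ hc
    simp only [UnitPartition.cell_ratio hk] at hcurve
    -- the edge between the halves has the same chart on both sides
    rw [𝓐.tau_self hU hcurve, Sq.diag, inv_one, C.hcomp_thin]
    · exact 𝓐.localHol_hcomp hU hs hc
    · simp only [localHol, mul_one, UnitPartition.cell_ratio hk]
  · simp only [UnitPartition.parent_succ ha.le, UnitPartition.insert_cell_succ hk h₁ h₂ ha]
  · simp only [UnitPartition.parent_succ ha, UnitPartition.parent_succ (ha.trans (Nat.le_succ a)),
      UnitPartition.insert_pts_succ hk h₁ h₂ (Nat.lt_succ_of_le ha)]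

/-- Invariance of the holonomy under the subdivision of a column. -/
theorem hol_insert_column {k : ℕ} {c : ℝ} (hk : k ≤ P.m) (h₁ : P.pts k < c)
    (h₂ : c < P.pts (k + 1)) :
    𝓐.hol (fun t => t) Γ (P.insert k c hk h₁ h₂) Q
      (fun a b => idx (UnitPartition.parent k a) b) = 𝓐.hol (fun t => t) Γ P Q idx :=
  LieCrossedModule.vchain_congr (fun _ hb => 𝓐.holRow_insert hU hΓ hidx hk h₁ h₂ hb)
    (fun b hb => 𝓐.tauRow_insert (γ := fun t => Γ (t, Q.pts (b + 1))) (i := fun a => idx a b)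
      (i' := fun a => idx a (b + 1)) hU
      (hΓ.curve₁ (Q.pts_mem (by omega))) (fun a ha => hidx.mem_horizontal ha hb) hk h₁ h₂)

/-- Invariance of the holonomy under the subdivision of a row. The row of horizontal edges between
the two halves consists of thin squares and can be dropped; then the interchange law merges the
halves column by column. -/
theorem hol_insert_row {k : ℕ} {c : ℝ} (hk : k ≤ Q.m) (h₁ : Q.pts k < c)
    (h₂ : c < Q.pts (k + 1)) :
    𝓐.hol (fun t => t) Γ P (Q.insert k c hk h₁ h₂)
      (fun a b => idx a (UnitPartition.parent k b)) = 𝓐.hol (fun t => t) Γ P Q idx := by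
  refine LieCrossedModule.vchain_insert (k := k) hk (fun b hb => ?_) (fun b hb => ?_) ?_
    (fun b hb _ => ?_) (fun b hb _ => ?_)
  · simp only [holRow, UnitPartition.parent_of_le hb.le,
      UnitPartition.insert_cell_of_lt hk h₁ h₂ hb]
  · simp only [UnitPartition.parent_of_le hb.le, UnitPartition.parent_of_le hb,
      UnitPartition.insert_pts_of_le hk h₁ h₂ hb]
  · have hc := UnitPartition.ratio_mem hk h₁ h₂
    have hs : ∀ a ≤ P.m, IsSmoothSq V (fun t s => Γ (P.cell (fun t => t) a t,
        Q.cell (fun t => t) k s)) (U (idx a k)) :=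
      fun a ha => isSmoothSq_cell IsReparam.id hΓ ha hk (hidx a ha k hk)
    have hv : ∀ a < P.m, IsSmoothCurve V (fun s => Γ (P.pts (a + 1), Q.cell (fun t => t) k s))
        (U (idx a k) ∩ U (idx (a + 1) k)) := fun a ha =>
      isSmoothCurve_vertical IsReparam.id hΓ (by omega) hk (hidx.mem_vertical ha hk)
    have hcurve : ∀ a ≤ P.m, IsSmoothCurve V (fun t => Γ (P.cell (fun t => t) a t, c))
        (U (idx a k)) := fun a ha => by
      simpa only [UnitPartition.cell_ratio hk] using (hs a ha).curve₁ hc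
    have hp : ∀ a < P.m, Γ (P.pts (a + 1), c) ∈ U (idx a k) ∩ U (idx (a + 1) k) := fun a ha =>
      hidx.mem_vertical ha hk c ⟨h₁.le, h₂.le⟩
    have hl := isUnitMap_left hc
    have hsL : ∀ a ≤ P.m, IsSmoothSq V (fun t s => Γ (P.cell (fun t => t) a t,
        Q.cell (fun t => t) k (Q.ratio k c * s))) (U (idx a k)) := fun a ha =>
      (hs a ha).comp (χ₁ := fun t => t) (χ₂ := fun s => Q.ratio k c * s) (by fun_prop)
        (by fun_prop) isUnitMap_id.maps hl.maps
        (fun t ht s hs' => (hs a ha).mem t ht _ (hl.maps hs'))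
    have hvL : ∀ a < P.m, IsSmoothCurve V (fun s => Γ (P.pts (a + 1),
        Q.cell (fun t => t) k (Q.ratio k c * s))) (U (idx a k) ∩ U (idx (a + 1) k)) := fun a ha =>
      (hv a ha).comp (χ := fun s => Q.ratio k c * s) (by fun_prop) hl.maps
        (fun s hs' => (hv a ha).mem _ (hl.maps hs'))
    simp only [holRow, tauRow, UnitPartition.parent_of_le le_rfl, UnitPartition.parent_succ le_rfl,
      UnitPartition.insert_cell_left hk h₁ h₂, UnitPartition.insert_cell_right hk h₁ h₂,
      UnitPartition.insert_pts_self hk h₁ h₂]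
    -- the side conditions of the two rewriting steps: the lower squares are flat, adjacent edges
    -- match, and the row between the halves is thin
    rw [C.vcomp_thin_vcomp, LieCrossedModule.vcomp_hchain]
    · refine LieCrossedModule.hchain_congr (fun a ha => 𝓐.localHol_vcomp hU (hs a ha) hc)
        (fun a ha => ?_)
      rw [← C.diag_hcomp, 𝓐.tau_hcomp hU (hv a ha) hc]
    · exact fun a ha => (𝓐.isFakeFlat hU (hsL a ha)).sqFlat
    · exact fun a ha => (𝓐.sqFlat_tau hU (hvL a ha)).diag
    · intro a _
      simp only [localHol, tau, Sq.diag, P.cell_one IsReparam.id]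
    · intro a _
      simp only [localHol, tau, Sq.diag, P.cell_zero IsReparam.id]
    · intro a _
      simp only [localHol, mul_one, mul_zero, add_zero]
    · intro a _
      simp only [tau, Sq.diag, mul_one, mul_zero, add_zero]
    · rw [LieCrossedModule.hchain_Y, 𝓐.tau_self hU (hcurve P.m le_rfl)]
    · rw [LieCrossedModule.hchain_Z, 𝓐.tau_self hU (hcurve 0 (Nat.zero_le _))]
    · refine LieCrossedModule.hchain_e_eq_one (fun a ha => ?_) (fun a ha => ?_)
      · rw [𝓐.tau_self hU (hcurve a ha)]
      · rw [𝓐.psiSq_self₂ (hp a ha)]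
  · simp only [holRow, UnitPartition.parent_succ hb.le,
      UnitPartition.insert_cell_succ hk h₁ h₂ hb]
  · simp only [UnitPartition.parent_succ hb, UnitPartition.parent_succ (hb.trans (Nat.le_succ b)),
      UnitPartition.insert_pts_succ hk h₁ h₂ (Nat.lt_succ_of_le hb)]

variable {idx' : ℕ → ℕ → ι} (hidx' : IsAssignment U Γ P Q idx')
include hidx' hθ

/-- The cube over a row of rectangles: the cubes over the rectangles alternate with those over the
vertical edges, which are mirror images of cubes over curves in four charts. -/
theorem isCube_holRow {b : ℕ} (hb : b ≤ Q.m) :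
    C.IsCube (𝓐.tau (idx 0 b) (idx' 0 b) (fun s => Γ (P.pts 0, Q.cell θ b s)))
      (𝓐.tau (idx P.m b) (idx' P.m b) (fun s => Γ (P.pts (P.m + 1), Q.cell θ b s)))
      (𝓐.tauRow θ (fun t => Γ (t, Q.pts b)) P (fun a => idx a b) (fun a => idx' a b))
      (𝓐.tauRow θ (fun t => Γ (t, Q.pts (b + 1))) P (fun a => idx a b) (fun a => idx' a b))
      (𝓐.holRow θ Γ P Q idx b) (𝓐.holRow θ Γ P Q idx' b) := by
  refine LieCrossedModule.IsCube.hchain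
    (l := fun a => 𝓐.tau (idx a b) (idx' a b) (fun s => Γ (P.pts a, Q.cell θ b s)))
    (r := fun a => 𝓐.tau (idx a b) (idx' a b) (fun s => Γ (P.pts (a + 1), Q.cell θ b s)))
    (fun a ha => ?_) (fun a ha => ?_)
  · have := 𝓐.isCube_localHol hU (isSmoothSq_cell hθ hΓ ha hb (W := U (idx a b) ∩ U (idx' a b))
      (fun t ht s hs => ⟨hidx a ha b hb t ht s hs, hidx' a ha b hb t ht s hs⟩))
    simpa only [P.cell_zero hθ, P.cell_one hθ, Q.cell_zero hθ, Q.cell_one hθ] using this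
  · have := (𝓐.isCube_psiSq hU (isSmoothCurve_vertical hθ hΓ (a := a + 1) (by omega) hb
      (W := U (idx a b) ∩ U (idx (a + 1) b) ∩ U (idx' a b) ∩ U (idx' (a + 1) b))
      (fun s hs => ⟨⟨hidx.mem_vertical ha hb s hs, (hidx'.mem_vertical ha hb s hs).1⟩,
        (hidx'.mem_vertical ha hb s hs).2⟩))).swap
    simpa only [Q.cell_zero hθ, Q.cell_one hθ] using this

/-- The cube over the row of horizontal edges between two rows of rectangles: the cubes over the
edges alternate with those at the interior vertices. -/
theorem isCube_tauRow {b : ℕ} (hb : b < Q.m) :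
    C.IsCube
      (𝓐.psiSq (idx 0 b) (idx 0 (b + 1)) (idx' 0 b) (idx' 0 (b + 1)) (Γ (P.pts 0, Q.pts (b + 1))))
      (𝓐.psiSq (idx P.m b) (idx P.m (b + 1)) (idx' P.m b) (idx' P.m (b + 1))
        (Γ (P.pts (P.m + 1), Q.pts (b + 1))))
      (𝓐.tauRow θ (fun t => Γ (t, Q.pts (b + 1))) P (fun a => idx a b) (fun a => idx' a b))
      (𝓐.tauRow θ (fun t => Γ (t, Q.pts (b + 1))) P (fun a => idx a (b + 1))
        (fun a => idx' a (b + 1)))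
      (𝓐.tauRow θ (fun t => Γ (t, Q.pts (b + 1))) P (fun a => idx a b) (fun a => idx a (b + 1)))
      (𝓐.tauRow θ (fun t => Γ (t, Q.pts (b + 1))) P (fun a => idx' a b)
        (fun a => idx' a (b + 1))) := by
  have hmem : ∀ a ≤ P.m, ∀ t ∈ Icc (P.pts a) (P.pts (a + 1)), Γ (t, Q.pts (b + 1))
      ∈ U (idx a b) ∩ U (idx a (b + 1)) ∩ U (idx' a b) ∩ U (idx' a (b + 1)) := fun a ha t ht =>
    ⟨⟨hidx.mem_horizontal ha hb t ht, (hidx'.mem_horizontal ha hb t ht).1⟩,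
      (hidx'.mem_horizontal ha hb t ht).2⟩
  refine LieCrossedModule.IsCube.hchain
    (l := fun a => 𝓐.psiSq (idx a b) (idx a (b + 1)) (idx' a b) (idx' a (b + 1))
      (Γ (P.pts a, Q.pts (b + 1))))
    (r := fun a => 𝓐.psiSq (idx a b) (idx a (b + 1)) (idx' a b) (idx' a (b + 1))
      (Γ (P.pts (a + 1), Q.pts (b + 1))))
    (fun a ha => ?_) (fun a ha => ?_)
  · have := 𝓐.isCube_psiSq hU (isSmoothCurve_horizontal hθ hΓ ha (b := b + 1) (by omega)
      (hmem a ha))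
    simpa only [P.cell_zero hθ, P.cell_one hθ] using this
  · have h1 := hmem a ha.le _ (P.right_mem ha.le)
    have h2 := hmem (a + 1) ha _ (P.left_mem ha)
    exact 𝓐.isCube_vertex ⟨⟨⟨h1.1.1.1, h2.1.1.1⟩, h1.1.1.2⟩, h2.1.1.2⟩
      ⟨⟨⟨h1.1.2, h2.1.2⟩, h1.2⟩, h2.2⟩

/-- The cube over the whole square: the cubes over the rows of rectangles and over the rows of
horizontal edges, composed from the bottom to the top. -/
theorem isCube_hol :
    C.IsCube (𝓐.tauRow θ (fun s => Γ (0, s)) Q (fun b => idx 0 b) (fun b => idx' 0 b))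
      (𝓐.tauRow θ (fun s => Γ (1, s)) Q (fun b => idx P.m b) (fun b => idx' P.m b))
      (𝓐.tauRow θ (fun t => Γ (t, 0)) P (fun a => idx a 0) (fun a => idx' a 0))
      (𝓐.tauRow θ (fun t => Γ (t, 1)) P (fun a => idx a Q.m) (fun a => idx' a Q.m))
      (𝓐.hol θ Γ P Q idx) (𝓐.hol θ Γ P Q idx') := by
  have := LieCrossedModule.IsCube.vchain (n := Q.m)
    (fun b hb => 𝓐.isCube_holRow hU hθ hΓ hidx hidx' hb)
    (fun b hb => 𝓐.isCube_tauRow hU hθ hΓ hidx hidx' hb)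
  simp only [P.pts_zero, P.pts_last, Q.pts_zero, Q.pts_last] at this
  exact this

end Square

end CubicalBundle.Connection

end

theorem mainTheorem7 {V VG VE G E M ι : Type*}
    [NormedAddCommGroup V] [NormedSpace ℝ V] [FiniteDimensional ℝ V]
    [NormedAddCommGroup VG] [NormedSpace ℝ VG] [FiniteDimensional ℝ VG]
    [NormedAddCommGroup VE] [NormedSpace ℝ VE] [FiniteDimensional ℝ VE]
    [TopologicalSpace G] [ChartedSpace VG G] [Group G] [LieGroup 𝓘(ℝ, VG) ∞ G]
    [TopologicalSpace E] [ChartedSpace VE E] [Group E] [LieGroup 𝓘(ℝ, VE) ∞ E]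
    [TopologicalSpace M] [ChartedSpace V M] [IsManifold 𝓘(ℝ, V) ∞ M]
    (C : LieCrossedModule VG VE G E)
    (U : ι → Set M) (hUopen : ∀ i, IsOpen (U i)) (hUcover : ⋃ i, U i = univ)
    (𝓑 : CubicalBundle V C U) (𝓐 : 𝓑.Connection)
    (Γ : ℝ × ℝ → M)
    (hΓ : ContMDiffOn 𝓘(ℝ, ℝ × ℝ) 𝓘(ℝ, V) ∞ Γ (Icc (0 : ℝ) 1 ×ˢ Icc (0 : ℝ) 1))
    (P Q : UnitPartition) (idx : ℕ → ℕ → ι) (hidx : IsAssignment U Γ P Q idx) :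
    -- the holonomy does not depend on the reparametrization of the rectangles
    (∀ θ θ' : ℝ → ℝ, IsReparam θ → IsReparam θ' →
      𝓐.hol θ Γ P Q idx = 𝓐.hol θ' Γ P Q idx) ∧
    ∀ θ : ℝ → ℝ, IsReparam θ →
      -- subdividing a column
      (∀ (k : ℕ) (c : ℝ) (hk : k ≤ P.m) (h₁ : P.pts k < c) (h₂ : c < P.pts (k + 1)),
        𝓐.hol θ Γ (P.insert k c hk h₁ h₂) Q (fun a b => idx (UnitPartition.parent k a) b)
          = 𝓐.hol θ Γ P Q idx) ∧
      -- subdividing a row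
      (∀ (k : ℕ) (c : ℝ) (hk : k ≤ Q.m) (h₁ : Q.pts k < c) (h₂ : c < Q.pts (k + 1)),
        𝓐.hol θ Γ P (Q.insert k c hk h₁ h₂) (fun a b => idx a (UnitPartition.parent k b))
          = 𝓐.hol θ Γ P Q idx) ∧
      ∀ idx' : ℕ → ℕ → ι, IsAssignment U Γ P Q idx' →
        -- coherence law
        (∃ T : Cube G E, C.CubeFlat T ∧
          T.face₃ false = 𝓐.hol θ Γ P Q idx ∧
          T.face₃ true = 𝓐.hol θ Γ P Q idx' ∧
          T.face₁ false = 𝓐.tauRow θ (fun s => Γ (0, s)) Q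
            (fun b => idx 0 b) (fun b => idx' 0 b) ∧
          T.face₁ true = 𝓐.tauRow θ (fun s => Γ (1, s)) Q
            (fun b => idx P.m b) (fun b => idx' P.m b) ∧
          T.face₂ false = 𝓐.tauRow θ (fun t => Γ (t, 0)) P
            (fun a => idx a 0) (fun a => idx' a 0) ∧
          T.face₂ true = 𝓐.tauRow θ (fun t => Γ (t, 1)) P
            (fun a => idx a Q.m) (fun a => idx' a Q.m)) ∧
        -- spheres
        (∀ (x : M) (i i' : ι),
          (∀ t ∈ Icc (0 : ℝ) 1,
            Γ (t, 0) = x ∧ Γ (t, 1) = x ∧ Γ (0, t) = x ∧ Γ (1, t) = x) →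
          (∀ a ≤ P.m, ∀ b ≤ Q.m, (a = 0 ∨ a = P.m ∨ b = 0 ∨ b = Q.m) →
            idx a b = i ∧ idx' a b = i') →
          𝓐.hol θ Γ P Q idx' = C.gact (𝓑.φ i i' x)⁻¹ (𝓐.hol θ Γ P Q idx)) := by
  have : CompleteSpace VG := FiniteDimensional.complete ℝ VG
  have : CompleteSpace VE := FiniteDimensional.complete ℝ VE
  have hS : IsSmoothSq V (fun t s => Γ (t, s)) univ := ⟨hΓ, fun _ _ _ _ => mem_univ _⟩
  have hrep := fun (P Q : UnitPartition) (idx : ℕ → ℕ → ι) (h : IsAssignment U Γ P Q idx)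
    (θ : ℝ → ℝ) (hθ : IsReparam θ) => 𝓐.hol_reparam hUopen hθ hS h
  refine ⟨fun θ θ' hθ hθ' => by rw [hrep P Q idx hidx θ hθ, hrep P Q idx hidx θ' hθ'],
    fun θ hθ => ⟨fun k c hk h₁ h₂ => ?_, fun k c hk h₁ h₂ => ?_, fun idx' hidx' => ⟨?_, ?_⟩⟩⟩
  · rw [hrep _ _ _ (hidx.insert_column hk h₁ h₂) θ hθ, hrep P Q idx hidx θ hθ,
      𝓐.hol_insert_column hUopen hS hidx hk h₁ h₂]
  · rw [hrep _ _ _ (hidx.insert_row hk h₁ h₂) θ hθ, hrep P Q idx hidx θ hθ,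
      𝓐.hol_insert_row hUopen hS hidx hk h₁ h₂]
  · exact (𝓐.isCube_hol hUopen hθ hS hidx hidx').exists_cubeFlat
  · intro x i i' hx hi
    have hcube := 𝓐.isCube_hol hUopen hθ hS hidx hidx'
    -- `x` is the image of the corner `(0,0)`, where the charts are `i` and `i'`
    have hxU : x ∈ U i ∩ U i' := by
      have h00 : Γ (P.pts 0, Q.pts 0) = x := by
        rw [P.pts_zero, Q.pts_zero]
        exact (hx 0 I01_zero).1
      obtain ⟨h1, h2⟩ := hi 0 (Nat.zero_le _) 0 (Nat.zero_le _) (Or.inl rfl)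
      rw [← h1, ← h2, ← h00]
      exact ⟨hidx 0 (Nat.zero_le _) 0 (Nat.zero_le _) _ (P.left_mem (Nat.zero_le _)) _
          (Q.left_mem (Nat.zero_le _)),
        hidx' 0 (Nat.zero_le _) 0 (Nat.zero_le _) _ (P.left_mem (Nat.zero_le _)) _
          (Q.left_mem (Nat.zero_le _))⟩
    -- all four side faces are the same thin square
    rw [𝓐.tauRow_const hUopen (fun t ht => (hx t ht).2.2.1)
        (fun b hb => hi 0 (Nat.zero_le _) b hb (Or.inl rfl)) hxU hθ,
      𝓐.tauRow_const hUopen (fun t ht => (hx t ht).2.2.2)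
        (fun b hb => hi P.m le_rfl b hb (Or.inr (Or.inl rfl))) hxU hθ,
      𝓐.tauRow_const hUopen (fun t ht => (hx t ht).1)
        (fun a ha => hi a ha 0 (Nat.zero_le _) (Or.inr (Or.inr (Or.inl rfl)))) hxU hθ,
      𝓐.tauRow_const hUopen (fun t ht => (hx t ht).2.1)
        (fun a ha => hi a ha Q.m le_rfl (Or.inr (Or.inr (Or.inr rfl)))) hxU hθ] at hcube
    exact hcube.eq_gact
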